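/- Let $d\in\mathbb N$, $T>0$, $1/3<\gamma\le 1/2$, and let $(\Omega,\mathcal F,\mathbb P)$ be a probability space. **Rough paths.** A $\gamma$-rough path is a pair $\mathbf X=(X,\mathbb X)$ with $X\in\mathcal C^\gamma([0,T];\mathbb R^d)$, $\mathbb X:[0,T]^2\to\mathbb R^{d\times d}$ continuous, $\mathbb X_{s,s}=0$, $\|\mathbb X\|_{2\gamma}:=\sup_{s\ne t}|\mathbb X_{s,t}|/|t-s|^{2\gamma}<\infty$, and $\mathbb X^{ij}_{s,t}-\mathbb X^{ij}_{s,u}-\mathbb X^{ij}_{u,t}=(X^i_u-X^i_s)(X^j_t-X^j_u)$ for $s\le u\le t$. The distance of two rough paths is $\|\mathbf X-\mathbf Y\|_{\mathcal R^\gamma}=|X_0-Y_0|+[X-Y]_\gamma+\|\mathbb X-\mathbb Y\|_{2\gamma}$, where $[\cdot]_\gamma$ is the Hölder seminorm. The natural lift of $X\in C^1([0,T];\mathbb R^d)$ has $\mathbb X_{s,t}=\int_s^t(X_r-X_s)\otimes\dot X_r\,dr$. The rough path $\mathbf X$ is geometric if it is the limit in this distance of a sequence of natural lifts of $C^1$ paths.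 **Assumptions.** Let $X=(X_t)_{t\in[0,T]}$ be an $\mathbb R^d$-valued process and $(\mathbb X_{s,t})_{s,t\in[0,T]}$ random matrices, such that $X_t$ and $\mathbb X_{s,t}$ are measurable in $\omega$ and almost surely $\mathbf X=(X,\mathbb X)$ is a geometric $\gamma$-rough path. Let $X^n$ $(n\in\mathbb N)$ be processes, measurable in $\omega$, with almost surely $C^1$ paths on $[0,T]$, such that their natural lifts $\mathbf X^n$ satisfy $\mathbb E[\|\mathbf X-\mathbf X^n\|^p_{\mathcal R^\gamma}]\to0$ for every $p\in[1,\infty)$. Let $b:\Omega\times[0,T]\times\mathbb R^d\to\mathbb R^d$ be in $L^\infty(\Omega\times[0,T];\mathrm{Lin}(\mathbb R^d))$, i.e. $b$ is measurable and $b_t(\omega,x)/(1+|x|)$ is essentially bounded; let the distributional divergence in $x$ satisfy $\operatorname{div} b\in L^\infty(\Omega\times[0,T]\times\mathbb R^d)$; and let $u_0\in L^\infty(\Omega\times\mathbb R^d)$. **Conclusion.** There is a stochastic weak controlled solution of $\partial_tu+b\cdot\nabla u+\nabla u\cdot d\mathbf X=0$ with initial condition $u_0$. That is, there is a function $u\in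 L^\infty(\Omega\times[0,T]\times\mathbb R^d)$, jointly measurable in $(\omega,t,x)$, such that, with $u_t(\varphi)=\int_{\mathbb R^d}u_t(x)\varphi(x)\,dx$, almost surely the following holds: 1. $u_t\in L^\infty(\mathbb R^d)$ for all $t\in[0,T]$. 2. For all $\varphi\in C^\infty_c(\mathbb R^d)$, the path $t\mapsto u_t(\varphi)$ is $\gamma$-controlled by $X$ with derivative $u(\nabla\varphi)$, i.e. $u(\varphi)$ and $u(\nabla\varphi)$ are $\gamma$-Hölder on $[0,T]$ and $(s,t)\mapsto u_t(\varphi)-u_s(\varphi)-u_s(\nabla\varphi)\cdot(X_t-X_s)$ is continuous on $[0,T]^2$ and bounded by a constant times $|t-s|^{2\gamma}$. 3. For all $\varphi\in C^\infty_c(\mathbb R^d)$ and all $t\in[0,T]$, $$u_t(\varphi)=u_0(\varphi)+\int_0^tu_s\big(b_s\cdot\nabla\varphi+\operatorname{div}(b_s)\,\varphi\big)\,ds+\int_0^tu_s(\nabla\varphi)\,d\mathbf X_s,$$ where the last term is the controlled rough integral of $u(\nabla\varphi)$, with derivative $u(\nabla^2\varphi)$, i.e. the limit, which exists, as the mesh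 of the partitions $0=t_0\le\dots\le t_m=t$ tends to zero, of $$\sum_k\Big(u_{t_k}(\nabla\varphi)\cdot(X_{t_{k+1}}-X_{t_k})+\sum_{i,j}u_{t_k}(\partial_i\partial_j\varphi)\,\mathbb X^{ji}_{t_k,t_{k+1}}\Big).$$ -/

import Mathlib

open MeasureTheory Filter Topology Set
open scoped ENNReal NNReal

noncomputable section

namespace RTE

/-- The Euclidean space `ℝ^d`. -/
abbrev E (d : ℕ) : Type := EuclideanSpace ℝ (Fin d)

/-- The norm `‖g‖_α = sup_{s ≠ t} |g_{s,t}| / |t - s|^α` of a function `g` on `[0,T]²`,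
with values in `[0,∞]`. -/
def twoParamNorm {F : Type*} [NormedAddCommGroup F] (T α : ℝ) (g : ℝ → ℝ → F) : ℝ≥0∞ :=
  ⨆ (s ∈ Icc (0 : ℝ) T) (t ∈ Icc (0 : ℝ) T) (_ : s ≠ t),
    ‖g s t‖ₑ / ENNReal.ofReal (|t - s| ^ α)

/-- The Hölder seminorm `sup_{s ≠ t} |f_t - f_s| / |t - s|^α` on `[0,T]`. -/
def holderSeminorm {F : Type*} [NormedAddCommGroup F] (T α : ℝ) (f : ℝ → F) : ℝ≥0∞ :=
  twoParamNorm T α (fun s t => f t - f s)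

/-- The Hölder norm `|f_0| + sup_{s ≠ t} |f_t - f_s| / |t - s|^α` on `[0,T]`. -/
def holderNorm {F : Type*} [NormedAddCommGroup F] (T α : ℝ) (f : ℝ → F) : ℝ≥0∞ :=
  ‖f 0‖ₑ + holderSeminorm T α f

/-- `g ∈ C^α_2([0,T]²; F)`: `g` is continuous on `[0,T]²`, vanishes on the diagonal, and
`‖g‖_α < ∞`. -/
structure MemC2 {F : Type*} [NormedAddCommGroup F] (T α : ℝ) (g : ℝ → ℝ → F) : Prop where
  continuousOn : ContinuousOn (fun q : ℝ × ℝ => g q.1 q.2) (Icc 0 T ×ˢ Icc 0 T)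
  diag : ∀ s ∈ Icc (0 : ℝ) T, g s s = 0
  norm_lt_top : twoParamNorm T α g < ⊤

/-- `f ∈ C^α([0,T]; F)`. -/
structure MemC1 {F : Type*} [NormedAddCommGroup F] (T α : ℝ) (f : ℝ → F) : Prop where
  continuousOn : ContinuousOn f (Icc 0 T)
  seminorm_lt_top : holderSeminorm T α f < ⊤

/-- `(X, 𝕏)` is a rough path of order `γ` on `[0,T]`; `XX s t i j` stands for
`∫_s^t (X^i_r - X^i_s) dX^j_r`. The space `M_d(ℝ)` carries the maximum norm of the entries. -/
structure IsRoughPath {d : ℕ} (T γ : ℝ) (X : ℝ → E d) (XX : ℝ → ℝ → Fin d → Fin d → ℝ) :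
    Prop where
  path : MemC1 T γ X
  area : MemC2 T (2 * γ) XX
  chen : ∀ s u t : ℝ, 0 ≤ s → s ≤ u → u ≤ t → t ≤ T → ∀ i j : Fin d,
    XX s t i j - XX s u i j - XX u t i j = (X u i - X s i) * (X t j - X u j)

/-- The second level `∫_s^t (X_r - X_s) ⊗ Ẋ_r dr` of the natural lift of a `C¹` path. -/
def naturalLift {d : ℕ} (T : ℝ) (X : ℝ → E d) : ℝ → ℝ → Fin d → Fin d → ℝ :=
  fun s t i j => ∫ r in s..t, (X r i - X s i) * derivWithin (fun q => X q j) (Icc 0 T) r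

/-- The rough path distance `‖X - Y‖_γ + ‖𝕏 - 𝕐‖_{2γ}`. -/
def roughDist {d : ℕ} (T γ : ℝ) (X : ℝ → E d) (XX : ℝ → ℝ → Fin d → Fin d → ℝ)
    (Y : ℝ → E d) (YY : ℝ → ℝ → Fin d → Fin d → ℝ) : ℝ≥0∞ :=
  holderNorm T γ (fun t => X t - Y t) + twoParamNorm T (2 * γ) (fun s t => XX s t - YY s t)

/-- `(X, 𝕏)` is a geometric rough path of order `γ`: a rough path which is a limit, in the rough
path distance, of natural lifts of `C¹` paths. -/
structure IsGeometricRoughPath {d : ℕ} (T γ : ℝ) (X : ℝ → E d)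
    (XX : ℝ → ℝ → Fin d → Fin d → ℝ) : Prop where
  isRoughPath : IsRoughPath T γ X XX
  approx : ∃ Y : ℕ → ℝ → E d, (∀ n, ContDiffOn ℝ 1 (Y n) (Icc 0 T)) ∧
    Tendsto (fun n => roughDist T γ X XX (Y n) (naturalLift T (Y n))) atTop (𝓝 0)

/-- `y ∈ D^γ_X([0,T])` with derivative `y'`: both are `γ`-Hölder, and the remainder
`y^#_{s,t} = y_t - y_s - y'_s (X_t - X_s)` belongs to `C^{2γ}_2`. -/
structure IsControlled {d : ℕ} (T γ : ℝ) (X : ℝ → E d) (y : ℝ → ℝ) (y' : ℝ → Fin d → ℝ) :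
    Prop where
  path : MemC1 T γ y
  deriv : MemC1 T γ y'
  remainder : MemC2 T (2 * γ) (fun s t => y t - y s - ∑ i, y' s i * (X t i - X s i))

/-- `I` is the controlled rough integral over `[s,t]` of the `ℝ^d`-valued controlled path `y`
against `(X, 𝕏)`, where `y' r i j` is the derivative of `y^i` in the direction `X^j`: the sums
`∑_k (y_{t_k} · δX_{t_k,t_{k+1}} + y'_{t_k} : 𝕏_{t_k,t_{k+1}})` converge to `I` as the mesh of the
partition `s = t_0 ≤ ⋯ ≤ t_n = t` tends to zero. -/
def HasRoughIntegral {d : ℕ} (X : ℝ → E d) (XX : ℝ → ℝ → Fin d → Fin d → ℝ)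
    (y : ℝ → Fin d → ℝ) (y' : ℝ → Fin d → Fin d → ℝ) (s t I : ℝ) : Prop :=
  ∀ ε > 0, ∃ δ > 0, ∀ (n : ℕ) (τ : ℕ → ℝ), τ 0 = s → τ n = t →
    (∀ k < n, τ k ≤ τ (k + 1) ∧ τ (k + 1) - τ k < δ) →
    |(∑ k ∈ Finset.range n,
        ((∑ i, y (τ k) i * (X (τ (k + 1)) i - X (τ k) i)) +
          ∑ i, ∑ j, y' (τ k) i j * XX (τ k) (τ (k + 1)) j i)) - I| < ε

/-- `φ ∈ C^∞_c(ℝ^d)`. -/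
def IsTest {d : ℕ} (φ : E d → ℝ) : Prop :=
  ContDiff ℝ (⊤ : ℕ∞) φ ∧ HasCompactSupport φ

/-- The partial derivative `∂_i φ`. -/
def pd {d : ℕ} (i : Fin d) (φ : E d → ℝ) : E d → ℝ :=
  fun x => fderiv ℝ φ x (EuclideanSpace.single i 1)

/-- The pairing `v(φ) = ∫ v(x) φ(x) dx`. -/
def pairing {d : ℕ} (v φ : E d → ℝ) : ℝ := ∫ x, v x * φ x

/-- `g` is the divergence of the vector field `b` in the sense of distributions. -/
def IsWeakDiv {d : ℕ} (b : E d → E d) (g : E d → ℝ) : Prop :=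
  ∀ φ : E d → ℝ, IsTest φ → ∫ x, ∑ i, b x i * pd i φ x = - ∫ x, g x * φ x

/-- The measure `ℙ ⊗ dt ⊗ dx` on `Ω × [0,T] × ℝ^d`. -/
def spaceTime {Ω : Type*} [MeasurableSpace Ω] (P : Measure Ω) (T : ℝ) (d : ℕ) :
    Measure (Ω × ℝ × E d) :=
  P.prod ((volume.restrict (Icc (0 : ℝ) T)).prod volume)

/-- `b ∈ L^∞(Ω × [0,T]; Lin(ℝ^d))`: the function `b / (1 + |x|)` is essentially bounded. -/
def MemLinftyLin {Ω : Type*} [MeasurableSpace Ω] {d : ℕ} (P : Measure Ω) (T : ℝ)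
    (b : Ω → ℝ → E d → E d) : Prop :=
  MemLp (fun z : Ω × ℝ × E d => (1 + ‖z.2.2‖)⁻¹ • b z.1 z.2.1 z.2.2) ∞ (spaceTime P T d)

/-- `g ∈ L^∞(Ω × [0,T] × ℝ^d)`. -/
def MemLinfty {Ω : Type*} [MeasurableSpace Ω] {d : ℕ} (P : Measure Ω) (T : ℝ)
    (g : Ω → ℝ → E d → ℝ) : Prop :=
  MemLp (fun z : Ω × ℝ × E d => g z.1 z.2.1 z.2.2) ∞ (spaceTime P T d)

/-- `u` is a stochastic weak controlled solution of
`∂_t u + b · ∇u + ∇u · d𝐗 = 0`, `u(0, ·) = u₀`, where `divb` is the divergence of `b`.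
The path `t ↦ u_t(φ)` has the derivative `u(∇φ)`, so that `u(∇φ)` has the derivative `u(∇²φ)`. -/
structure IsStochasticWCS {Ω : Type*} [MeasurableSpace Ω] {d : ℕ} (P : Measure Ω) (T γ : ℝ)
    (X : Ω → ℝ → E d) (XX : Ω → ℝ → ℝ → Fin d → Fin d → ℝ)
    (b : Ω → ℝ → E d → E d) (divb : Ω → ℝ → E d → ℝ) (u₀ : Ω → E d → ℝ)
    (u : Ω → ℝ → E d → ℝ) : Prop where
  measurable : Measurable (fun z : Ω × ℝ × E d => u z.1 z.2.1 z.2.2)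
  memLinfty : MemLinfty P T u
  /-- At every time `u_t` is essentially bounded, so that all the numbers `u_t(φ)` make sense. -/
  memLinfty_slice : ∀ᵐ ω ∂P, ∀ t ∈ Icc (0 : ℝ) T, MemLp (u ω t) ∞ volume
  controlled : ∀ᵐ ω ∂P, ∀ φ : E d → ℝ, IsTest φ →
    IsControlled T γ (X ω) (fun t => pairing (u ω t) φ) (fun t i => pairing (u ω t) (pd i φ))
  equation : ∀ᵐ ω ∂P, ∀ φ : E d → ℝ, IsTest φ → ∀ t ∈ Icc (0 : ℝ) T, ∃ I : ℝ,
    HasRoughIntegral (X ω) (XX ω) (fun r i => pairing (u ω r) (pd i φ))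
      (fun r i j => pairing (u ω r) (pd j (pd i φ))) 0 t I ∧
    pairing (u ω t) φ = pairing (u₀ ω) φ +
      (∫ s in (0 : ℝ)..t,
        pairing (u ω s) (fun x => (∑ i, b ω s x i * pd i φ x) + divb ω s x * φ x)) + I

end RTE

end

/-! The noise transports along constant vector fields, so the translation $u_t(x)=w_t(x-X_t)$
removes it. Formally $w$ solves $\partial_tw+b_t(x+X_t)\cdot\nabla w=0$, a linear transport equation
with a random measurable field of linear growth whose divergence is still bounded. Conversely,
$u_t(\varphi)=w_t(\varphi(\cdot+X_t))$ defines $u$ from $w$.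

Existence of $w$ is a duality argument. Tested against $\Psi$ with $\Psi_T=0$, the equation is the
linear system $\int w f=\int w_0\Psi_0$ with $f=-(\partial_t\Psi+\operatorname{div}(b\Psi))$, where
$b$ now stands for the shifted field. By Hahn–Banach (`exists_bounded_solution`) it has a solution
bounded by $C\ge\sup|w_0|$ once $\|\Psi_0\|_{L^1}\le\|f\|_{L^1}$. This estimate
(`integral_abs_le_backward`) comes from multiplying by $\operatorname{sgn}\Psi$: the term
$\operatorname{div}(b|\Psi|)$ has integral zero. As $\Psi$ is smooth in $x$, no regularisation of
$b$ is involved. The system is solved on $\Omega\times[0,T]\times\mathbb R^d$ at once, so joint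
measurability comes for free. The equation then holds for almost every $t$. Its right-hand side is
continuous in $t$, and testing it with mollifiers defines a good version of $w$ at every $t$
(`exists_regular_solution`). The growth constant of the shifted field involves $\sup_t|X_t|$, which
need not be integrable, so this step is carried out under an equivalent measure.

The rough part is pathwise. For a fixed test function $w_t$ is Lipschitz in $t$, so the irregularity
of $t\mapsto w_t(\varphi(\cdot+X_t))$ comes from Taylor expansion in the shift. Order one gives a
controlled path with remainder $|t-s|^{2\gamma}$. Order two gives the local expansion with error
$|t-s|^{3\gamma}$: its quadratic term contracts the symmetric Hessian with $\frac12\delta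
X\otimes\delta X$, which is the symmetric part of $\mathbb X$ because $\mathbf X$ is geometric
(`IsGeometricRoughPath.add_swap`). Since $3\gamma>1$, the compensated sums converge to the increment
of $u(\varphi)$ minus the drift (`exists_mesh_bound`). The limit is known in advance, so no sewing
argument is needed. -/

noncomputable section

namespace RTE

/-! ### Duality: bounded functionals on L¹ and solvability of linear systems in L^∞. -/

section Duality

variable {α : Type*} [MeasurableSpace α] {μ : Measure α}

/-- Dominated convergence: since `κ` is positive, at each point the truncation is eventually
inactive. Cutting off at a multiple of a weight, not of a constant, makes the truncated function
divisible by the weight below. -/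
theorem tendsto_integral_abs_sub_truncation {f κ : α → ℝ} (hf : Integrable f μ)
    (hfm : Measurable f) (hκm : Measurable κ) (hκ : ∀ x, 0 < κ x) :
    Tendsto (fun n : ℕ => ∫ x, |f x - {x | |f x| ≤ n * κ x}.indicator f x| ∂μ) atTop (𝓝 0) := by
  have h0 : (0 : ℝ) = ∫ x, (0 : ℝ) ∂μ := by simp
  rw [h0]
  have hS : ∀ n : ℕ, MeasurableSet {x | |f x| ≤ n * κ x} := fun n =>
    measurableSet_le hfm.abs (hκm.const_mul _)
  refine tendsto_integral_of_dominated_convergence (fun x => |f x|) ?_ hf.abs ?_ ?_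
  · intro n
    exact ((hfm.sub (hfm.indicator (hS n))).abs).aestronglyMeasurable
  · intro n
    refine ae_of_all _ fun x => ?_
    by_cases hx : x ∈ {x | |f x| ≤ n * κ x}
    · simp [indicator_of_mem hx]
    · simp [indicator_of_notMem hx]
  · refine ae_of_all _ fun x => ?_
    obtain ⟨N, hN⟩ := exists_nat_ge (|f x| / κ x)
    refine tendsto_const_nhds.congr' ?_
    filter_upwards [eventually_ge_atTop N] with n hn
    have : |f x| ≤ n * κ x := by
      rw [div_le_iff₀ (hκ x)] at hN
      refine hN.trans ?_
      gcongr
      exact (hκ x).le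
    rw [indicator_of_mem (by exact this)]
    simp

/-- A bounded functional on `L¹` of a `σ`-finite measure is represented by a bounded function. -/
theorem exists_bounded_representative [SigmaFinite μ] (ℓ : (α →₁[μ] ℝ) →ₗ[ℝ] ℝ) {C : ℝ}
    (hℓ : ∀ f, |ℓ f| ≤ C * ‖f‖) :
    ∃ v : α → ℝ, Measurable v ∧ (∀ x, |v x| ≤ max C 0) ∧
      ∀ (f : α → ℝ) (hf : Integrable f μ), ∫ x, v x * f x ∂μ = ℓ (hf.toL1 f) := by
  -- A positive integrable weight `κ²` reduces the claim to Riesz representation in L²: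
  -- multiplication by `κ` maps L² boundedly into L¹. If `r` represents `h ↦ ℓ (κ h)`, the sought
  -- function is `r / κ`.
  obtain ⟨g, hg0, hgm, hgi⟩ := exists_pos_lintegral_lt_of_sigmaFinite μ one_ne_zero
  set κ : α → ℝ := fun x => Real.sqrt (g x) with hκdef
  have hκm : Measurable κ := (measurable_coe_nnreal_real.comp hgm).sqrt
  have hκ : ∀ x, 0 < κ x := fun x => Real.sqrt_pos.2 (by exact_mod_cast hg0 x)
  have hκ2 : ∀ x, κ x ^ 2 = g x := fun x => Real.sq_sqrt (by positivity)
  have hgint : Integrable (fun x => (g x : ℝ)) μ := by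
    refine ⟨(measurable_coe_nnreal_real.comp hgm).aestronglyMeasurable, ?_⟩
    rw [hasFiniteIntegral_iff_enorm]
    simpa using hgi.trans ENNReal.one_lt_top
  have hκL : MemLp κ 2 μ := by
    rw [memLp_two_iff_integrable_sq hκm.aestronglyMeasurable]
    simpa [hκ2] using hgint
  have hmul : ∀ h : Lp ℝ 2 μ, Integrable (fun x => κ x * h x) μ := fun h =>
    MemLp.integrable_mul hκL (Lp.memLp h)
  -- the functional `h ↦ ℓ (κ h)` on `L²`
  let A : Lp ℝ 2 μ →ₗ[ℝ] ℝ :=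
    { toFun := fun h => ℓ ((hmul h).toL1 _)
      map_add' := by
        intro h k
        rw [← map_add]
        congr 1
        rw [← Integrable.toL1_add]
        refine (Integrable.toL1_eq_toL1_iff _ _ _ _).2 ?_
        filter_upwards [Lp.coeFn_add h k] with x hx
        simp only [hx, Pi.add_apply]
        ring
      map_smul' := by
        intro c h
        rw [RingHom.id_apply, ← map_smul]
        congr 1
        rw [← Integrable.toL1_smul]
        refine (Integrable.toL1_eq_toL1_iff _ _ _ _).2 ?_
        filter_upwards [Lp.coeFn_smul c h] with x hx
        simp only [hx, Pi.smul_apply, smul_eq_mul]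
        ring }
  have hnorm : ∀ f (hf : Integrable f μ), ‖hf.toL1 f‖ = ∫ x, |f x| ∂μ := by
    intro f hf
    rw [L1.norm_eq_integral_norm]
    refine integral_congr_ae ?_
    filter_upwards [hf.coeFn_toL1] with x hx
    rw [hx, Real.norm_eq_abs]
  have hℓ' : ∀ f (hf : Integrable f μ), |ℓ (hf.toL1 f)| ≤ max C 0 * ∫ x, |f x| ∂μ := by
    intro f hf
    refine (hℓ _).trans ?_
    rw [hnorm]
    exact mul_le_mul_of_nonneg_right (le_max_left _ _) (integral_nonneg fun x => abs_nonneg _)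
  have hA : ∀ h, ‖A h‖ ≤ (max C 0 * ‖hκL.toLp κ‖) * ‖h‖ := by
    intro h
    refine (hℓ' _ (hmul h)).trans ?_
    rw [mul_assoc]
    refine mul_le_mul_of_nonneg_left ?_ (le_max_right _ _)
    have h1 : ∫ x, |κ x * h x| ∂μ = inner ℝ (hκL.toLp κ) (|h|) := by
      rw [L2.inner_def]
      refine integral_congr_ae ?_
      filter_upwards [hκL.coeFn_toLp, Lp.coeFn_abs h] with x hx hx'
      rw [hx, hx', abs_mul, abs_of_pos (hκ x)]
      simp [mul_comm]
    rw [h1]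
    refine (real_inner_le_norm _ _).trans ?_
    rw [norm_abs_eq_norm]
  obtain ⟨r, hr⟩ := (InnerProductSpace.toDual ℝ (Lp ℝ 2 μ)).surjective (A.mkContinuous _ hA)
  have hr' : ∀ h, ∫ x, r x * h x ∂μ = ℓ ((hmul h).toL1 _) := by
    intro h
    have h1 : A.mkContinuous _ hA h = inner ℝ r h := by rw [← hr]; rfl
    rw [L2.inner_def] at h1
    have h2 : A.mkContinuous _ hA h = ℓ ((hmul h).toL1 _) := rfl
    rw [← h2, h1]
    refine integral_congr_ae (ae_of_all _ fun x => ?_)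
    simp [mul_comm]
  have hrκ : Integrable (fun x => r x * κ x) μ := MemLp.integrable_mul (Lp.memLp r) hκL
  -- Testing with `κ` restricted to `s` compares the integrals of `r κ` and `κ²` over every
  -- measurable set, hence their values almost everywhere.
  have hset : ∀ s, MeasurableSet s → |∫ x in s, r x * κ x ∂μ| ≤ max C 0 * ∫ x in s, κ x ^ 2 ∂μ := by
    intro s hs
    have hi : MemLp (s.indicator κ) 2 μ := hκL.indicator hs
    have h1 := hr' (hi.toLp _)
    have h2 : ∫ x, r x * hi.toLp _ x ∂μ = ∫ x in s, r x * κ x ∂μ := by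
      rw [← integral_indicator hs]
      refine integral_congr_ae ?_
      filter_upwards [hi.coeFn_toLp] with x hx
      rw [hx]
      by_cases hxs : x ∈ s <;> simp [hxs]
    rw [← h2, h1]
    refine (hℓ' _ _).trans (le_of_eq ?_)
    congr 1
    rw [← integral_indicator hs]
    refine integral_congr_ae ?_
    filter_upwards [hi.coeFn_toLp] with x hx
    rw [hx]
    by_cases hxs : x ∈ s
    · simp [hxs, sq, abs_of_pos (mul_pos (hκ x) (hκ x))]
    · simp [hxs]
  have hκ2i : Integrable (fun x => max C 0 * κ x ^ 2) μ := by
    simp only [hκ2]; exact hgint.const_mul _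
  have hle : ∀ᵐ x ∂μ, r x * κ x ≤ max C 0 * κ x ^ 2 := by
    refine ae_le_of_forall_setIntegral_le hrκ hκ2i fun s hs _ => ?_
    rw [integral_const_mul]
    exact (le_abs_self _).trans (hset s hs)
  have hge : ∀ᵐ x ∂μ, -(r x * κ x) ≤ max C 0 * κ x ^ 2 := by
    refine ae_le_of_forall_setIntegral_le hrκ.neg hκ2i fun s hs _ => ?_
    rw [integral_const_mul]
    simp only [integral_neg]
    exact (neg_le_abs _).trans (hset s hs)
  have hrm : StronglyMeasurable r := Lp.stronglyMeasurable r
  -- Clamping alters `r / κ` only on a null set and makes the bound hold at every point.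
  set v : α → ℝ := fun x => max (-(max C 0)) (min (max C 0) (r x / κ x)) with hvdef
  have hC0 : 0 ≤ max C 0 := le_max_right _ _
  have hvae : ∀ᵐ x ∂μ, v x * κ x = r x := by
    filter_upwards [hle, hge] with x h1 h2
    have hk := hκ x
    have h3 : r x / κ x ≤ max C 0 := by
      rw [div_le_iff₀ hk]
      nlinarith
    have h4 : -(max C 0) ≤ r x / κ x := by
      rw [le_div_iff₀ hk]
      nlinarith
    simp only [hvdef]
    rw [min_eq_right h3, max_eq_right h4]
    field_simp
  have hvm : Measurable v :=
    measurable_const.max (measurable_const.min (hrm.measurable.div hκm))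
  have hvb : ∀ x, |v x| ≤ max C 0 := by
    intro x
    rw [abs_le]
    exact ⟨le_max_left _ _, max_le (by linarith) (min_le_left _ _)⟩
  have hvi : ∀ f, Integrable f μ → Integrable (fun x => v x * f x) μ := by
    intro f hf
    refine hf.bdd_mul hvm.aestronglyMeasurable (c := max C 0) (ae_of_all _ hvb)
  refine ⟨v, hvm, hvb, ?_⟩
  -- reduction to measurable `f`
  suffices H : ∀ (f : α → ℝ) (_ : Measurable f) (hf : Integrable f μ),
      ∫ x, v x * f x ∂μ = ℓ (hf.toL1 f) by
    intro f hf
    have hae := hf.aestronglyMeasurable.ae_eq_mk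
    have hf' := hf.congr hae
    have h1 := H _ hf.aestronglyMeasurable.stronglyMeasurable_mk.measurable hf'
    rw [(Integrable.toL1_eq_toL1_iff _ _ hf hf').2 hae, ← h1]
    refine integral_congr_ae ?_
    filter_upwards [hae] with x hx
    rw [hx]
  intro f hfm hf
  have hS : ∀ n : ℕ, MeasurableSet {x | |f x| ≤ n * κ x ^ 2} := fun n =>
    measurableSet_le hfm.abs ((hκm.pow_const 2).const_mul _)
  -- `F n / κ` is bounded by `n κ`, so it lies in L² and the representation applies to `F n`. Both
  -- sides are continuous in L¹, which gives `f` in the limit.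
  set F : ℕ → α → ℝ := fun n => {x | |f x| ≤ n * κ x ^ 2}.indicator f with hF
  have hFi : ∀ n, Integrable (F n) μ := fun n => hf.indicator (hS n)
  have hlim := tendsto_integral_abs_sub_truncation hf hfm (hκm.pow_const 2)
    (fun x => pow_pos (hκ x) 2)
  have hFeq : ∀ n, ∫ x, v x * F n x ∂μ = ℓ ((hFi n).toL1 _) := by
    intro n
    have hq : MemLp (fun x => F n x / κ x) 2 μ := by
      refine (hκL.const_mul (n : ℝ)).mono' ((hfm.indicator (hS n)).div hκm).aestronglyMeasurable
        (ae_of_all _ fun x => ?_)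
      have hk := hκ x
      rw [norm_div, Real.norm_eq_abs, Real.norm_eq_abs, abs_of_pos hk, div_le_iff₀ hk]
      by_cases hx : x ∈ {x | |f x| ≤ n * κ x ^ 2}
      · rw [hF]; simp only [indicator_of_mem hx]
        have : |f x| ≤ n * κ x ^ 2 := hx
        nlinarith
      · rw [hF]; simp only [indicator_of_notMem hx, abs_zero]
        positivity
    have h1 := hr' (hq.toLp _)
    have h2 : (hmul (hq.toLp _)).toL1 _ = (hFi n).toL1 _ := by
      refine (Integrable.toL1_eq_toL1_iff _ _ _ _).2 ?_
      filter_upwards [hq.coeFn_toLp] with x hx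
      rw [hx]
      have := (hκ x).ne'
      field_simp
    rw [← h2, ← h1]
    refine integral_congr_ae ?_
    filter_upwards [hq.coeFn_toLp, hvae] with x hx hx'
    rw [hx, ← hx']
    have := (hκ x).ne'
    field_simp
  have hd0 : Tendsto (fun n => max C 0 * ∫ x, |f x - F n x| ∂μ) atTop (𝓝 0) := by
    simpa using hlim.const_mul (max C 0)
  have t1 : Tendsto (fun n => ∫ x, v x * F n x ∂μ) atTop (𝓝 (∫ x, v x * f x ∂μ)) := by
    rw [tendsto_iff_norm_sub_tendsto_zero]
    refine squeeze_zero (fun _ => norm_nonneg _) (fun n => ?_) hd0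
    rw [← integral_sub (hvi _ (hFi n)) (hvi _ hf), ← integral_const_mul]
    refine norm_integral_le_of_norm_le ((hf.sub (hFi n)).abs.const_mul _) (ae_of_all _ fun x => ?_)
    rw [← mul_sub, norm_mul, Real.norm_eq_abs, Real.norm_eq_abs, abs_sub_comm]
    exact mul_le_mul_of_nonneg_right (hvb x) (abs_nonneg _)
  have t2 : Tendsto (fun n => ℓ ((hFi n).toL1 _)) atTop (𝓝 (ℓ (hf.toL1 f))) := by
    rw [tendsto_iff_norm_sub_tendsto_zero]
    refine squeeze_zero (fun _ => norm_nonneg _) (fun n => ?_) hd0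
    rw [norm_sub_rev, ← map_sub, ← Integrable.toL1_sub]
    exact hℓ' _ (hf.sub (hFi n))
  simp only [hFeq] at t1
  exact tendsto_nhds_unique t1 t2

/-- A system of linear equations `∫ v f_j = c_j` has a solution bounded by `C` as soon as
`|∑ m_j c_j| ≤ C ∫ |∑ m_j f_j|` for all finite linear combinations. -/
theorem exists_bounded_solution [SigmaFinite μ] {J : Type*} (f : J → α → ℝ)
    (hf : ∀ j, Integrable (f j) μ) (c : J → ℝ) {C : ℝ} (hC : 0 ≤ C)
    (h : ∀ (s : Finset J) (m : J → ℝ),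
      |∑ j ∈ s, m j * c j| ≤ C * ∫ x, |∑ j ∈ s, m j * f j x| ∂μ) :
    ∃ v : α → ℝ, Measurable v ∧ (∀ x, |v x| ≤ C) ∧ ∀ j, ∫ x, v x * f j x ∂μ = c j := by
  let A : (J →₀ ℝ) →ₗ[ℝ] (α →₁[μ] ℝ) := Finsupp.linearCombination ℝ (fun j => (hf j).toL1 (f j))
  let L : (J →₀ ℝ) →ₗ[ℝ] ℝ := Finsupp.linearCombination ℝ c
  have hAL : ∀ m, |L m| ≤ C * ‖A m‖ := by
    intro m
    have h1 : L m = ∑ j ∈ m.support, m j * c j := by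
      simp [L, Finsupp.linearCombination_apply, Finsupp.sum]
    have h2 : ‖A m‖ = ∫ x, |∑ j ∈ m.support, m j * f j x| ∂μ := by
      rw [L1.norm_eq_integral_norm]
      refine integral_congr_ae ?_
      have h3 : A m = ∑ j ∈ m.support, m j • (hf j).toL1 (f j) := by
        simp [A, Finsupp.linearCombination_apply, Finsupp.sum]
      have h4 : (A m : α → ℝ) =ᵐ[μ] fun x => ∑ j ∈ m.support, m j * (hf j).toL1 (f j) x := by
        rw [h3]
        refine (Lp.coeFn_finsetSum _ _).trans ?_
        have : ∀ᵐ x ∂μ, ∀ j ∈ m.support, (m j • (hf j).toL1 (f j) : α →₁[μ] ℝ) x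
            = m j * (hf j).toL1 (f j) x := by
          refine (ae_ball_iff (Finset.countable_toSet m.support)).2 ?_
          intro j _
          filter_upwards [Lp.coeFn_smul (m j) ((hf j).toL1 (f j))] with x hx
          simp [hx]
        filter_upwards [this] with x hx
        rw [Finset.sum_apply]
        exact Finset.sum_congr rfl hx
      have h5 : ∀ᵐ x ∂μ, ∀ j ∈ m.support, (hf j).toL1 (f j) x = f j x := by
        refine (ae_ball_iff (Finset.countable_toSet m.support)).2 ?_
        intro j _
        exact (hf j).coeFn_toL1
      filter_upwards [h4, h5] with x h4 h5
      rw [h4, Real.norm_eq_abs]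
      congr 1
      exact Finset.sum_congr rfl fun j hj => by rw [h5 j hj]
    rw [h1, h2]
    exact h _ _
  -- The assumed inequality makes the prescribed values a well-defined functional, of norm at most
  -- `C`, on the span of the `f j` in L¹. Hahn–Banach extends it with the same bound.
  have hker : LinearMap.ker A ≤ LinearMap.ker L := by
    intro m hm
    have := hAL m
    rw [LinearMap.mem_ker.1 hm] at this
    simp only [norm_zero, mul_zero] at this
    exact LinearMap.mem_ker.2 (abs_eq_zero.1 (le_antisymm this (abs_nonneg _)))
  let F : (α →₁[μ] ℝ) →ₗ.[ℝ] ℝ :=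
    { domain := LinearMap.range A
      toFun := ((LinearMap.ker A).liftQ L hker).comp A.quotKerEquivRange.symm.toLinearMap }
  have hF : ∀ m, ∀ hm : A m ∈ F.domain, F ⟨A m, hm⟩ = L m := by
    intro m hm
    change (LinearMap.ker A).liftQ L hker (A.quotKerEquivRange.symm ⟨A m, hm⟩) = L m
    rw [LinearMap.quotKerEquivRange_symm_apply_image]
    exact Submodule.liftQ_apply _ _ _
  obtain ⟨ℓ, hℓ1, hℓ2⟩ := exists_extension_of_le_sublinear F (fun f => C * ‖f‖)
    (fun a ha x => by rw [norm_smul, Real.norm_eq_abs, abs_of_pos ha]; ring)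
    (fun x y => by rw [← mul_add]; exact mul_le_mul_of_nonneg_left (norm_add_le _ _) hC)
    (by
      rintro ⟨x, m, rfl⟩
      exact (hF m _).trans_le ((le_abs_self _).trans (hAL m)))
  have hℓ : ∀ f, |ℓ f| ≤ C * ‖f‖ := by
    intro f
    rw [abs_le]
    refine ⟨?_, hℓ2 f⟩
    have := hℓ2 (-f)
    rw [map_neg, norm_neg] at this
    linarith
  obtain ⟨v, hvm, hvb, hv⟩ := exists_bounded_representative ℓ hℓ
  refine ⟨v, hvm, by simpa [max_eq_left hC] using hvb, fun j => ?_⟩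
  have hm : A (Finsupp.single j 1) = (hf j).toL1 (f j) := by
    simp [A]
  have hmem : A (Finsupp.single j 1) ∈ F.domain := ⟨_, rfl⟩
  have h1 := hℓ1 ⟨_, hmem⟩
  rw [hF] at h1
  rw [hv _ (hf j), ← hm, h1]
  simp [L]

end Duality

/-! ### Test functions and the operator φ ↦ b · ∇φ + (div b) φ. -/

section TestFunctions

variable {d : ℕ} {φ ψ : E d → ℝ}

theorem IsTest.continuous (h : IsTest φ) : Continuous φ := h.1.continuous

theorem IsTest.differentiable (h : IsTest φ) : Differentiable ℝ φ :=
  h.1.differentiable (by simp)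

theorem IsTest.integrable (h : IsTest φ) : Integrable φ :=
  h.continuous.integrable_of_hasCompactSupport h.2

theorem IsTest.pd (h : IsTest φ) (i : Fin d) : IsTest (pd i φ) :=
  ⟨(h.1.fderiv_right (m := (⊤ : ℕ∞)) (by simp)).clm_apply contDiff_const,
    (h.2.fderiv (𝕜 := ℝ)).comp_left (g := fun L : E d →L[ℝ] ℝ => L (EuclideanSpace.single i 1))
      (by simp)⟩

theorem IsTest.zero : IsTest (fun _ : E d => (0 : ℝ)) :=
  ⟨contDiff_const, HasCompactSupport.zero⟩

theorem IsTest.add (h : IsTest φ) (h' : IsTest ψ) : IsTest (fun x => φ x + ψ x) :=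
  ⟨h.1.add h'.1, h.2.add h'.2⟩

theorem IsTest.const_mul (h : IsTest φ) (c : ℝ) : IsTest (fun x => c * φ x) :=
  ⟨contDiff_const.mul h.1, h.2.mul_left⟩

theorem IsTest.sub (h : IsTest φ) (h' : IsTest ψ) : IsTest (fun x => φ x - ψ x) := by
  simpa [sub_eq_add_neg] using h.add (h'.const_mul (-1))

theorem IsTest.sum {J : Type*} (s : Finset J) {φ : J → E d → ℝ} (h : ∀ j, IsTest (φ j))
    (c : J → ℝ) : IsTest (fun x => ∑ j ∈ s, c j * φ j x) := by
  classical
  induction s using Finset.induction_on with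
  | empty => simpa using IsTest.zero
  | insert j s hj ih => simpa [Finset.sum_insert hj] using ((h j).const_mul (c j)).add ih

theorem IsTest.comp_add (h : IsTest φ) (a : E d) : IsTest (fun x => φ (x + a)) :=
  ⟨h.1.comp (contDiff_id.add contDiff_const),
    h.2.comp_homeomorph (Homeomorph.addRight a)⟩

theorem IsTest.comp_sub_left (h : IsTest φ) (a : E d) : IsTest (fun x => φ (a - x)) :=
  ⟨h.1.comp (contDiff_const.sub contDiff_id),
    h.2.comp_homeomorph (Homeomorph.subLeft a)⟩

theorem IsTest.comp_left (h : IsTest φ) {β : ℝ → ℝ} (hβ : ContDiff ℝ (⊤ : ℕ∞) β) (h0 : β 0 = 0) :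
    IsTest (fun x => β (φ x)) :=
  ⟨hβ.comp h.1, h.2.comp_left h0⟩

theorem IsTest.exists_bound (h : IsTest φ) : ∃ B, 0 ≤ B ∧ ∀ x, |φ x| ≤ B := by
  obtain ⟨B, hB⟩ := h.2.exists_bound_of_continuous h.continuous
  exact ⟨B, (norm_nonneg _).trans (hB 0), hB⟩

theorem IsTest.exists_radius (h : IsTest φ) : ∃ R, 0 ≤ R ∧ ∀ x, R < ‖x‖ → φ x = 0 := by
  obtain ⟨R, hR⟩ := h.2.isCompact.isBounded.subset_closedBall (0 : E d)
  refine ⟨max R 0, le_max_right _ _, fun x hx => ?_⟩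
  by_contra hne
  have := hR (subset_tsupport _ hne)
  rw [mem_closedBall_zero_iff] at this
  exact absurd (this.trans (le_max_left _ _)) (not_le.2 hx)

theorem fderiv_apply_eq_sum (φ : E d → ℝ) (x h : E d) :
    fderiv ℝ φ x h = ∑ i, h i * pd i φ x := by
  conv_lhs => rw [← (EuclideanSpace.basisFun (Fin d) ℝ).sum_repr h]
  simp [pd]

theorem pd_of_hasFDerivAt {f : E d → ℝ} {L : E d →L[ℝ] ℝ} {x : E d} (h : HasFDerivAt f L x)
    (i : Fin d) : pd i f x = L (EuclideanSpace.single i 1) := by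
  rw [pd, h.fderiv]

theorem pd_sub (h : IsTest φ) (h' : IsTest ψ) (i : Fin d) (x : E d) :
    pd i (fun x => φ x - ψ x) x = pd i φ x - pd i ψ x := by
  exact (pd_of_hasFDerivAt (f := fun x => φ x - ψ x)
    ((h.differentiable x).hasFDerivAt.sub (h'.differentiable x).hasFDerivAt) i).trans rfl

theorem pd_sum {J : Type*} (s : Finset J) {φ : J → E d → ℝ} (h : ∀ j, IsTest (φ j))
    (c : J → ℝ) (i : Fin d) (x : E d) :
    pd i (fun x => ∑ j ∈ s, c j * φ j x) x = ∑ j ∈ s, c j * pd i (φ j) x := by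
  rw [pd_of_hasFDerivAt (HasFDerivAt.fun_sum fun j _ =>
    ((h j).differentiable x).hasFDerivAt.const_mul (c j))]
  simp [pd]

theorem pd_comp_add (φ : E d → ℝ) (a : E d) (i : Fin d) (x : E d) :
    pd i (fun x => φ (x + a)) x = pd i φ (x + a) := by
  rw [pd, fderiv_comp_add_right, pd]

theorem pd_comp_left (h : IsTest φ) {β β' : ℝ → ℝ} (hβ : ∀ s, HasDerivAt β (β' s) s)
    (i : Fin d) (x : E d) : pd i (fun x => β (φ x)) x = β' (φ x) * pd i φ x := by
  refine (pd_of_hasFDerivAt (f := fun x => β (φ x))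
    ((hβ (φ x)).comp_hasFDerivAt x (h.differentiable x).hasFDerivAt) i).trans ?_
  simp [pd]

/-- The density `b · ∇φ + g φ` of the weak form of the transport operator. -/
def drift (b : E d → E d) (g φ : E d → ℝ) : E d → ℝ :=
  fun x => (∑ i, b x i * pd i φ x) + g x * φ x

/-- A weight that dominates `drift b g φ` for `b` of linear growth and bounded `g`. -/
def testWeight (φ : E d → ℝ) : E d → ℝ :=
  fun x => (1 + ‖x‖) * ((∑ i, |pd i φ x|) + |φ x|)

theorem testWeight_nonneg (φ : E d → ℝ) (x : E d) : 0 ≤ testWeight φ x := by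
  unfold testWeight; positivity

theorem abs_le_testWeight (φ : E d → ℝ) (x : E d) : |φ x| ≤ testWeight φ x := by
  unfold testWeight
  have h1 : 0 ≤ ∑ i, |pd i φ x| := by positivity
  nlinarith [norm_nonneg x, abs_nonneg (φ x)]

theorem IsTest.continuous_testWeight (h : IsTest φ) : Continuous (testWeight φ) := by
  unfold testWeight
  have h1 := fun i => (h.pd i).continuous
  have h2 := h.continuous
  fun_prop

theorem IsTest.integrable_testWeight (h : IsTest φ) : Integrable (testWeight φ) := by
  refine h.continuous_testWeight.integrable_of_hasCompactSupport ?_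
  have hs : ∀ s : Finset (Fin d), HasCompactSupport (fun x => ∑ i ∈ s, |RTE.pd i φ x|) := by
    intro s
    induction s using Finset.induction_on with
    | empty => exact HasCompactSupport.zero
    | insert j s hj ih =>
      simp only [Finset.sum_insert hj]
      exact ((h.pd j).2.comp_left (g := fun r : ℝ => |r|) abs_zero).add ih
  exact ((hs _).add (h.2.comp_left (g := fun r : ℝ => |r|) abs_zero)).mul_left

theorem abs_drift_le {b : E d → E d} {g : E d → ℝ} {K M : ℝ} (hK : 0 ≤ K) (hM : 0 ≤ M)
    {x : E d} (hb : ‖b x‖ ≤ K * (1 + ‖x‖)) (hg : |g x| ≤ M) (φ : E d → ℝ) :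
    |drift b g φ x| ≤ (K + M) * testWeight φ x := by
  unfold drift testWeight
  have h1 : |∑ i, b x i * pd i φ x| ≤ K * (1 + ‖x‖) * ∑ i, |pd i φ x| := by
    refine (Finset.abs_sum_le_sum_abs _ _).trans ?_
    rw [Finset.mul_sum]
    refine Finset.sum_le_sum fun i _ => ?_
    rw [abs_mul]
    refine mul_le_mul_of_nonneg_right ?_ (abs_nonneg _)
    exact (PiLp.norm_apply_le (b x) i).trans hb
  have h2 : |g x * φ x| ≤ M * |φ x| := by
    rw [abs_mul]; exact mul_le_mul_of_nonneg_right hg (abs_nonneg _)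
  have h3 : 0 ≤ ∑ i, |pd i φ x| := by positivity
  have h4 := norm_nonneg x
  have h5 := abs_nonneg (φ x)
  refine (abs_add_le _ _).trans ((add_le_add h1 h2).trans ?_)
  have e1 : 0 ≤ M * (1 + ‖x‖) * ∑ i, |pd i φ x| := by positivity
  have e2 : 0 ≤ M * ‖x‖ * |φ x| := by positivity
  have e3 : 0 ≤ K * (1 + ‖x‖) * |φ x| := by positivity
  nlinarith

theorem drift_sum {J : Type*} (b : E d → E d) (g : E d → ℝ) (s : Finset J) {φ : J → E d → ℝ}
    (h : ∀ j, IsTest (φ j)) (c : J → ℝ) (x : E d) :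
    drift b g (fun x => ∑ j ∈ s, c j * φ j x) x = ∑ j ∈ s, c j * drift b g (φ j) x := by
  simp only [drift, pd_sum s h, mul_add, Finset.sum_add_distrib, Finset.mul_sum]
  congr 1
  · rw [Finset.sum_comm]
    exact Finset.sum_congr rfl fun j _ => Finset.sum_congr rfl fun i _ => by ring
  · exact Finset.sum_congr rfl fun j _ => by ring

theorem drift_sub (b : E d → E d) (g : E d → ℝ) (h : IsTest φ) (h' : IsTest ψ) (x : E d) :
    drift b g (fun x => φ x - ψ x) x = drift b g φ x - drift b g ψ x := by
  simp only [drift, pd_sub h h', mul_sub, Finset.sum_sub_distrib]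
  ring

theorem measurable_drift {Y : Type*} [MeasurableSpace Y] {b : Y → E d → E d} {g : Y → E d → ℝ}
    (hb : Measurable fun z : Y × E d => b z.1 z.2) (hg : Measurable fun z : Y × E d => g z.1 z.2)
    (h : IsTest φ) : Measurable fun z : Y × E d => drift (b z.1) (g z.1) φ z.2 := by
  unfold drift
  have h1 := fun i => (h.pd i).continuous.measurable
  have h2 := h.continuous.measurable
  fun_prop

theorem measurable_drift_slice {b : E d → E d} {g : E d → ℝ} (hb : Measurable b)
    (hg : Measurable g) (h : IsTest φ) : Measurable (drift b g φ) := by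
  unfold drift
  have h1 := fun i => (h.pd i).continuous.measurable
  have h2 := h.continuous.measurable
  fun_prop

theorem integrable_drift {b : E d → E d} {g : E d → ℝ} {K M : ℝ} (hK : 0 ≤ K) (hM : 0 ≤ M)
    (hbm : Measurable b) (hgm : Measurable g)
    (hb : ∀ x, ‖b x‖ ≤ K * (1 + ‖x‖)) (hg : ∀ x, |g x| ≤ M) (h : IsTest φ) :
    Integrable (drift b g φ) :=
  (h.integrable_testWeight.const_mul (K + M)).mono'
    (measurable_drift_slice hbm hgm h).aestronglyMeasurable
    (ae_of_all _ fun x => abs_drift_le hK hM (hb x) (hg x) φ)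

/-- `drift b g φ` is $\operatorname{div}(b\varphi)$ with φ compactly supported. The L¹ estimate uses
the divergence hypothesis only in this form. -/
theorem IsWeakDiv.integral_drift {b : E d → E d} {g : E d → ℝ} (hdiv : IsWeakDiv b g)
    {K M : ℝ} (hK : 0 ≤ K) (hM : 0 ≤ M) (hbm : Measurable b) (hgm : Measurable g)
    (hb : ∀ x, ‖b x‖ ≤ K * (1 + ‖x‖)) (hg : ∀ x, |g x| ≤ M) (h : IsTest φ) :
    ∫ x, drift b g φ x = 0 := by
  have hgi : Integrable fun x => g x * φ x :=
    h.integrable.bdd_mul hgm.aestronglyMeasurable (c := M) (ae_of_all _ hg)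
  have hi := integrable_drift hK hM hbm hgm hb hg h
  have hbi : Integrable fun x => ∑ i, b x i * pd i φ x := by
    refine (hi.sub hgi).congr (ae_of_all _ fun x => ?_)
    simp [drift]
  unfold drift
  rw [integral_add hbi hgi, hdiv φ h, neg_add_cancel]

end TestFunctions

/-! ### A smooth absolute value and the chain rule in time. -/

section SmoothAbs

/-- A smooth approximation of the absolute value. -/
def smoothAbs (ε s : ℝ) : ℝ := Real.sqrt (s ^ 2 + ε ^ 2) - ε

/-- The derivative of `smoothAbs`. -/
def smoothSign (ε s : ℝ) : ℝ := s / Real.sqrt (s ^ 2 + ε ^ 2)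

variable {ε : ℝ}

theorem contDiff_smoothAbs (hε : 0 < ε) : ContDiff ℝ (⊤ : ℕ∞) (smoothAbs ε) := by
  unfold smoothAbs
  refine ContDiff.sub (ContDiff.sqrt (by fun_prop) fun s => ?_) contDiff_const
  positivity

theorem hasDerivAt_smoothAbs (hε : 0 < ε) (s : ℝ) :
    HasDerivAt (smoothAbs ε) (smoothSign ε s) s := by
  have h1 : HasDerivAt (fun s : ℝ => s ^ 2 + ε ^ 2) (2 * s) s := by
    simpa using (hasDerivAt_pow 2 s).add_const (ε ^ 2)
  have h2 := (h1.sqrt (by positivity)).sub_const ε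
  have h3 : smoothSign ε s = 2 * s / (2 * Real.sqrt (s ^ 2 + ε ^ 2)) := by
    unfold smoothSign
    rw [mul_div_mul_left _ _ two_ne_zero]
  rw [h3]
  exact h2

/-- This is the purpose of subtracting `ε`: composition with `smoothAbs ε` preserves compact
support. -/
theorem smoothAbs_zero (hε : 0 < ε) : smoothAbs ε 0 = 0 := by
  simp [smoothAbs, Real.sqrt_sq hε.le]

theorem abs_smoothSign_le (hε : 0 < ε) (s : ℝ) : |smoothSign ε s| ≤ 1 := by
  unfold smoothSign
  have : 0 < Real.sqrt (s ^ 2 + ε ^ 2) := by positivity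
  rw [abs_div, abs_of_pos this, div_le_one this]
  exact Real.abs_le_sqrt (by nlinarith)

theorem continuous_smoothSign (hε : 0 < ε) : Continuous (smoothSign ε) := by
  unfold smoothSign
  refine continuous_id.div (by fun_prop) fun s => ?_
  positivity

theorem abs_le_smoothAbs_add (s : ℝ) : |s| ≤ smoothAbs ε s + ε := by
  unfold smoothAbs
  rw [sub_add_cancel]
  exact Real.abs_le_sqrt (by nlinarith [sq_nonneg ε])

/-- For the exact absolute value $s\beta'(s)=\beta(s)$; here the defect equals
$\varepsilon-\varepsilon^2/\sqrt{s^2+\varepsilon^2}$. It measures how far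
$\beta'(\Psi)\operatorname{div}(b\Psi)$ is from a divergence. -/
theorem abs_smoothSign_mul_sub_le (hε : 0 < ε) (s : ℝ) :
    |smoothSign ε s * s - smoothAbs ε s| ≤ ε := by
  unfold smoothSign smoothAbs
  set r := Real.sqrt (s ^ 2 + ε ^ 2) with hr
  have hr0 : 0 < r := by positivity
  have hr2 : r ^ 2 = s ^ 2 + ε ^ 2 := Real.sq_sqrt (by positivity)
  have hre : ε ≤ r := Real.le_sqrt_of_sq_le (by nlinarith [sq_nonneg s])
  have h1 : s / r * s - (r - ε) = ε - ε ^ 2 / r := by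
    field_simp
    nlinarith
  rw [h1]
  have h2 : ε ^ 2 / r ≤ ε := by
    rw [div_le_iff₀ hr0]; nlinarith
  have h3 : 0 ≤ ε ^ 2 / r := by positivity
  rw [abs_le]
  constructor <;> linarith

end SmoothAbs

/-- The fundamental theorem of calculus along the primitive of a bounded function. -/
theorem integral_comp_primitive {T : ℝ} {q : ℝ → ℝ} (hq : Measurable q) {Q : ℝ}
    (hQ : ∀ t, |q t| ≤ Q) {β β' : ℝ → ℝ} (hβ : ∀ s, HasDerivAt β (β' s) s)
    (hβ' : ∀ s, |β' s| ≤ 1) :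
    ∫ t in (0 : ℝ)..T, β' (∫ r in t..T, q r) * q t = β (∫ r in (0 : ℝ)..T, q r) - β 0 := by
  have hQ0 : 0 ≤ Q := (abs_nonneg _).trans (hQ 0)
  have hqi : ∀ a c, IntervalIntegrable q volume a c := fun a c =>
    (intervalIntegrable_const (c := Q)).mono_fun' hq.aestronglyMeasurable (ae_of_all _ hQ)
  set ψ : ℝ → ℝ := fun t => ∫ r in t..T, q r with hψ
  have hlip : ∀ s t, |ψ s - ψ t| ≤ Q * |s - t| := by
    intro s t
    have : ψ s - ψ t = ∫ r in s..t, q r := by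
      simp only [hψ]
      rw [sub_eq_iff_eq_add, intervalIntegral.integral_add_adjacent_intervals (hqi _ _) (hqi _ _)]
    rw [this, abs_sub_comm]
    exact intervalIntegral.norm_integral_le_of_norm_le_const (f := q) fun r _ => hQ r
  have hβlip : LipschitzWith 1 β := lipschitzWith_of_nnnorm_deriv_le
    (fun s => (hβ s).differentiableAt) (fun s => by
      rw [(hβ s).deriv, ← NNReal.coe_le_coe]
      simpa using hβ' s)
  -- As `q` is merely bounded and measurable, `β ∘ ψ` is Lipschitz and differentiable only almost
  -- everywhere; absolute continuity is enough for the fundamental theorem.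
  have hac : AbsolutelyContinuousOnInterval (fun t => β (ψ t)) 0 T := by
    refine LipschitzOnWith.absolutelyContinuousOnInterval (K := ⟨Q, hQ0⟩) ?_
    refine LipschitzOnWith.of_dist_le_mul fun s _ t _ => ?_
    refine (hβlip.dist_le_mul _ _).trans ?_
    rw [NNReal.coe_one, one_mul, Real.dist_eq, Real.dist_eq]
    exact hlip s t
  have hd : ∀ᵐ t, HasDerivAt (fun t => β (ψ t)) (-(β' (ψ t) * q t)) t := by
    have hloc : LocallyIntegrable q := by
      refine (locallyIntegrable_const Q).mono hq.aestronglyMeasurable (ae_of_all _ fun t => ?_)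
      rw [Real.norm_eq_abs, Real.norm_eq_abs, abs_of_nonneg hQ0]
      exact hQ t
    filter_upwards [LocallyIntegrable.ae_hasDerivAt_integral hloc] with t ht
    have h1 : HasDerivAt ψ (-(q t)) t := by
      have h2 := (ht T).neg
      refine h2.congr_of_eventuallyEq (Eventually.of_forall fun s => ?_)
      simp only [hψ]
      exact intervalIntegral.integral_symm _ _
    have h4 := (hβ (ψ t)).comp t h1
    rw [mul_neg] at h4
    exact h4
  have h1 := hac.integral_deriv_eq_sub
  have h2 : ∫ t in (0 : ℝ)..T, deriv (fun t => β (ψ t)) t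
      = ∫ t in (0 : ℝ)..T, -(β' (ψ t) * q t) :=
    intervalIntegral.integral_congr_ae (by
      filter_upwards [hd] with t ht _
      exact ht.deriv)
  rw [h2, intervalIntegral.integral_neg] at h1
  have h3 : ψ T = 0 := intervalIntegral.integral_same
  rw [h3] at h1
  linarith

/-! ### The L¹ estimate for the backward equation. -/

section BackwardEstimate

variable {d : ℕ} {J : Type*}

theorem exists_common_radius (s : Finset J) {φ : J → E d → ℝ} (h : ∀ j, IsTest (φ j)) :
    ∃ R, ∀ j ∈ s, ∀ x, R < ‖x‖ → φ j x = 0 := by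
  choose R hR0 hR using fun j => (h j).exists_radius
  refine ⟨∑ j ∈ s, R j, fun j hj x hx => hR j x (lt_of_le_of_lt ?_ hx)⟩
  exact Finset.single_le_sum (fun i _ => hR0 i) hj

theorem measurable_intervalIntegral {Y : Type*} [MeasurableSpace Y] {a : Y → ℝ → ℝ}
    (ha : Measurable fun z : Y × ℝ => a z.1 z.2) {l u : Y → ℝ} (hl : Measurable l)
    (hu : Measurable u) : Measurable fun y => ∫ r in l y..u y, a y r := by
  have key : ∀ (l u : Y → ℝ), Measurable l → Measurable u →
      Measurable fun y => ∫ r in Ioc (l y) (u y), a y r := by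
    intro l u hl hu
    have h1 : (fun y => ∫ r in Ioc (l y) (u y), a y r)
        = fun y => ∫ r, {p : Y × ℝ | l p.1 < p.2 ∧ p.2 ≤ u p.1}.indicator
          (fun p => a p.1 p.2) (y, r) := by
      funext y
      rw [← integral_indicator measurableSet_Ioc]
      rfl
    rw [h1]
    refine (StronglyMeasurable.integral_prod_right (f := fun y r =>
      {p : Y × ℝ | l p.1 < p.2 ∧ p.2 ≤ u p.1}.indicator
          (fun p => a p.1 p.2) (y, r)) ?_).measurable
    refine (ha.indicator ?_).stronglyMeasurable
    exact (measurableSet_lt (hl.comp measurable_fst) measurable_snd).inter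
        (measurableSet_le measurable_snd (hu.comp measurable_fst))
  unfold intervalIntegral
  exact (key _ _ hl hu).sub (key _ _ hu hl)

theorem abs_integral_to_le {a : ℝ → ℝ} {A T t : ℝ} (ha : ∀ r, |a r| ≤ A)
    (ht : t ∈ Icc 0 T) : |∫ r in t..T, a r| ≤ A * T := by
  have hA : 0 ≤ A := (abs_nonneg _).trans (ha 0)
  refine (intervalIntegral.norm_integral_le_of_norm_le_const (f := a) fun r _ => ha r).trans ?_
  rw [abs_of_nonneg (by linarith [ht.2])]
  exact mul_le_mul_of_nonneg_left (by linarith [ht.1]) hA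

theorem intervalIntegrable_of_bound {a : ℝ → ℝ} {A : ℝ} (ham : Measurable a)
    (ha : ∀ r, |a r| ≤ A) (s t : ℝ) : IntervalIntegrable a volume s t :=
  (intervalIntegrable_const (c := A)).mono_fun' ham.aestronglyMeasurable (ae_of_all _ ha)

variable {T K M : ℝ} {b : ℝ → E d → E d} {g : ℝ → E d → ℝ}

/-- The `L¹` estimate for the backward equation `∂_t Ψ + b · ∇Ψ + (div b) Ψ = f`, `Ψ_T = 0`. -/
theorem integral_abs_le_backward (hT : 0 ≤ T) (hK : 0 ≤ K) (hM : 0 ≤ M)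
    (hbm : Measurable fun z : ℝ × E d => b z.1 z.2)
    (hgm : Measurable fun z : ℝ × E d => g z.1 z.2)
    (hb : ∀ t x, ‖b t x‖ ≤ K * (1 + ‖x‖)) (hg : ∀ t x, |g t x| ≤ M)
    (hdiv : ∀ᵐ t ∂(volume.restrict (Icc (0 : ℝ) T)), IsWeakDiv (b t) (g t))
    (s : Finset J) {a : J → ℝ → ℝ} (ham : ∀ j, Measurable (a j)) {A : J → ℝ}
    (ha : ∀ j t, |a j t| ≤ A j) {φ : J → E d → ℝ} (hφ : ∀ j, IsTest (φ j)) :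
    ∫ x, |∑ j ∈ s, (∫ r in (0 : ℝ)..T, a j r) * φ j x| ≤
      ∫ z, |∑ j ∈ s, (a j z.1 * φ j z.2
        - (∫ r in z.1..T, a j r) * drift (b z.1) (g z.1) (φ j) z.2)|
        ∂((volume.restrict (Icc (0 : ℝ) T)).prod (volume : Measure (E d))) := by
  have hA : ∀ j, 0 ≤ A j := fun j => (abs_nonneg _).trans (ha j 0)
  obtain ⟨R, hR⟩ := exists_common_radius s hφ
  set V : ℝ := volume.real (Metric.closedBall (0 : E d) R) with hV
  have hV0 : 0 ≤ V := measureReal_nonneg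
  -- All `φ j` with `j ∈ s` vanish outside this ball, so the errors of size `ε` below are supported
  -- in a set of finite volume `V`.
  set χ : E d → ℝ := (Metric.closedBall (0 : E d) R).indicator (fun _ => 1) with hχ
  have hχi : Integrable χ := (integrable_indicator_iff measurableSet_closedBall).2
    (integrableOn_const (measure_closedBall_lt_top).ne)
  have hχV : ∫ x, χ x = V := by
    rw [hχ, integral_indicator measurableSet_closedBall]
    simp [hV]
  set τ : Measure ℝ := volume.restrict (Icc (0 : ℝ) T) with hτ
  set α : J → ℝ → ℝ := fun j t => ∫ r in t..T, a j r with hα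
  have hαm : ∀ j, Measurable (α j) := fun j =>
    measurable_intervalIntegral (a := fun _ r => a j r) ((ham j).comp measurable_snd)
      measurable_id measurable_const
  -- With `Ψ` below, $\partial_t\Psi=-\eta$ and $\Psi_T=0$. Hence `η - δ` is minus the backward
  -- operator applied to `Ψ`.
  set η : ℝ → E d → ℝ := fun t x => ∑ j ∈ s, a j t * φ j x with hη
  set Ψ : ℝ → E d → ℝ := fun t x => ∑ j ∈ s, α j t * φ j x with hΨ
  have hΨtest : ∀ t, IsTest (Ψ t) := fun t => IsTest.sum s hφ _
  have hφm := fun j => (hφ j).continuous.measurable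
  have hηm : Measurable fun z : ℝ × E d => η z.1 z.2 := by
    simp only [hη]
    exact Finset.measurable_sum _ fun j _ =>
      ((ham j).comp measurable_fst).mul ((hφm j).comp measurable_snd)
  have hΨm : Measurable fun z : ℝ × E d => Ψ z.1 z.2 := by
    simp only [hΨ]
    exact Finset.measurable_sum _ fun j _ =>
      ((hαm j).comp measurable_fst).mul ((hφm j).comp measurable_snd)
  set δ : ℝ × E d → ℝ := fun z => drift (b z.1) (g z.1) (Ψ z.1) z.2 with hδ
  have hδeq : ∀ z, δ z = ∑ j ∈ s, α j z.1 * drift (b z.1) (g z.1) (φ j) z.2 := fun z =>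
    drift_sum _ _ s hφ _ _
  have hδm : Measurable δ := by
    simp only [funext hδeq]
    exact Finset.measurable_sum _ fun j _ =>
      ((hαm j).comp measurable_fst).mul (measurable_drift hbm hgm (hφ j))
  have hR0 : ∀ t x, χ x = 0 → Ψ t x = 0 := by
    intro t x hx
    refine Finset.sum_eq_zero fun j hj => ?_
    rw [hR j hj x, mul_zero]
    by_contra hlt
    rw [hχ, indicator_of_mem (by simpa using hlt)] at hx
    exact one_ne_zero hx
  have hχ01 : ∀ x, χ x = 0 ∨ χ x = 1 := fun x => by
    by_cases hx : x ∈ Metric.closedBall (0 : E d) R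
    · right; simp only [hχ, indicator_of_mem hx]
    · left; simp only [hχ, indicator_of_notMem hx]
  -- dominating functions
  set q : E d → ℝ := fun x => ∑ j ∈ s, A j * |φ j x| with hq
  set W : E d → ℝ := fun x => ∑ j ∈ s, A j * T * ((K + M) * testWeight (φ j) x) with hW
  have hqi : Integrable q := integrable_finsetSum _ fun j _ => (hφ j).integrable.abs.const_mul _
  have hWi : Integrable W := integrable_finsetSum _ fun j _ =>
    ((hφ j).integrable_testWeight.const_mul _).const_mul _
  have hηq : ∀ t x, |η t x| ≤ q x := by
    intro t x
    refine (Finset.abs_sum_le_sum_abs _ _).trans (Finset.sum_le_sum fun j _ => ?_)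
    rw [abs_mul]
    exact mul_le_mul_of_nonneg_right (ha j t) (abs_nonneg _)
  have hδW : ∀ t ∈ Icc 0 T, ∀ x, |δ (t, x)| ≤ W x := by
    intro t ht x
    rw [hδeq]
    refine (Finset.abs_sum_le_sum_abs _ _).trans (Finset.sum_le_sum fun j _ => ?_)
    rw [abs_mul]
    exact mul_le_mul (abs_integral_to_le (ha j) ht) (abs_drift_le hK hM (hb t x) (hg t x) _)
      (abs_nonneg _) (mul_nonneg (hA j) hT)
  have hprod : ∀ᵐ z ∂(τ.prod (volume : Measure (E d))), z.1 ∈ Icc 0 T := by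
    have h1 : ∀ᵐ t ∂τ, t ∈ Icc 0 T := ae_restrict_mem measurableSet_Icc
    exact Measure.quasiMeasurePreserving_fst.ae h1
  have hηI : Integrable (fun z : ℝ × E d => η z.1 z.2) (τ.prod volume) :=
    (hqi.comp_snd τ).mono' hηm.aestronglyMeasurable (ae_of_all _ fun z => hηq _ _)
  have hδI : Integrable δ (τ.prod volume) :=
    (hWi.comp_snd τ).mono' hδm.aestronglyMeasurable (by
      filter_upwards [hprod] with z hz using hδW z.1 hz z.2)
  have hrhs : ∀ z : ℝ × E d, ∑ j ∈ s, (a j z.1 * φ j z.2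
        - (∫ r in z.1..T, a j r) * drift (b z.1) (g z.1) (φ j) z.2) = η z.1 z.2 - δ z := by
    intro z
    rw [Finset.sum_sub_distrib, hδeq]
  simp only [hrhs]
  refine le_of_forall_pos_le_add fun e he => ?_
  -- Smoothing the modulus costs `M ε V T` in the transport term and `ε V` at time zero. This choice
  -- makes the total at most `e`; the summand 1 keeps the denominator positive.
  set ε : ℝ := e / (M * V * T + V + 1) with hε
  have hden : 0 < M * V * T + V + 1 := by positivity
  have hε0 : 0 < ε := div_pos he hden
  set S : ℝ × E d → ℝ := fun z => smoothSign ε (Ψ z.1 z.2) with hS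
  have hSm : Measurable S := (continuous_smoothSign hε0).measurable.comp hΨm
  have hS1 : ∀ z, |S z| ≤ 1 := fun z => abs_smoothSign_le hε0 _
  have hSη : Integrable (fun z : ℝ × E d => S z * η z.1 z.2) (τ.prod volume) :=
    hηI.bdd_mul hSm.aestronglyMeasurable (c := 1) (ae_of_all _ hS1)
  have hSδ : Integrable (fun z : ℝ × E d => S z * δ z) (τ.prod volume) :=
    hδI.bdd_mul hSm.aestronglyMeasurable (c := 1) (ae_of_all _ hS1)
  -- the time derivative
  have hΨint : ∀ t x, Ψ t x = ∫ r in t..T, η r x := by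
    intro t x
    simp only [hη, hΨ, hα]
    rw [intervalIntegral.integral_finsetSum fun j _ =>
      (intervalIntegrable_of_bound (ham j) (ha j) _ _).mul_const _]
    simp only [intervalIntegral.integral_mul_const]
  have h1 : ∫ z, S z * η z.1 z.2 ∂(τ.prod volume) = ∫ x, smoothAbs ε (Ψ 0 x) := by
    rw [integral_prod_symm _ hSη]
    refine integral_congr_ae (ae_of_all _ fun x => ?_)
    have h2 := integral_comp_primitive (T := T) (q := fun t => η t x)
      (hηm.comp (measurable_id.prodMk measurable_const)) (fun t => hηq t x)
      (hasDerivAt_smoothAbs hε0) (abs_smoothSign_le hε0)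
    simp only [← hΨint, smoothAbs_zero hε0, sub_zero] at h2
    refine Eq.trans ?_ h2
    rw [intervalIntegral.integral_of_le hT, hτ, ← integral_Icc_eq_integral_Ioc]
  -- the transport term
  have h2 : |∫ z, S z * δ z ∂(τ.prod volume)| ≤ M * ε * V * T := by
    rw [integral_prod _ hSδ]
    have h3 : ∀ᵐ t ∂τ, ‖∫ x, S (t, x) * δ (t, x)‖ ≤ M * ε * V := by
      filter_upwards [hdiv] with t ht
      have hbt : Measurable (b t) := hbm.comp (measurable_const.prodMk measurable_id)
      have hgt : Measurable (g t) := hgm.comp (measurable_const.prodMk measurable_id)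
      have htest := (hΨtest t).comp_left (contDiff_smoothAbs hε0) (smoothAbs_zero hε0)
      have hz := ht.integral_drift hK hM hbt hgt (hb t) (hg t) htest
      have hzi := integrable_drift hK hM hbt hgt (hb t) (hg t) htest
      set ρ : E d → ℝ := fun x =>
        g t x * (smoothSign ε (Ψ t x) * Ψ t x - smoothAbs ε (Ψ t x)) with hρ
      have hρb : ∀ x, ‖ρ x‖ ≤ M * ε * χ x := by
        intro x
        rcases hχ01 x with h | h
        · simp only [hρ, hR0 t x h, h, smoothAbs_zero hε0]
          simp
        · rw [h, mul_one, hρ, norm_mul]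
          exact mul_le_mul (hg t x) (abs_smoothSign_mul_sub_le hε0 _) (norm_nonneg _) hM
      have hΨt := (hΨtest t).continuous
      have hρm : Measurable ρ := hgt.mul ((((continuous_smoothSign hε0).comp hΨt).mul hΨt).sub
        ((contDiff_smoothAbs hε0).continuous.comp hΨt)).measurable
      have hρi : Integrable ρ := (hχi.const_mul _).mono' hρm.aestronglyMeasurable
        (ae_of_all _ hρb)
      -- Chain rule:
      -- $\beta'(\Psi)\operatorname{div}(b\Psi)=\operatorname{div}(b\,\beta(\Psi))+g\,(\beta'(\Psi)\Psi-\beta(\Psi))$.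
      -- The first term integrates to zero, the second is `ρ`, of size `M ε` on the ball.
      have heq : ∀ x, S (t, x) * δ (t, x)
          = drift (b t) (g t) (fun x => smoothAbs ε (Ψ t x)) x + ρ x := by
        intro x
        simp only [hS, hδ, hρ, drift, pd_comp_left (hΨtest t) (hasDerivAt_smoothAbs hε0), mul_add,
          Finset.mul_sum]
        have : ∑ i, smoothSign ε (Ψ t x) * (b t x i * pd i (Ψ t) x)
          = ∑ i, b t x i * (smoothSign ε (Ψ t x) * pd i (Ψ t) x) :=
          Finset.sum_congr rfl fun i _ => by ring
        rw [this]
        ring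
      simp only [heq]
      rw [integral_add hzi hρi, hz, zero_add]
      refine (norm_integral_le_of_norm_le (hχi.const_mul _) (ae_of_all _ hρb)).trans ?_
      rw [integral_const_mul, hχV]
    refine (norm_integral_le_of_norm_le_const h3).trans ?_
    simp [hτ, hT]
  have h3 : ∫ z, S z * η z.1 z.2 ∂(τ.prod volume) ≤
      (∫ z, |η z.1 z.2 - δ z| ∂(τ.prod volume)) + M * ε * V * T := by
    have h4 : ∫ z, S z * η z.1 z.2 ∂(τ.prod volume)
        = (∫ z, S z * (η z.1 z.2 - δ z) ∂(τ.prod volume)) + ∫ z, S z * δ z ∂(τ.prod volume) := by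
      rw [← integral_add _ hSδ]
      · exact integral_congr_ae (ae_of_all _ fun z => by ring)
      · simp only [mul_sub]; exact hSη.sub hSδ
    rw [h4]
    refine add_le_add ?_ ((le_abs_self _).trans h2)
    have h5 : Integrable (fun z => S z * (η z.1 z.2 - δ z)) (τ.prod volume) :=
      (hηI.sub hδI).bdd_mul hSm.aestronglyMeasurable (c := 1) (ae_of_all _ hS1)
    refine integral_mono h5 (hηI.sub hδI).abs fun z => ?_
    refine (le_abs_self _).trans ?_
    simp only [abs_mul]
    exact mul_le_of_le_one_left (abs_nonneg _) (hS1 z)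
  have h5 : ∫ x, |Ψ 0 x| ≤ (∫ x, smoothAbs ε (Ψ 0 x)) + ε * V := by
    have htest := (hΨtest 0).comp_left (contDiff_smoothAbs hε0) (smoothAbs_zero hε0)
    rw [← hχV, ← integral_const_mul, ← integral_add htest.integrable (hχi.const_mul _)]
    refine integral_mono (hΨtest 0).integrable.abs (htest.integrable.add (hχi.const_mul _))
      fun x => ?_
    rcases hχ01 x with h | h
    · simp [hR0 0 x h, smoothAbs_zero hε0, h]
    · simp only [h, mul_one]
      exact abs_le_smoothAbs_add _
  have h6 : (M * V * T + V + 1) * ε = e := by rw [hε]; field_simp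
  calc ∫ x, |Ψ 0 x| ≤ (∫ x, smoothAbs ε (Ψ 0 x)) + ε * V := h5
    _ ≤ (∫ z, |η z.1 z.2 - δ z| ∂(τ.prod volume)) + M * ε * V * T + ε * V := by
        rw [← h1]; linarith
    _ ≤ _ := by nlinarith

end BackwardEstimate

/-! ### Elementary bounds on pairings with a bounded function. -/

section PathwiseBounds

variable {d : ℕ} {C K M : ℝ} {v : E d → ℝ} {b : E d → E d} {g φ ψ : E d → ℝ}

theorem integrable_mul_test (hv : Measurable v) (hvC : ∀ x, |v x| ≤ C) (hφ : Integrable φ) :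
    Integrable fun x => v x * φ x :=
  hφ.bdd_mul hv.aestronglyMeasurable (c := C) (ae_of_all _ hvC)

theorem abs_pairing_le (hvC : ∀ x, |v x| ≤ C) (hφ : Integrable φ) :
    |pairing v φ| ≤ C * ∫ x, |φ x| := by
  unfold pairing
  rw [← integral_const_mul, ← Real.norm_eq_abs]
  refine norm_integral_le_of_norm_le (hφ.abs.const_mul C) (ae_of_all _ fun x => ?_)
  rw [norm_mul]
  exact mul_le_mul_of_nonneg_right (hvC x) (abs_nonneg _)

theorem pairing_sub (hv : Measurable v) (hvC : ∀ x, |v x| ≤ C) (hφ : Integrable φ)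
    (hψ : Integrable ψ) : pairing v (fun x => φ x - ψ x) = pairing v φ - pairing v ψ := by
  unfold pairing
  rw [← integral_sub (integrable_mul_test hv hvC hφ) (integrable_mul_test hv hvC hψ)]
  simp only [mul_sub]

theorem abs_pairing_drift_le (hK : 0 ≤ K) (hM : 0 ≤ M) (hvC : ∀ x, |v x| ≤ C)
    (hbm : Measurable b) (hgm : Measurable g)
    (hb : ∀ x, ‖b x‖ ≤ K * (1 + ‖x‖)) (hg : ∀ x, |g x| ≤ M) (hφ : IsTest φ) :
    |pairing v (drift b g φ)| ≤ C * ((K + M) * ∫ x, testWeight φ x) := by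
  have hC : 0 ≤ C := (abs_nonneg _).trans (hvC 0)
  have hi := integrable_drift hK hM hbm hgm hb hg hφ
  refine (abs_pairing_le hvC hi).trans (mul_le_mul_of_nonneg_left ?_ hC)
  rw [← integral_const_mul]
  exact integral_mono hi.abs (hφ.integrable_testWeight.const_mul _) fun x =>
    abs_drift_le hK hM (hb x) (hg x) φ

theorem measurable_pairing {Y : Type*} [MeasurableSpace Y] {v φ : Y → E d → ℝ}
    (hv : Measurable fun z : Y × E d => v z.1 z.2) (hφ : Measurable fun z : Y × E d => φ z.1 z.2) :
    Measurable fun y => pairing (v y) (φ y) :=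
  ((hv.mul hφ).stronglyMeasurable.integral_prod_right (f := fun y x => v y x * φ y x)).measurable

end PathwiseBounds

/-- Integration by parts for primitives of bounded functions. -/
theorem integral_primitive_mul {T A B : ℝ} (hT : 0 ≤ T) {a G : ℝ → ℝ} (ham : Measurable a)
    (hGm : Measurable G) (ha : ∀ t, |a t| ≤ A) (hG : ∀ t, |G t| ≤ B) :
    ∫ t in Icc 0 T, (∫ r in t..T, a r) * G t = ∫ t in Icc 0 T, a t * ∫ r in (0 : ℝ)..t, G r := by
  have hloc : ∀ {q : ℝ → ℝ} {Q : ℝ}, Measurable q → (∀ t, |q t| ≤ Q) → LocallyIntegrable q := by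
    intro q Q hqm hq
    refine (locallyIntegrable_const Q).mono hqm.aestronglyMeasurable (ae_of_all _ fun t => ?_)
    exact (hq t).trans (le_abs_self _)
  have hai := intervalIntegrable_of_bound ham ha 0 T
  have hGi := intervalIntegrable_of_bound hGm hG 0 T
  -- Both primitives are absolutely continuous. The boundary terms drop out because one vanishes at
  -- `T` and the other at `0`.
  have h1 := (hai.absolutelyContinuousOnInterval_intervalIntegral
    (c := T) (by simp)).neg
  have h2 := hGi.absolutelyContinuousOnInterval_intervalIntegral (c := 0) (by simp)
  have h3 := AbsolutelyContinuousOnInterval.integral_deriv_mul_eq_sub h1 h2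
  simp only [Pi.neg_apply, intervalIntegral.integral_same, neg_zero, zero_mul, mul_zero,
    sub_zero] at h3
  have h4 : ∫ t in (0 : ℝ)..T, ((∫ r in t..T, a r) * G t - a t * ∫ r in (0 : ℝ)..t, G r) = 0 := by
    refine Eq.trans (intervalIntegral.integral_congr_ae ?_) h3
    have h7 : LocallyIntegrable a volume := hloc ham ha
    have h8 : LocallyIntegrable G volume := hloc hGm hG
    filter_upwards [LocallyIntegrable.ae_hasDerivAt_integral h7,
      LocallyIntegrable.ae_hasDerivAt_integral h8] with t h5 h6 _
    have h9 := (h5 T).neg.deriv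
    have h10 := (h6 0).deriv
    rw [h9, h10, intervalIntegral.integral_symm t T]
    ring
  have hc1 : ContinuousOn (fun t => ∫ r in t..T, a r) (uIcc 0 T) := by
    have := h1.continuousOn
    refine this.congr fun t _ => ?_
    simp only [Pi.neg_apply]
    exact intervalIntegral.integral_symm _ _
  rw [intervalIntegral.integral_sub (hGi.continuousOn_mul hc1) (hai.mul_continuousOn h2.continuousOn),
    sub_eq_zero] at h4
  simpa only [intervalIntegral.integral_of_le hT, ← integral_Icc_eq_integral_Ioc] using h4

/-! ### Random transport fields and the test functions of the duality argument. -/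

/-- A random vector field `b` of linear growth with bounded weak divergence `g`. -/
structure IsTransportField {Ω : Type*} [MeasurableSpace Ω] {d : ℕ} (P : Measure Ω) (T : ℝ)
    (K : Ω → ℝ) (M : ℝ) (b : Ω → ℝ → E d → E d) (g : Ω → ℝ → E d → ℝ) : Prop where
  measurable_field : Measurable fun z : Ω × ℝ × E d => b z.1 z.2.1 z.2.2
  measurable_div : Measurable fun z : Ω × ℝ × E d => g z.1 z.2.1 z.2.2
  integrable_growth : Integrable K P
  growth_nonneg : ∀ ω, 0 ≤ K ω
  bound_nonneg : 0 ≤ M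
  field_le : ∀ ω t x, ‖b ω t x‖ ≤ K ω * (1 + ‖x‖)
  div_le : ∀ ω t x, |g ω t x| ≤ M
  isWeakDiv : ∀ᵐ ω ∂P, ∀ᵐ t ∂(volume.restrict (Icc (0 : ℝ) T)), IsWeakDiv (b ω t) (g ω t)

/-- The right-hand side of the weak transport equation. -/
def weakRHS {d : ℕ} (b : ℝ → E d → E d) (g : ℝ → E d → ℝ) (u₀ : E d → ℝ) (v : ℝ → E d → ℝ)
    (φ : E d → ℝ) (t : ℝ) : ℝ :=
  pairing u₀ φ + ∫ s in (0 : ℝ)..t, pairing (v s) (drift (b s) (g s) φ)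

section Existence

variable {Ω : Type*} [MeasurableSpace Ω] {d : ℕ} {P : Measure Ω} {T : ℝ} {K : Ω → ℝ} {M : ℝ}
  {b : Ω → ℝ → E d → E d} {g : Ω → ℝ → E d → ℝ}

theorem IsTransportField.measurable_field_path (h : IsTransportField P T K M b g) (ω : Ω) :
    Measurable fun z : ℝ × E d => b ω z.1 z.2 :=
  h.measurable_field.comp (measurable_const.prodMk measurable_id)

theorem IsTransportField.measurable_div_path (h : IsTransportField P T K M b g) (ω : Ω) :
    Measurable fun z : ℝ × E d => g ω z.1 z.2 :=
  h.measurable_div.comp (measurable_const.prodMk measurable_id)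

theorem IsTransportField.measurable_field_slice (h : IsTransportField P T K M b g) (ω : Ω)
    (t : ℝ) : Measurable (b ω t) :=
  (h.measurable_field_path ω).comp (measurable_const.prodMk measurable_id)

theorem IsTransportField.measurable_div_slice (h : IsTransportField P T K M b g) (ω : Ω)
    (t : ℝ) : Measurable (g ω t) :=
  (h.measurable_div_path ω).comp (measurable_const.prodMk measurable_id)

theorem IsTransportField.measurable_drift (h : IsTransportField P T K M b g) {φ : E d → ℝ}
    (hφ : IsTest φ) : Measurable fun z : Ω × ℝ × E d => drift (b z.1 z.2.1) (g z.1 z.2.1) φ z.2.2 := by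
  have h1 : Measurable fun z : (Ω × ℝ) × E d => drift (b z.1.1 z.1.2) (g z.1.1 z.1.2) φ z.2 :=
    RTE.measurable_drift (b := fun y : Ω × ℝ => b y.1 y.2) (g := fun y : Ω × ℝ => g y.1 y.2)
      (h.measurable_field.comp (f := fun z : (Ω × ℝ) × E d => (z.1.1, z.1.2, z.2)) (by fun_prop))
      (h.measurable_div.comp (f := fun z : (Ω × ℝ) × E d => (z.1.1, z.1.2, z.2)) (by fun_prop)) hφ
  exact h1.comp (f := fun z : Ω × ℝ × E d => ((z.1, z.2.1), z.2.2)) (by fun_prop)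

theorem IsTransportField.integrable_drift (h : IsTransportField P T K M b g) {φ : E d → ℝ}
    (hφ : IsTest φ) (ω : Ω) (t : ℝ) : Integrable (drift (b ω t) (g ω t) φ) :=
  RTE.integrable_drift (h.growth_nonneg ω) h.bound_nonneg (h.measurable_field_slice ω t)
    (h.measurable_div_slice ω t) (h.field_le ω t) (h.div_le ω t) hφ

theorem IsTransportField.abs_pairing_drift_le (h : IsTransportField P T K M b g) {φ : E d → ℝ}
    (hφ : IsTest φ) {v : E d → ℝ} {C : ℝ} (hvC : ∀ x, |v x| ≤ C) (ω : Ω) (t : ℝ) :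
    |pairing v (drift (b ω t) (g ω t) φ)| ≤ C * ((K ω + M) * ∫ x, testWeight φ x) :=
  RTE.abs_pairing_drift_le (h.growth_nonneg ω) h.bound_nonneg hvC (h.measurable_field_slice ω t)
    (h.measurable_div_slice ω t) (h.field_le ω t) (h.div_le ω t) hφ

/-- The time spent in `S` after `t`. -/
def timeIn (T : ℝ) (S : Set (Ω × ℝ)) (ω : Ω) (t : ℝ) : ℝ :=
  ∫ r in t..T, S.indicator (fun _ => (1 : ℝ)) (ω, r)

theorem abs_indicator_one_le {α : Type*} (S : Set α) (x : α) :
    |S.indicator (fun _ => (1 : ℝ)) x| ≤ 1 := by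
  by_cases hx : x ∈ S <;> simp [hx]

theorem measurable_timeIn {S : Set (Ω × ℝ)} (hS : MeasurableSet S) :
    Measurable fun z : Ω × ℝ => timeIn T S z.1 z.2 :=
  measurable_intervalIntegral (a := fun y r => S.indicator (fun _ => (1 : ℝ)) (y.1, r))
    ((measurable_const.indicator hS).comp (f := fun z : (Ω × ℝ) × ℝ => (z.1.1, z.2)) (by fun_prop))
    measurable_snd measurable_const

omit [MeasurableSpace Ω] in
theorem abs_timeIn_le {S : Set (Ω × ℝ)} {ω : Ω} {t : ℝ} (ht : t ∈ Icc 0 T) :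
    |timeIn T S ω t| ≤ T := by
  unfold timeIn
  simpa using abs_integral_to_le (a := fun r => S.indicator (fun _ => (1 : ℝ)) (ω, r)) (A := 1)
    (fun r => abs_indicator_one_le _ _) ht

/-- The backward transport operator on the test function `(ω, t, x) ↦ timeIn T S ω t * φ x`. -/
def backwardOp (T : ℝ) (b : Ω → ℝ → E d → E d) (g : Ω → ℝ → E d → ℝ) (S : Set (Ω × ℝ))
    (φ : E d → ℝ) (z : Ω × ℝ × E d) : ℝ :=
  S.indicator (fun _ => (1 : ℝ)) (z.1, z.2.1) * φ z.2.2
    - timeIn T S z.1 z.2.1 * drift (b z.1 z.2.1) (g z.1 z.2.1) φ z.2.2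

theorem IsTransportField.measurable_backwardOp (h : IsTransportField P T K M b g)
    {S : Set (Ω × ℝ)} (hS : MeasurableSet S) {φ : E d → ℝ} (hφ : IsTest φ) :
    Measurable (backwardOp T b g S φ) := by
  have h1 : Measurable fun z : Ω × ℝ × E d => (z.1, z.2.1) := by fun_prop
  refine Measurable.sub (Measurable.mul ?_ ?_) (Measurable.mul ?_ (h.measurable_drift hφ))
  · exact (measurable_const.indicator hS).comp h1
  · exact hφ.continuous.measurable.comp (by fun_prop)
  · exact (measurable_timeIn hS).comp h1

theorem IsTransportField.abs_backwardOp_le (h : IsTransportField P T K M b g) (S : Set (Ω × ℝ))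
    (φ : E d → ℝ) {z : Ω × ℝ × E d} (hz : z.2.1 ∈ Icc 0 T) :
    |backwardOp T b g S φ z| ≤ |φ z.2.2| + T * ((K z.1 + M) * testWeight φ z.2.2) := by
  unfold backwardOp
  refine (abs_sub _ _).trans (add_le_add ?_ ?_)
  · rw [abs_mul]
    exact mul_le_of_le_one_left (abs_nonneg _) (abs_indicator_one_le _ _)
  · rw [abs_mul]
    exact mul_le_mul (abs_timeIn_le hz) (abs_drift_le (h.growth_nonneg _) h.bound_nonneg
      (h.field_le _ _ _) (h.div_le _ _ _) φ) (abs_nonneg _) (hz.1.trans hz.2)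

/-- Integrability of the growth constant `K` in ω is what places the test functions of the duality
in L¹ of the product space. -/
theorem IsTransportField.integrable_backwardOp [IsFiniteMeasure P]
    (h : IsTransportField P T K M b g) {S : Set (Ω × ℝ)} (hS : MeasurableSet S) {φ : E d → ℝ}
    (hφ : IsTest φ) : Integrable (backwardOp T b g S φ) (spaceTime P T d) := by
  have h1 : Integrable (fun z : Ω × ℝ × E d => |φ z.2.2|) (spaceTime P T d) :=
    (hφ.integrable.abs.comp_snd (volume.restrict (Icc (0 : ℝ) T))).comp_snd P
  have h2 : Integrable (fun z : Ω × ℝ × E d => (K z.1 + M) * testWeight φ z.2.2)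
      (spaceTime P T d) :=
    (h.integrable_growth.add (integrable_const M)).mul_prod
      (hφ.integrable_testWeight.comp_snd (volume.restrict (Icc (0 : ℝ) T)))
  refine (h1.add (h2.const_mul T)).mono' (h.measurable_backwardOp hS hφ).aestronglyMeasurable ?_
  have h3 : ∀ᵐ t ∂(volume.restrict (Icc (0 : ℝ) T)), t ∈ Icc 0 T :=
    ae_restrict_mem measurableSet_Icc
  have h4 : ∀ᵐ z ∂(spaceTime P T d), z.2.1 ∈ Icc 0 T :=
    Measure.quasiMeasurePreserving_snd.ae (Measure.quasiMeasurePreserving_fst.ae h3)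
  filter_upwards [h4] with z hz using h.abs_backwardOp_le S φ hz

end Existence

/-! ### Weak solutions of the random transport equation, for almost every time. -/

section Existence

variable {Ω : Type*} [MeasurableSpace Ω] {d : ℕ} {P : Measure Ω} {T : ℝ} {K : Ω → ℝ} {M C : ℝ}
  {b : Ω → ℝ → E d → E d} {g : Ω → ℝ → E d → ℝ} {u₀ : Ω → E d → ℝ}

theorem integral_spaceTime [SFinite P] {f : Ω × ℝ × E d → ℝ} (hf : Integrable f (spaceTime P T d)) :
    ∫ z, f z ∂(spaceTime P T d) = ∫ ω, ∫ z, f (ω, z)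
      ∂((volume.restrict (Icc (0 : ℝ) T)).prod volume) ∂P :=
  integral_prod _ hf

theorem pairing_sum {J : Type*} {v : E d → ℝ} (hv : Measurable v) (hvC : ∀ x, |v x| ≤ C)
    (s : Finset J) {φ : J → E d → ℝ} (h : ∀ j, Integrable (φ j)) (c : J → ℝ) :
    pairing v (fun x => ∑ j ∈ s, c j * φ j x) = ∑ j ∈ s, c j * pairing v (φ j) := by
  unfold pairing
  simp only [← integral_const_mul]
  rw [← integral_finsetSum _ fun j _ => (integrable_mul_test hv hvC (h j)).const_mul (c j)]
  refine integral_congr_ae (ae_of_all _ fun x => ?_)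
  simp only [Finset.mul_sum]
  exact Finset.sum_congr rfl fun j _ => by ring

/-- For fixed ω this is the backward estimate with `a j = m j • 1_{S j}(ω, ·)`, whose primitives
from `t` to `T` are the weighted times spent in `S j`. -/
theorem IsTransportField.integral_timeIn_le (h : IsTransportField P T K M b g) (hT : 0 ≤ T)
    {J : Type*} (s : Finset J) (m : J → ℝ) {S : J → Set (Ω × ℝ)} (hS : ∀ j, MeasurableSet (S j))
    {φ : J → E d → ℝ} (hφ : ∀ j, IsTest (φ j)) :
    ∀ᵐ ω ∂P, ∫ x, |∑ j ∈ s, m j * timeIn T (S j) ω 0 * φ j x| ≤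
      ∫ z, |∑ j ∈ s, m j * backwardOp T b g (S j) (φ j) (ω, z)|
        ∂((volume.restrict (Icc (0 : ℝ) T)).prod (volume : Measure (E d))) := by
  filter_upwards [h.isWeakDiv] with ω hω
  have h1 := integral_abs_le_backward hT (h.growth_nonneg ω) h.bound_nonneg
    (h.measurable_field_path ω) (h.measurable_div_path ω) (h.field_le ω) (h.div_le ω) hω s
    (a := fun j r => m j * (S j).indicator (fun _ => (1 : ℝ)) (ω, r))
    (fun j => (((measurable_const.indicator (hS j)).comp
      (measurable_const.prodMk measurable_id))).const_mul _)
    (A := fun j => |m j|)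
    (fun j t => by
      rw [abs_mul]
      exact mul_le_of_le_one_right (abs_nonneg _) (abs_indicator_one_le _ _)) hφ
  simp only [intervalIntegral.integral_const_mul] at h1
  refine h1.trans (le_of_eq (integral_congr_ae (ae_of_all _ fun z => ?_)))
  simp only [backwardOp, timeIn, mul_sub, mul_assoc]

/-- The solvability condition of `exists_bounded_solution`: the pathwise L¹ estimate is integrated
in ω, and the bound on `u₀` supplies the constant. -/
theorem IsTransportField.abs_sum_le [IsFiniteMeasure P] (h : IsTransportField P T K M b g)
    (hT : 0 ≤ T) (hu₀m : Measurable fun z : Ω × E d => u₀ z.1 z.2)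
    (hu₀ : ∀ ω x, |u₀ ω x| ≤ C) (hC : 0 ≤ C)
    {J : Type*} (s : Finset J) (m : J → ℝ) {S : J → Set (Ω × ℝ)} (hS : ∀ j, MeasurableSet (S j))
    {φ : J → E d → ℝ} (hφ : ∀ j, IsTest (φ j)) :
    |∑ j ∈ s, m j * ∫ ω, timeIn T (S j) ω 0 * pairing (u₀ ω) (φ j) ∂P| ≤
      C * ∫ z, |∑ j ∈ s, m j * backwardOp T b g (S j) (φ j) z| ∂(spaceTime P T d) := by
  have h0 : (0 : ℝ) ∈ Icc 0 T := ⟨le_rfl, hT⟩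
  have hu₀s : ∀ ω, Measurable (u₀ ω) := fun ω => hu₀m.comp (measurable_const.prodMk measurable_id)
  have hUm : ∀ j, Measurable fun ω => pairing (u₀ ω) (φ j) := fun j =>
    measurable_pairing hu₀m ((hφ j).continuous.measurable.comp measurable_snd)
  have hαm : ∀ j, Measurable fun ω => timeIn T (S j) ω 0 := fun j =>
    (measurable_timeIn (hS j)).comp (measurable_id.prodMk measurable_const)
  have hi : ∀ j, Integrable (fun ω => timeIn T (S j) ω 0 * pairing (u₀ ω) (φ j)) P := by
    intro j
    refine (integrable_const (T * (C * ∫ x, |φ j x|))).mono'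
      ((hαm j).mul (hUm j)).aestronglyMeasurable (ae_of_all _ fun ω => ?_)
    rw [norm_mul]
    exact mul_le_mul (abs_timeIn_le h0) (abs_pairing_le (hu₀ ω) (hφ j).integrable)
      (abs_nonneg _) hT
  have hF : Integrable (fun z => |∑ j ∈ s, m j * backwardOp T b g (S j) (φ j) z|)
      (spaceTime P T d) :=
    (integrable_finsetSum _ fun j _ => (h.integrable_backwardOp (hS j) (hφ j)).const_mul _).abs
  have h1 : ∑ j ∈ s, m j * ∫ ω, timeIn T (S j) ω 0 * pairing (u₀ ω) (φ j) ∂P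
      = ∫ ω, pairing (u₀ ω) (fun x => ∑ j ∈ s, m j * timeIn T (S j) ω 0 * φ j x) ∂P := by
    simp only [← integral_const_mul]
    rw [← integral_finsetSum _ fun j _ => (hi j).const_mul _]
    refine integral_congr_ae (ae_of_all _ fun ω => ?_)
    simp only
    rw [pairing_sum (hu₀s ω) (hu₀ ω) s fun j => (hφ j).integrable]
    simp only [mul_assoc]
  rw [h1, integral_spaceTime hF, ← integral_const_mul, ← Real.norm_eq_abs]
  refine norm_integral_le_of_norm_le ((Integrable.integral_prod_left hF).const_mul C) ?_
  filter_upwards [h.integral_timeIn_le hT s m hS hφ] with ω hω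
  refine (abs_pairing_le (hu₀ ω) (IsTest.sum s hφ _).integrable).trans ?_
  exact mul_le_mul_of_nonneg_left hω hC

/-- The tested form of the transport equation on a set of `(ω, t)`. -/
theorem IsTransportField.integral_mul_backwardOp (h : IsTransportField P T K M b g) (hT : 0 ≤ T)
    {v : ℝ → E d → ℝ} (hvm : Measurable fun z : ℝ × E d => v z.1 z.2)
    (hv : ∀ t x, |v t x| ≤ C) (ω : Ω) {S : Set (Ω × ℝ)} (hS : MeasurableSet S) {φ : E d → ℝ}
    (hφ : IsTest φ) :
    ∫ z, v z.1 z.2 * backwardOp T b g S φ (ω, z) ∂((volume.restrict (Icc (0 : ℝ) T)).prod volume)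
      = ∫ t in Icc 0 T, S.indicator (fun _ => (1 : ℝ)) (ω, t) * (pairing (v t) φ
        - ∫ r in (0 : ℝ)..t, pairing (v r) (drift (b ω r) (g ω r) φ)) := by
  set G : ℝ → ℝ := fun r => pairing (v r) (drift (b ω r) (g ω r) φ) with hG
  set χ : ℝ → ℝ := fun t => S.indicator (fun _ => (1 : ℝ)) (ω, t) with hχ
  have hvs : ∀ t, Measurable (v t) := fun t => hvm.comp (measurable_const.prodMk measurable_id)
  have hGm : Measurable G :=
    measurable_pairing hvm ((RTE.measurable_drift (h.measurable_field_path ω)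
      (h.measurable_div_path ω) hφ))
  have hGb : ∀ t, |G t| ≤ C * ((K ω + M) * ∫ x, testWeight φ x) := fun t =>
    h.abs_pairing_drift_le hφ (hv t) ω t
  have hχm : Measurable χ := (measurable_const.indicator hS).comp
    (measurable_const.prodMk measurable_id)
  have hχb : ∀ t, |χ t| ≤ 1 := fun t => abs_indicator_one_le _ _
  have hHm : Measurable fun t => pairing (v t) φ :=
    measurable_pairing hvm (hφ.continuous.measurable.comp measurable_snd)
  have hHb : ∀ t, |pairing (v t) φ| ≤ C * ∫ x, |φ x| := fun t => abs_pairing_le (hv t) hφ.integrable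
  have hαm : Measurable fun t => timeIn T S ω t :=
    (measurable_timeIn hS).comp (measurable_const.prodMk measurable_id)
  have hI : Integrable (fun z : ℝ × E d => v z.1 z.2 * backwardOp T b g S φ (ω, z))
      ((volume.restrict (Icc (0 : ℝ) T)).prod volume) := by
    refine Integrable.bdd_mul (c := C) ?_ hvm.aestronglyMeasurable (ae_of_all _ fun z => hv _ _)
    have h1 : Integrable (fun x => |φ x| + T * ((K ω + M) * testWeight φ x)) :=
      hφ.integrable.abs.add ((hφ.integrable_testWeight.const_mul _).const_mul _)
    refine (h1.comp_snd _).mono' ((h.measurable_backwardOp hS hφ).comp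
      (measurable_const.prodMk measurable_id)).aestronglyMeasurable ?_
    have h3 : ∀ᵐ t ∂(volume.restrict (Icc (0 : ℝ) T)), t ∈ Icc 0 T :=
      ae_restrict_mem measurableSet_Icc
    filter_upwards [Measure.quasiMeasurePreserving_fst.ae h3] with z hz
    exact h.abs_backwardOp_le S φ (z := (ω, z)) hz
  have hfin : IntegrableOn (fun t => χ t * pairing (v t) φ) (Icc 0 T) := by
    refine (integrable_const (1 * (C * ∫ x, |φ x|))).mono' (hχm.mul hHm).aestronglyMeasurable
      (ae_of_all _ fun t => ?_)
    rw [norm_mul]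
    exact mul_le_mul (hχb t) (hHb t) (norm_nonneg _) zero_le_one
  have hfin2 : IntegrableOn (fun t => timeIn T S ω t * G t) (Icc 0 T) := by
    refine (integrable_const (T * (C * ((K ω + M) * ∫ x, testWeight φ x)))).mono'
      (hαm.mul hGm).aestronglyMeasurable ?_
    filter_upwards [ae_restrict_mem measurableSet_Icc] with t ht
    rw [norm_mul]
    exact mul_le_mul (abs_timeIn_le ht) (hGb t) (norm_nonneg _) hT
  have hQm : Measurable fun t => ∫ r in (0 : ℝ)..t, G r := by
    exact measurable_intervalIntegral (a := fun _ r => G r) (hGm.comp measurable_snd)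
      measurable_const measurable_id
  have hfin3 : IntegrableOn (fun t => χ t * ∫ r in (0 : ℝ)..t, G r) (Icc 0 T) := by
    refine (integrable_const (1 * (C * ((K ω + M) * ∫ x, testWeight φ x) * T))).mono'
      (hχm.mul hQm).aestronglyMeasurable ?_
    filter_upwards [ae_restrict_mem measurableSet_Icc] with t ht
    rw [norm_mul]
    refine mul_le_mul (hχb t) ?_ (norm_nonneg _) zero_le_one
    refine (intervalIntegral.norm_integral_le_of_norm_le_const (f := G) fun r _ => hGb r).trans ?_
    refine mul_le_mul_of_nonneg_left ?_ ((abs_nonneg _).trans (hGb 0))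
    rw [sub_zero, abs_of_nonneg ht.1]
    exact ht.2
  rw [integral_prod _ hI]
  have h1 : ∀ t, ∫ x, v t x * backwardOp T b g S φ (ω, t, x)
      = χ t * pairing (v t) φ - timeIn T S ω t * G t := by
    intro t
    have h2 := (integrable_mul_test (hvs t) (hv t) hφ.integrable).const_mul (χ t)
    have h3 := (integrable_mul_test (hvs t) (hv t) (h.integrable_drift hφ ω t)).const_mul
      (timeIn T S ω t)
    simp only [hG, pairing]
    rw [← integral_const_mul, ← integral_const_mul, ← integral_sub h2 h3]
    refine integral_congr_ae (ae_of_all _ fun x => ?_)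
    simp only [backwardOp, hχ]
    ring
  simp only [h1]
  rw [integral_sub hfin hfin2]
  -- Integration by parts in time trades the remaining time in `S` for the accumulated drift, so
  -- that only the indicator of `S` multiplies the equation.
  have h4 := integral_primitive_mul hT hχm hGm hχb hGb
  have h5 : ∫ t in Icc 0 T, timeIn T S ω t * G t = ∫ t in Icc 0 T, χ t * ∫ r in (0 : ℝ)..t, G r := h4
  rw [h5, ← integral_sub hfin hfin3]
  refine integral_congr_ae (ae_of_all _ fun t => ?_)
  simp only [hχ, mul_sub]

theorem measurable_drift_param {Y : Type*} [MeasurableSpace Y] {b : Y → E d → E d}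
    {g φ : Y → E d → ℝ} (hb : Measurable fun z : Y × E d => b z.1 z.2)
    (hg : Measurable fun z : Y × E d => g z.1 z.2) (hφ : Measurable fun z : Y × E d => φ z.1 z.2)
    (hpd : ∀ i, Measurable fun z : Y × E d => pd i (φ z.1) z.2) :
    Measurable fun z : Y × E d => drift (b z.1) (g z.1) (φ z.1) z.2 := by
  unfold drift
  refine Measurable.add (Finset.measurable_sum _ fun i _ => Measurable.mul ?_ (hpd i)) (hg.mul hφ)
  fun_prop

theorem measurable_weakRHS {Y : Type*} [MeasurableSpace Y] {b : Y → ℝ → E d → E d}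
    {g v : Y → ℝ → E d → ℝ} {u₀ φ : Y → E d → ℝ} {t : Y → ℝ}
    (hb : Measurable fun z : Y × ℝ × E d => b z.1 z.2.1 z.2.2)
    (hg : Measurable fun z : Y × ℝ × E d => g z.1 z.2.1 z.2.2)
    (hv : Measurable fun z : Y × ℝ × E d => v z.1 z.2.1 z.2.2)
    (hu₀ : Measurable fun z : Y × E d => u₀ z.1 z.2)
    (hφ : Measurable fun z : Y × E d => φ z.1 z.2)
    (hpd : ∀ i, Measurable fun z : Y × E d => pd i (φ z.1) z.2) (ht : Measurable t) :
    Measurable fun y => weakRHS (b y) (g y) (u₀ y) (v y) (φ y) (t y) := by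
  refine (measurable_pairing hu₀ hφ).add (measurable_intervalIntegral ?_ measurable_const ht)
  have hA : Measurable fun z : (Y × ℝ) × E d => (z.1.1, z.1.2, z.2) := by fun_prop
  have hB : Measurable fun z : (Y × ℝ) × E d => (z.1.1, z.2) := by fun_prop
  exact measurable_pairing (Y := Y × ℝ) (v := fun y => v y.1 y.2) (hv.comp hA)
    (measurable_drift_param (Y := Y × ℝ) (b := fun y => b y.1 y.2) (g := fun y => g y.1 y.2)
      (φ := fun y => φ y.1) (hb.comp hA) (hg.comp hA) (hφ.comp hB) fun i => (hpd i).comp hB)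

/-- Existence of a bounded weak solution of the transport equation, for almost every time. -/
theorem IsTransportField.exists_weak_solution [IsFiniteMeasure P]
    (h : IsTransportField P T K M b g)
    (hT : 0 ≤ T) (hu₀m : Measurable fun z : Ω × E d => u₀ z.1 z.2)
    (hu₀ : ∀ ω x, |u₀ ω x| ≤ C) (hC : 0 ≤ C) :
    ∃ v : Ω → ℝ → E d → ℝ, (Measurable fun z : Ω × ℝ × E d => v z.1 z.2.1 z.2.2) ∧
      (∀ ω t x, |v ω t x| ≤ C) ∧ ∀ φ : E d → ℝ, IsTest φ →
        ∀ᵐ ω ∂P, ∀ᵐ t ∂(volume.restrict (Icc (0 : ℝ) T)),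
          pairing (v ω t) φ = weakRHS (b ω) (g ω) (u₀ ω) (v ω) φ t := by
  have : SigmaFinite (spaceTime P T d) := by unfold spaceTime; infer_instance
  -- For fixed φ, the equations indexed by all measurable `S` say that the defect `D` of the weak
  -- equation has integral zero over every `S`, hence vanishes almost everywhere.
  let J := {p : Set (Ω × ℝ) × (E d → ℝ) // MeasurableSet p.1 ∧ IsTest p.2}
  obtain ⟨v, hvm, hvC, hv⟩ := exists_bounded_solution (μ := spaceTime P T d)
    (fun j : J => backwardOp T b g j.1.1 j.1.2)
    (fun j => h.integrable_backwardOp j.2.1 j.2.2)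
    (fun j => ∫ ω, timeIn T j.1.1 ω 0 * pairing (u₀ ω) j.1.2 ∂P) hC
    (fun s m => h.abs_sum_le hT hu₀m hu₀ hC s m (fun j => j.2.1) (fun j => j.2.2))
  refine ⟨fun ω t x => v (ω, t, x), hvm, fun ω t x => hvC _, fun φ hφ => ?_⟩
  set τ : Measure ℝ := volume.restrict (Icc (0 : ℝ) T) with hτ
  set w : Ω → ℝ → E d → ℝ := fun ω t x => v (ω, t, x) with hw
  set D : Ω × ℝ → ℝ := fun y => pairing (w y.1 y.2) φ
    - weakRHS (b y.1) (g y.1) (u₀ y.1) (w y.1) φ y.2 with hD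
  have hA : Measurable fun z : (Ω × ℝ) × E d => (z.1.1, z.1.2, z.2) := by fun_prop
  have hB : Measurable fun z : (Ω × ℝ) × ℝ × E d => (z.1.1, z.2.1, z.2.2) := by fun_prop
  have hE : Measurable fun z : (Ω × ℝ) × E d => (z.1.1, z.2) := by fun_prop
  have hφm := hφ.continuous.measurable
  have hDm : Measurable D :=
    (measurable_pairing (v := fun y : Ω × ℝ => w y.1 y.2) (φ := fun _ => φ) (hvm.comp hA)
        (hφm.comp measurable_snd)).sub
      (measurable_weakRHS (Y := Ω × ℝ) (b := fun y => b y.1) (g := fun y => g y.1)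
        (v := fun y => w y.1) (u₀ := fun y => u₀ y.1) (φ := fun _ => φ) (t := fun y => y.2)
        (h.measurable_field.comp hB) (h.measurable_div.comp hB) (hvm.comp hB) (hu₀m.comp hE)
        (hφm.comp measurable_snd)
        (fun i => (hφ.pd i).continuous.measurable.comp measurable_snd) measurable_snd)
  have hDb : ∀ ω, ∀ t ∈ Icc 0 T, |D (ω, t)| ≤
      2 * (C * ∫ x, |φ x|) + C * ((K ω + M) * ∫ x, testWeight φ x) * T := by
    intro ω t ht
    have h1 := abs_pairing_le (fun x => hvC (ω, t, x)) hφ.integrable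
    have h2 := abs_pairing_le (hu₀ ω) hφ.integrable
    have h3 : |∫ s in (0 : ℝ)..t, pairing (w ω s) (drift (b ω s) (g ω s) φ)|
        ≤ C * ((K ω + M) * ∫ x, testWeight φ x) * T := by
      have h4 : ∀ s, |pairing (w ω s) (drift (b ω s) (g ω s) φ)|
        ≤ C * ((K ω + M) * ∫ x, testWeight φ x) := fun s =>
          h.abs_pairing_drift_le hφ (fun x => hvC (ω, s, x)) ω s
      refine (intervalIntegral.norm_integral_le_of_norm_le_const
        (f := fun s => pairing (w ω s) (drift (b ω s) (g ω s) φ)) fun r _ => h4 r).trans ?_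
      refine mul_le_mul_of_nonneg_left ?_ ((abs_nonneg _).trans (h4 0))
      rw [sub_zero, abs_of_nonneg ht.1]
      exact ht.2
    simp only [hD, weakRHS]
    refine (abs_sub _ _).trans ?_
    have h5 := abs_add_le (pairing (u₀ ω) φ)
      (∫ s in (0 : ℝ)..t, pairing (w ω s) (drift (b ω s) (g ω s) φ))
    have h6 : |pairing (w ω t) φ| ≤ C * ∫ x, |φ x| := h1
    linarith
  have hKi : Integrable (fun ω => 2 * (C * ∫ x, |φ x|)
      + C * ((K ω + M) * ∫ x, testWeight φ x) * T) P :=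
    (integrable_const _).add
      ((((h.integrable_growth.add (integrable_const M)).mul_const _).const_mul C).mul_const T)
  have hτm : ∀ᵐ t ∂τ, t ∈ Icc 0 T := ae_restrict_mem measurableSet_Icc
  have hDi : Integrable D (P.prod τ) := by
    refine (hKi.comp_fst τ).mono' hDm.aestronglyMeasurable ?_
    filter_upwards [Measure.quasiMeasurePreserving_snd.ae hτm] with y hy using hDb y.1 y.2 hy
  have hset : ∀ S, MeasurableSet S → ∫ y in S, D y ∂(P.prod τ) = 0 := by
    intro S hS
    rw [← integral_indicator hS, integral_prod _ (hDi.indicator hS)]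
    have hbi : Integrable (fun z => v z * backwardOp T b g S φ z) (spaceTime P T d) :=
      (h.integrable_backwardOp hS hφ).bdd_mul hvm.aestronglyMeasurable (c := C) (ae_of_all _ hvC)
    have hαm : Measurable fun ω => timeIn T S ω 0 :=
      (measurable_timeIn hS).comp (measurable_id.prodMk measurable_const)
    have hUm : Measurable fun ω => pairing (u₀ ω) φ :=
      measurable_pairing hu₀m (hφm.comp measurable_snd)
    have hci : Integrable (fun ω => timeIn T S ω 0 * pairing (u₀ ω) φ) P := by
      refine (integrable_const (T * (C * ∫ x, |φ x|))).mono'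
        (hαm.mul hUm).aestronglyMeasurable (ae_of_all _ fun ω => ?_)
      rw [norm_mul]
      exact mul_le_mul (abs_timeIn_le ⟨le_rfl, hT⟩) (abs_pairing_le (hu₀ ω) hφ.integrable)
        (abs_nonneg _) hT
    have h1 : ∀ ω, ∫ t, S.indicator D (ω, t) ∂τ
        = (∫ z, v (ω, z) * backwardOp T b g S φ (ω, z) ∂(τ.prod volume))
          - timeIn T S ω 0 * pairing (u₀ ω) φ := by
      intro ω
      have h2 := h.integral_mul_backwardOp hT (v := w ω)
        (hvm.comp (measurable_const.prodMk measurable_id)) (fun t x => hvC (ω, t, x)) ω hS hφ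
      have h3 : timeIn T S ω 0 = ∫ t, S.indicator (fun _ => (1 : ℝ)) (ω, t) ∂τ := by
        rw [timeIn, intervalIntegral.integral_of_le hT, hτ, ← integral_Icc_eq_integral_Ioc]
      have hχm : Measurable fun t => S.indicator (fun _ => (1 : ℝ)) (ω, t) :=
        (measurable_const.indicator hS).comp (measurable_const.prodMk measurable_id)
      have hχi : Integrable (fun t => S.indicator (fun _ => (1 : ℝ)) (ω, t)) τ :=
        (integrable_const (1 : ℝ)).mono' hχm.aestronglyMeasurable
          (ae_of_all _ fun t => abs_indicator_one_le _ _)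
      have hDω : Integrable (fun t => S.indicator D (ω, t)) τ := by
        refine (integrable_const (2 * (C * ∫ x, |φ x|)
            + C * ((K ω + M) * ∫ x, testWeight φ x) * T)).mono'
          ((hDm.indicator hS).comp (measurable_const.prodMk measurable_id)).aestronglyMeasurable ?_
        filter_upwards [hτm] with t ht
        exact (norm_indicator_le_norm_self _ _).trans (hDb ω t ht)
      rw [eq_sub_iff_add_eq, h3, ← integral_mul_const,
        ← integral_add hDω (hχi.mul_const _)]
      refine Eq.trans ?_ h2.symm
      refine integral_congr_ae (ae_of_all _ fun t => ?_)
      by_cases hx : (ω, t) ∈ S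
      · simp only [indicator_of_mem hx, hD, weakRHS, one_mul]
        ring
      · simp [indicator_of_notMem hx]
    simp only [h1]
    rw [integral_sub (Integrable.integral_prod_left hbi) hci, ← integral_spaceTime hbi, sub_eq_zero]
    exact hv ⟨(S, φ), hS, hφ⟩
  have hz : D =ᵐ[P.prod τ] 0 :=
    ae_eq_zero_of_forall_setIntegral_eq_of_sigmaFinite (fun s _ _ => hDi.integrableOn)
      fun s hs _ => hset s hs
  filter_upwards [Measure.ae_ae_of_ae_prod hz] with ω hω
  filter_upwards [hω] with t ht
  exact sub_eq_zero.1 ht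

end Existence

/-! ### A countable dense family of test functions. -/

section DenseTests

variable {d : ℕ}

/-- The first-order jet of `φ`, weighted by `1 + |x|`. -/
def weightedJet (φ : E d → ℝ) (x : E d) : ℝ × (Fin d → ℝ) :=
  (1 + ‖x‖) • (φ x, fun i => pd i φ x)

theorem norm_weightedJet_le (φ : E d → ℝ) (x : E d) : ‖weightedJet φ x‖ ≤ testWeight φ x := by
  unfold weightedJet testWeight
  have h0 : (0 : ℝ) ≤ 1 + ‖x‖ := by positivity
  rw [norm_smul, Real.norm_of_nonneg h0]
  refine mul_le_mul_of_nonneg_left ?_ h0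
  rw [Prod.norm_mk]
  have h1 : 0 ≤ ∑ i, |pd i φ x| := by positivity
  refine max_le (by rw [Real.norm_eq_abs]; linarith) ((pi_norm_le_iff_of_nonneg (by positivity)).2
    fun i => ?_)
  have := Finset.single_le_sum (f := fun i => |pd i φ x|) (fun i _ => abs_nonneg _)
    (Finset.mem_univ i)
  rw [Real.norm_eq_abs]
  linarith [abs_nonneg (φ x)]

theorem testWeight_le_norm_weightedJet (φ : E d → ℝ) (x : E d) :
    testWeight φ x ≤ (d + 1) * ‖weightedJet φ x‖ := by
  unfold weightedJet testWeight
  have h0 : (0 : ℝ) ≤ 1 + ‖x‖ := by positivity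
  rw [norm_smul, Real.norm_of_nonneg h0, mul_left_comm]
  refine mul_le_mul_of_nonneg_left ?_ h0
  set p : ℝ × (Fin d → ℝ) := (φ x, fun i => pd i φ x) with hp
  have h1 : |φ x| ≤ ‖p‖ := norm_fst_le p
  have h2 : ∑ i, |pd i φ x| ≤ d * ‖p‖ := by
    have : ∑ i : Fin d, |pd i φ x| ≤ ∑ _i : Fin d, ‖p‖ :=
      Finset.sum_le_sum fun i _ => (norm_le_pi_norm (fun i => pd i φ x) i).trans (norm_snd_le p)
    simpa using this
  linarith

theorem IsTest.integrable_weightedJet {φ : E d → ℝ} (h : IsTest φ) : Integrable (weightedJet φ) := by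
  refine h.integrable_testWeight.mono' (Continuous.aestronglyMeasurable ?_)
    (ae_of_all _ (norm_weightedJet_le φ))
  unfold weightedJet
  have h1 := fun i => (h.pd i).continuous
  have h2 := h.continuous
  fun_prop

theorem weightedJet_sub {φ ψ : E d → ℝ} (h : IsTest φ) (h' : IsTest ψ) (x : E d) :
    weightedJet (fun x => φ x - ψ x) x = weightedJet φ x - weightedJet ψ x := by
  unfold weightedJet
  rw [← smul_sub]
  congr 1
  ext i
  · rfl
  · exact pd_sub h h' i x

/-- There is a countable set of test functions that is dense in the weighted `W^{1,1}` norm. -/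
theorem exists_dense_tests (d : ℕ) : ∃ D : ℕ → E d → ℝ, (∀ n, IsTest (D n)) ∧
    ∀ φ, IsTest φ → ∀ ε > 0, ∃ n, ∫ x, testWeight (fun x => φ x - D n x) x < ε := by
  -- Weighted jets embed the test functions in a separable L¹ space, and subsets of separable metric
  -- spaces are separable. A countable family is needed because the exceptional null set of the weak
  -- equation depends on φ.
  let ι : {φ : E d → ℝ // IsTest φ} → (E d →₁[volume] (ℝ × (Fin d → ℝ))) :=
    fun φ => φ.2.integrable_weightedJet.toL1 _
  have : Nonempty (range ι) := ⟨⟨_, ⟨⟨_, IsTest.zero⟩, rfl⟩⟩⟩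
  have : SecondCountableTopology (E d →₁[volume] (ℝ × (Fin d → ℝ))) := by
    have : Fact ((1 : ℝ≥0∞) ≠ ⊤) := ⟨ENNReal.one_ne_top⟩
    infer_instance
  have hpre : ∀ n, ∃ φ, ι φ = TopologicalSpace.denseSeq (range ι) n := fun n =>
    (TopologicalSpace.denseSeq (range ι) n).2
  choose D hD using hpre
  refine ⟨fun n => (D n).1, fun n => (D n).2, fun φ hφ ε hε => ?_⟩
  have hd : (0 : ℝ) < d + 1 := by positivity
  obtain ⟨n, hn⟩ := (TopologicalSpace.denseRange_denseSeq (range ι)).exists_dist_lt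
    (⟨ι ⟨φ, hφ⟩, mem_range_self _⟩ : range ι) (div_pos hε hd)
  refine ⟨n, ?_⟩
  rw [Subtype.dist_eq, ← hD n, dist_eq_norm, ← Integrable.toL1_sub, L1.norm_eq_integral_norm] at hn
  have h1 : ∫ x, ‖(hφ.integrable_weightedJet.sub (D n).2.integrable_weightedJet).toL1 _ x‖
      = ∫ x, ‖weightedJet (fun x => φ x - (D n).1 x) x‖ := by
    refine integral_congr_ae ?_
    filter_upwards [(hφ.integrable_weightedJet.sub (D n).2.integrable_weightedJet).coeFn_toL1]
      with x hx
    rw [hx, weightedJet_sub hφ (D n).2, Pi.sub_apply]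
  have h2 := hφ.sub (D n).2
  calc ∫ x, testWeight (fun x => φ x - (D n).1 x) x
      ≤ ∫ x, (d + 1) * ‖weightedJet (fun x => φ x - (D n).1 x) x‖ :=
        integral_mono h2.integrable_testWeight (h2.integrable_weightedJet.norm.const_mul _)
          fun x => testWeight_le_norm_weightedJet _ x
    _ < ε := by
      rw [integral_const_mul, ← h1, ← lt_div_iff₀' hd]
      exact hn

end DenseTests

/-! ### The right-hand side of the equation for a single realisation. -/

section WeakRHS

variable {d : ℕ} {T K M C : ℝ} {b : ℝ → E d → E d} {g : ℝ → E d → ℝ} {u₀ : E d → ℝ}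
  {v : ℝ → E d → ℝ} {φ ψ : E d → ℝ}

/-- The data of the transport equation for one realisation. -/
structure IsTransportPath (K M C : ℝ) (b : ℝ → E d → E d) (g : ℝ → E d → ℝ) (u₀ : E d → ℝ)
    (v : ℝ → E d → ℝ) : Prop where
  growth_nonneg : 0 ≤ K
  bound_nonneg : 0 ≤ M
  measurable_field : Measurable fun z : ℝ × E d => b z.1 z.2
  measurable_div : Measurable fun z : ℝ × E d => g z.1 z.2
  measurable_init : Measurable u₀
  measurable_sol : Measurable fun z : ℝ × E d => v z.1 z.2
  field_le : ∀ t x, ‖b t x‖ ≤ K * (1 + ‖x‖)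
  div_le : ∀ t x, |g t x| ≤ M
  init_le : ∀ x, |u₀ x| ≤ C
  sol_le : ∀ t x, |v t x| ≤ C

namespace IsTransportPath

variable (h : IsTransportPath K M C b g u₀ v)
include h

theorem measurable_field_slice (t : ℝ) : Measurable (b t) :=
  h.measurable_field.comp (measurable_const.prodMk measurable_id)

theorem measurable_div_slice (t : ℝ) : Measurable (g t) :=
  h.measurable_div.comp (measurable_const.prodMk measurable_id)

theorem measurable_sol_slice (t : ℝ) : Measurable (v t) :=
  h.measurable_sol.comp (measurable_const.prodMk measurable_id)

theorem nonneg : 0 ≤ C := (abs_nonneg _).trans (h.init_le 0)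

theorem integrable_drift (hφ : IsTest φ) (t : ℝ) : Integrable (drift (b t) (g t) φ) :=
  RTE.integrable_drift h.growth_nonneg h.bound_nonneg (h.measurable_field_slice t)
    (h.measurable_div_slice t) (h.field_le t) (h.div_le t) hφ

theorem abs_pairing_drift_le (hφ : IsTest φ) (t : ℝ) :
    |pairing (v t) (drift (b t) (g t) φ)| ≤ C * ((K + M) * ∫ x, testWeight φ x) :=
  RTE.abs_pairing_drift_le h.growth_nonneg h.bound_nonneg (h.sol_le t) (h.measurable_field_slice t)
    (h.measurable_div_slice t) (h.field_le t) (h.div_le t) hφ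

theorem measurable_pairing_drift (hφ : IsTest φ) :
    Measurable fun t => pairing (v t) (drift (b t) (g t) φ) :=
  measurable_pairing h.measurable_sol (RTE.measurable_drift h.measurable_field h.measurable_div hφ)

theorem intervalIntegrable (hφ : IsTest φ) (s t : ℝ) :
    IntervalIntegrable (fun t => pairing (v t) (drift (b t) (g t) φ)) volume s t :=
  intervalIntegrable_of_bound (h.measurable_pairing_drift hφ) (h.abs_pairing_drift_le hφ) s t

theorem continuous_weakRHS (hφ : IsTest φ) : Continuous (weakRHS b g u₀ v φ) :=
  continuous_const.add (intervalIntegral.continuous_primitive (h.intervalIntegrable hφ) 0)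

theorem weakRHS_sub (hφ : IsTest φ) (hψ : IsTest ψ) (t : ℝ) :
    weakRHS b g u₀ v (fun x => φ x - ψ x) t = weakRHS b g u₀ v φ t - weakRHS b g u₀ v ψ t := by
  unfold weakRHS
  have h1 : ∀ s, pairing (v s) (drift (b s) (g s) fun x => φ x - ψ x)
      = pairing (v s) (drift (b s) (g s) φ) - pairing (v s) (drift (b s) (g s) ψ) := by
    intro s
    rw [← pairing_sub (h.measurable_sol_slice s) (h.sol_le s) (h.integrable_drift hφ s)
      (h.integrable_drift hψ s)]
    congr 1
    funext x
    exact drift_sub _ _ hφ hψ x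
  simp only [h1]
  rw [pairing_sub h.measurable_init h.init_le hφ.integrable hψ.integrable,
    intervalIntegral.integral_sub (h.intervalIntegrable hφ _ _) (h.intervalIntegrable hψ _ _)]
  ring

theorem weakRHS_sum {J : Type*} (s : Finset J) {φ : J → E d → ℝ} (hφ : ∀ j, IsTest (φ j))
    (c : J → ℝ) (t : ℝ) :
    weakRHS b g u₀ v (fun x => ∑ j ∈ s, c j * φ j x) t
      = ∑ j ∈ s, c j * weakRHS b g u₀ v (φ j) t := by
  unfold weakRHS
  have h1 : ∀ r, pairing (v r) (drift (b r) (g r) fun x => ∑ j ∈ s, c j * φ j x)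
      = ∑ j ∈ s, c j * pairing (v r) (drift (b r) (g r) (φ j)) := by
    intro r
    rw [← pairing_sum (h.measurable_sol_slice r) (h.sol_le r) s
      fun j => h.integrable_drift (hφ j) r]
    congr 1
    funext x
    exact drift_sum _ _ s hφ c x
  simp only [h1, mul_add, Finset.sum_add_distrib]
  rw [pairing_sum h.measurable_init h.init_le s fun j => (hφ j).integrable,
    intervalIntegral.integral_finsetSum fun j _ => (h.intervalIntegrable (hφ j) _ _).const_mul _]
  simp only [intervalIntegral.integral_const_mul]

theorem abs_weakRHS_le (hφ : IsTest φ) {t : ℝ} (ht : t ∈ Icc 0 T) :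
    |weakRHS b g u₀ v φ t| ≤ (C + C * (K + M) * T) * ∫ x, testWeight φ x := by
  have h1 := abs_pairing_le h.init_le hφ.integrable
  have h2 : ∫ x, |φ x| ≤ ∫ x, testWeight φ x :=
    integral_mono hφ.integrable.abs hφ.integrable_testWeight (abs_le_testWeight φ)
  have h4 := h.abs_pairing_drift_le hφ
  have h3 : |∫ s in (0 : ℝ)..t, pairing (v s) (drift (b s) (g s) φ)|
      ≤ C * ((K + M) * ∫ x, testWeight φ x) * T := by
    refine (intervalIntegral.norm_integral_le_of_norm_le_const
      (f := fun s => pairing (v s) (drift (b s) (g s) φ)) fun r _ => h4 r).trans ?_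
    refine mul_le_mul_of_nonneg_left ?_ ((abs_nonneg _).trans (h4 0))
    rw [sub_zero, abs_of_nonneg ht.1]
    exact ht.2
  have h5 := mul_le_mul_of_nonneg_left h2 h.nonneg
  unfold weakRHS
  refine (abs_add_le _ _).trans ?_
  nlinarith

/-- Equality for countably many dense test functions implies equality for all of them. -/
theorem pairing_eq_weakRHS_of_dense {D : ℕ → E d → ℝ} (hD : ∀ n, IsTest (D n))
    (hdense : ∀ φ, IsTest φ → ∀ ε > 0, ∃ n, ∫ x, testWeight (fun x => φ x - D n x) x < ε)
    {t : ℝ} (ht : t ∈ Icc 0 T) (heq : ∀ n, pairing (v t) (D n) = weakRHS b g u₀ v (D n) t)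
    (hφ : IsTest φ) : pairing (v t) φ = weakRHS b g u₀ v φ t := by
  have hC := h.nonneg
  have hT : 0 ≤ T := ht.1.trans ht.2
  have hK := h.growth_nonneg
  have hM := h.bound_nonneg
  rw [← sub_eq_zero, ← abs_eq_zero]
  refine le_antisymm (le_of_forall_pos_le_add fun ε hε => ?_) (abs_nonneg _)
  -- Of the weighted norm of `φ - D n`, the left side of the equation costs a factor `C` and the
  -- right side the bracket; the 1 ensures positivity.
  set A : ℝ := C + (C + C * (K + M) * T) + 1 with hA
  have hA0 : 0 < A := by positivity
  obtain ⟨n, hn⟩ := hdense φ hφ (ε / A) (div_pos hε hA0)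
  have hs := hφ.sub (hD n)
  have h1 : pairing (v t) φ - weakRHS b g u₀ v φ t
      = pairing (v t) (fun x => φ x - D n x) - weakRHS b g u₀ v (fun x => φ x - D n x) t := by
    rw [pairing_sub (h.measurable_sol_slice t) (h.sol_le t) hφ.integrable (hD n).integrable,
      h.weakRHS_sub hφ (hD n), heq n]
    ring
  have h2 := abs_pairing_le (h.sol_le t) hs.integrable
  have h3 : ∫ x, |φ x - D n x| ≤ ∫ x, testWeight (fun x => φ x - D n x) x :=
    integral_mono hs.integrable.abs hs.integrable_testWeight (abs_le_testWeight _)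
  have h4 := h.abs_weakRHS_le hs ht
  have h5 : 0 ≤ ∫ x, testWeight (fun x => φ x - D n x) x :=
    integral_nonneg fun x => testWeight_nonneg _ x
  rw [lt_div_iff₀ hA0] at hn
  rw [h1, zero_add]
  refine (abs_sub _ _).trans ?_
  have h6 := mul_le_mul_of_nonneg_left h3 hC
  nlinarith

/-- If the equation holds at almost every time then its right-hand side is represented, at every
time, by a bounded function. -/
theorem exists_representative (hT : 0 < T)
    (heq : ∀ᵐ t ∂(volume.restrict (Icc (0 : ℝ) T)), ∀ φ, IsTest φ →
      pairing (v t) φ = weakRHS b g u₀ v φ t) {t : ℝ} (ht : t ∈ Icc 0 T) :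
    ∃ m : E d → ℝ, Measurable m ∧ (∀ x, |m x| ≤ C) ∧
      ∀ φ, IsTest φ → pairing m φ = weakRHS b g u₀ v φ t := by
  have hbound : ∀ φ, IsTest φ → |weakRHS b g u₀ v φ t| ≤ C * ∫ x, |φ x| := by
    intro φ hφ
    -- Written with a maximum, the bound becomes an equality of continuous functions, and an almost
    -- everywhere equality on a nondegenerate interval holds at every `t`.
    have h1 : (fun t => max |weakRHS b g u₀ v φ t| (C * ∫ x, |φ x|))
        =ᵐ[volume.restrict (Icc 0 T)] fun _ => C * ∫ x, |φ x| := by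
      filter_upwards [heq] with t ht
      rw [max_eq_right_iff, ← ht φ hφ]
      exact abs_pairing_le (h.sol_le t) hφ.integrable
    have h2 := Measure.eqOn_Icc_of_ae_eq volume hT.ne h1
      ((h.continuous_weakRHS hφ).abs.max continuous_const).continuousOn continuousOn_const ht
    exact max_eq_right_iff.1 h2
  let J := {φ : E d → ℝ // IsTest φ}
  obtain ⟨m, hm, hmC, hmeq⟩ := exists_bounded_solution (μ := (volume : Measure (E d)))
    (fun j : J => j.1) (fun j => j.2.integrable) (fun j : J => weakRHS b g u₀ v j.1 t) h.nonneg
    (fun s c => by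
      rw [← h.weakRHS_sum s (fun j : J => j.2)]
      exact hbound _ (IsTest.sum s (fun j : J => j.2) c))
  exact ⟨m, hm, hmC, fun φ hφ => hmeq ⟨φ, hφ⟩⟩

end IsTransportPath

end WeakRHS

/-! ### Recovering a bounded function from its pairings with mollifiers. -/

section Mollifier

variable {d : ℕ}

/-- A standard sequence of bump functions shrinking to the origin. -/
def bump (d : ℕ) (n : ℕ) : ContDiffBump (0 : E d) where
  rIn := 1 / (2 * (n + 1))
  rOut := 1 / (n + 1)
  rIn_pos := by positivity
  rIn_lt_rOut := by
    have : (0 : ℝ) < n + 1 := by positivity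
    rw [div_lt_div_iff₀ (by positivity) this]
    linarith

/-- The mollifier centred at `x`. -/
def mollifier (n : ℕ) (x : E d) : E d → ℝ := fun y => (bump d n).normed volume (x - y)

theorem isTest_bump (n : ℕ) : IsTest ((bump d n).normed (volume : Measure (E d))) :=
  ⟨(bump d n).contDiff_normed, (bump d n).hasCompactSupport_normed⟩

theorem isTest_mollifier (n : ℕ) (x : E d) : IsTest (mollifier n x) :=
  (isTest_bump n).comp_sub_left x

theorem pd_mollifier (n : ℕ) (x : E d) (i : Fin d) (y : E d) :
    pd i (mollifier n x) y = -pd i ((bump d n).normed (volume : Measure (E d))) (x - y) := by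
  refine (pd_of_hasFDerivAt (f := mollifier n x)
    (((isTest_bump n).differentiable (x - y)).hasFDerivAt.comp y
      ((hasFDerivAt_id y).const_sub x)) i).trans ?_
  simp [pd]

/-- The pairing is a convolution with a bump. Lebesgue differentiation applies because the inner and
outer radii keep the fixed ratio 2 while shrinking. -/
theorem ae_tendsto_pairing_mollifier {m : E d → ℝ} {C : ℝ} (hm : Measurable m)
    (hmC : ∀ x, |m x| ≤ C) :
    ∀ᵐ x, Tendsto (fun n => pairing m (mollifier n x)) atTop (𝓝 (m x)) := by
  have hloc : LocallyIntegrable m volume := by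
    refine (locallyIntegrable_const C).mono hm.aestronglyMeasurable (ae_of_all _ fun x => ?_)
    exact (hmC x).trans (le_abs_self _)
  have hlim : Tendsto (fun n => (bump d n).rOut) atTop (𝓝 0) :=
    tendsto_one_div_add_atTop_nhds_zero_nat
  have h1 := ContDiffBump.ae_convolution_tendsto_right_of_locallyIntegrable (μ := volume)
    (φ := bump d) (l := atTop) (K := 2) hlim (Eventually.of_forall fun n => by
      change (1 : ℝ) / (n + 1) ≤ 2 * (1 / (2 * (n + 1)))
      have : (0 : ℝ) < n + 1 := by positivity
      apply le_of_eq
      field_simp) hloc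
  filter_upwards [h1] with x hx
  refine hx.congr fun n => ?_
  rw [convolution_eq_swap]
  unfold pairing mollifier
  refine integral_congr_ae (ae_of_all _ fun y => ?_)
  simp [mul_comm]

end Mollifier

/-! ### A jointly measurable version that solves the equation at every time. -/

section Regular

variable {Ω : Type*} [MeasurableSpace Ω] {d : ℕ} {P : Measure Ω} {T : ℝ} {K : Ω → ℝ} {M C : ℝ}
  {b : Ω → ℝ → E d → E d} {g : Ω → ℝ → E d → ℝ} {u₀ : Ω → E d → ℝ}

theorem IsTransportField.isTransportPath (h : IsTransportField P T K M b g)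
    (hu₀m : Measurable fun z : Ω × E d => u₀ z.1 z.2) (hu₀ : ∀ ω x, |u₀ ω x| ≤ C)
    {v : Ω → ℝ → E d → ℝ} (hvm : Measurable fun z : Ω × ℝ × E d => v z.1 z.2.1 z.2.2)
    (hv : ∀ ω t x, |v ω t x| ≤ C) (ω : Ω) :
    IsTransportPath (K ω) M C (b ω) (g ω) (u₀ ω) (v ω) where
  growth_nonneg := h.growth_nonneg ω
  bound_nonneg := h.bound_nonneg
  measurable_field := h.measurable_field_path ω
  measurable_div := h.measurable_div_path ω
  measurable_init := hu₀m.comp (measurable_const.prodMk measurable_id)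
  measurable_sol := hvm.comp (measurable_const.prodMk measurable_id)
  field_le := h.field_le ω
  div_le := h.div_le ω
  init_le := hu₀ ω
  sol_le := hv ω

theorem eq_ae_of_pairing_eq {v w : E d → ℝ} {C : ℝ} (hv : Measurable v) (hvC : ∀ x, |v x| ≤ C)
    (hw : Measurable w) (hwC : ∀ x, |w x| ≤ C)
    (h : ∀ φ, IsTest φ → pairing v φ = pairing w φ) : v =ᵐ[volume] w := by
  have hloc : ∀ {q : E d → ℝ}, Measurable q → (∀ x, |q x| ≤ C) → LocallyIntegrable q volume := by
    intro q hqm hq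
    refine (locallyIntegrable_const C).mono hqm.aestronglyMeasurable (ae_of_all _ fun x => ?_)
    exact (hq x).trans (le_abs_self _)
  refine ae_eq_of_integral_contDiff_smul_eq (hloc hv hvC) (hloc hw hwC) fun φ h1 h2 => ?_
  simpa [pairing, mul_comm] using h φ ⟨h1, h2⟩

/-- Existence of a bounded, jointly measurable weak solution that solves the transport equation at
every time. -/
theorem IsTransportField.exists_regular_solution [IsFiniteMeasure P]
    (h : IsTransportField P T K M b g)
    (hT : 0 < T) (hu₀m : Measurable fun z : Ω × E d => u₀ z.1 z.2)
    (hu₀ : ∀ ω x, |u₀ ω x| ≤ C) (hC : 0 ≤ C) :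
    ∃ w : Ω → ℝ → E d → ℝ, (Measurable fun z : Ω × ℝ × E d => w z.1 z.2.1 z.2.2) ∧
      (∀ ω t x, |w ω t x| ≤ C) ∧ ∀ᵐ ω ∂P, ∀ t ∈ Icc 0 T, ∀ φ : E d → ℝ, IsTest φ →
          pairing (w ω t) φ = weakRHS (b ω) (g ω) (u₀ ω) (w ω) φ t := by
  obtain ⟨v, hvm, hvC, hv⟩ := h.exists_weak_solution hT.le hu₀m hu₀ hC
  obtain ⟨D, hD, hdense⟩ := exists_dense_tests d
  have hpath := h.isTransportPath hu₀m hu₀ hvm hvC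
  -- At every `t` the right-hand side is the pairing with some bounded `m`, which depends on ω and
  -- `t` in no controlled way. Its mollified values, however, are jointly measurable, and so is
  -- their limsup.
  set f : ℕ → Ω × ℝ × E d → ℝ := fun n z =>
    weakRHS (b z.1) (g z.1) (u₀ z.1) (v z.1) (mollifier n z.2.2) z.2.1 with hf
  have hB : Measurable fun z : (Ω × ℝ × E d) × ℝ × E d => (z.1.1, z.2.1, z.2.2) := by fun_prop
  have hE : Measurable fun z : (Ω × ℝ × E d) × E d => (z.1.1, z.2) := by fun_prop
  have hF : Measurable fun z : (Ω × ℝ × E d) × E d => z.1.2.2 - z.2 := by fun_prop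
  have hfm : ∀ n, Measurable (f n) := fun n =>
    measurable_weakRHS (Y := Ω × ℝ × E d) (b := fun y => b y.1) (g := fun y => g y.1)
      (v := fun y => v y.1) (u₀ := fun y => u₀ y.1) (φ := fun y => mollifier n y.2.2)
      (t := fun y => y.2.1)
      (h.measurable_field.comp hB) (h.measurable_div.comp hB) (hvm.comp hB) (hu₀m.comp hE)
      ((isTest_bump n).continuous.measurable.comp hF)
      (fun i => by
        simp only [pd_mollifier]
        exact (((isTest_bump n).pd i).continuous.measurable.comp hF).neg) (by fun_prop)
  -- Clamping keeps the bound by `C` also at points where the mollified values do not converge.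
  set w : Ω → ℝ → E d → ℝ := fun ω t x =>
    max (-C) (min C (limsup (fun n => f n (ω, t, x)) atTop)) with hw
  have hwm : Measurable fun z : Ω × ℝ × E d => w z.1 z.2.1 z.2.2 :=
    measurable_const.max (measurable_const.min (Measurable.limsup hfm))
  have hwC : ∀ ω t x, |w ω t x| ≤ C := fun ω t x =>
    abs_le.2 ⟨le_max_left _ _, max_le (by linarith) (min_le_left _ _)⟩
  refine ⟨w, hwm, hwC, ?_⟩
  filter_upwards [ae_all_iff.2 fun n => hv (D n) (hD n)] with ω hω
  have hvt : ∀ᵐ t ∂(volume.restrict (Icc (0 : ℝ) T)), ∀ φ, IsTest φ →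
      pairing (v ω t) φ = weakRHS (b ω) (g ω) (u₀ ω) (v ω) φ t := by
    filter_upwards [ae_all_iff.2 hω, ae_restrict_mem measurableSet_Icc] with t h1 h2 φ hφ
    exact (hpath ω).pairing_eq_weakRHS_of_dense hD hdense h2 h1 hφ
  have hwt : ∀ t ∈ Icc 0 T, ∀ φ, IsTest φ →
      pairing (w ω t) φ = weakRHS (b ω) (g ω) (u₀ ω) (v ω) φ t := by
    intro t ht φ hφ
    obtain ⟨m, hm, hmC, hmeq⟩ := (hpath ω).exists_representative hT hvt ht
    rw [← hmeq φ hφ]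
    refine integral_congr_ae ?_
    filter_upwards [ae_tendsto_pairing_mollifier hm hmC] with x hx
    have h1 : Tendsto (fun n => f n (ω, t, x)) atTop (𝓝 (m x)) :=
      hx.congr fun n => hmeq _ (isTest_mollifier n x)
    have h2 : w ω t x = m x := by
      simp only [hw]
      rw [h1.limsup_eq, min_eq_right (abs_le.1 (hmC x)).2, max_eq_right (abs_le.1 (hmC x)).1]
    simp only [h2]
  -- This allows `v` to be replaced by `w` inside the time integral, which closes the equation for
  -- `w`.
  have hvw : ∀ᵐ t ∂(volume.restrict (Icc (0 : ℝ) T)), v ω t =ᵐ[volume] w ω t := by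
    filter_upwards [hvt, ae_restrict_mem measurableSet_Icc] with t h1 h2
    exact eq_ae_of_pairing_eq ((hpath ω).measurable_sol_slice t) (hvC ω t)
      ((h.isTransportPath hu₀m hu₀ hwm hwC ω).measurable_sol_slice t) (hwC ω t)
      fun φ hφ => by rw [h1 φ hφ, hwt t h2 φ hφ]
  intro t ht φ hφ
  rw [hwt t ht φ hφ]
  unfold weakRHS
  congr 1
  rw [intervalIntegral.integral_of_le ht.1, intervalIntegral.integral_of_le ht.1]
  refine integral_congr_ae ?_
  have hsub : Ioc 0 t ⊆ Icc 0 T := fun s hs => ⟨hs.1.le, hs.2.trans ht.2⟩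
  filter_upwards [ae_restrict_of_ae_restrict_of_subset hsub hvw] with s hs
  refine integral_congr_ae ?_
  filter_upwards [hs] with x hx
  rw [hx]

end Regular

/-! ### Taylor expansion of test functions under a shift. -/

section Taylor

variable {d : ℕ} {φ : E d → ℝ}

theorem IsTest.hasDerivAt_comp_line (h : IsTest φ) (x k : E d) (s : ℝ) :
    HasDerivAt (fun s : ℝ => φ (x + s • k)) (∑ i, k i * RTE.pd i φ (x + s • k)) s := by
  rw [← fderiv_apply_eq_sum]
  have h1 : HasDerivAt (fun s : ℝ => x + s • k) k s := by
    simpa using ((hasDerivAt_id s).smul_const k).const_add x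
  exact (h.differentiable _).hasFDerivAt.comp_hasDerivAt s h1

theorem abs_sub_le_of_hasDerivAt {G G' : ℝ → ℝ} {B : ℝ} (hG : ∀ s, HasDerivAt G (G' s) s)
    (hB : ∀ s ∈ Ico (0 : ℝ) 1, |G' s| ≤ B) : |G 1 - G 0| ≤ B :=
  norm_image_sub_le_of_norm_deriv_le_segment_01' (fun s _ => (hG s).hasDerivWithinAt) hB

theorem abs_sum_mul_le {k : E d} {c : Fin d → ℝ} {B : Fin d → ℝ} {r : ℝ}
    (hc : ∀ i, |c i| ≤ B i * r) : |∑ i, k i * c i| ≤ (∑ i, B i) * (r * ‖k‖) := by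
  refine (Finset.abs_sum_le_sum_abs _ _).trans ?_
  rw [Finset.sum_mul]
  refine Finset.sum_le_sum fun i _ => ?_
  rw [abs_mul]
  calc |k i| * |c i| ≤ ‖k‖ * (B i * r) :=
        mul_le_mul (PiLp.norm_apply_le k i) (hc i) (abs_nonneg _) (norm_nonneg _)
    _ = B i * (r * ‖k‖) := by ring

/-- Taylor's formula of order zero. -/
theorem IsTest.exists_taylor_zero (h : IsTest φ) :
    ∃ L, 0 ≤ L ∧ ∀ x k : E d, |φ (x + k) - φ x| ≤ L * ‖k‖ := by
  choose B hB0 hB using fun i => (h.pd i).exists_bound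
  refine ⟨∑ i, B i, Finset.sum_nonneg fun i _ => hB0 i, fun x k => ?_⟩
  have := abs_sub_le_of_hasDerivAt (h.hasDerivAt_comp_line x k)
    (B := (∑ i, B i) * (1 * ‖k‖)) fun s _ => abs_sum_mul_le fun i => by
      rw [mul_one]; exact hB i _
  simpa using this

/-- Taylor's formula of order one. -/
theorem IsTest.exists_taylor_one (h : IsTest φ) :
    ∃ L, 0 ≤ L ∧ ∀ x k : E d, |φ (x + k) - φ x - ∑ i, k i * RTE.pd i φ x| ≤ L * ‖k‖ ^ 2 := by
  choose B hB0 hB using fun i => (h.pd i).exists_taylor_zero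
  refine ⟨∑ i, B i, Finset.sum_nonneg fun i _ => hB0 i, fun x k => ?_⟩
  -- The derivative along the segment is an order-zero remainder of the partial derivatives, so each
  -- Taylor order follows from the previous one applied to `pd i φ`.
  have hG : ∀ s : ℝ, HasDerivAt (fun s : ℝ => φ (x + s • k) - s * ∑ i, k i * RTE.pd i φ x)
      (∑ i, k i * (RTE.pd i φ (x + s • k) - RTE.pd i φ x)) s := by
    intro s
    have := (h.hasDerivAt_comp_line x k s).sub
      ((hasDerivAt_id s).mul_const (∑ i, k i * RTE.pd i φ x))
    refine this.congr_deriv ?_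
    simp [mul_sub, Finset.sum_sub_distrib]
  have := abs_sub_le_of_hasDerivAt hG (B := (∑ i, B i) * (‖k‖ * ‖k‖)) fun s hs =>
    abs_sum_mul_le fun i => (hB i x (s • k)).trans (by
      refine mul_le_mul_of_nonneg_left ?_ (hB0 i)
      rw [norm_smul, Real.norm_of_nonneg hs.1]
      exact mul_le_of_le_one_left (norm_nonneg _) hs.2.le)
  simp only [one_smul, one_mul, zero_smul, add_zero, zero_mul, sub_zero] at this
  rw [sq, sub_right_comm]
  exact this

/-- Taylor's formula of order two. -/
theorem IsTest.exists_taylor_two (h : IsTest φ) :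
    ∃ L, 0 ≤ L ∧ ∀ x k : E d, |φ (x + k) - φ x - ∑ i, k i * RTE.pd i φ x
      - (1 / 2) * ∑ i, k i * ∑ j, k j * RTE.pd j (RTE.pd i φ) x| ≤ L * ‖k‖ ^ 3 := by
  choose B hB0 hB using fun i => (h.pd i).exists_taylor_one
  refine ⟨∑ i, B i, Finset.sum_nonneg fun i _ => hB0 i, fun x k => ?_⟩
  have hG : ∀ s : ℝ, HasDerivAt (fun s : ℝ => φ (x + s • k) - s * ∑ i, k i * RTE.pd i φ x
        - (s ^ 2 / 2) * ∑ i, k i * ∑ j, k j * RTE.pd j (RTE.pd i φ) x)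
      (∑ i, k i * (RTE.pd i φ (x + s • k) - RTE.pd i φ x
        - ∑ j, (s • k) j * RTE.pd j (RTE.pd i φ) x)) s := by
    intro s
    have h1 : HasDerivAt (fun s : ℝ => s ^ 2 / 2) s s := by
      simpa using (hasDerivAt_pow 2 s).div_const 2
    have := ((h.hasDerivAt_comp_line x k s).sub
      ((hasDerivAt_id s).mul_const (∑ i, k i * RTE.pd i φ x))).sub
      (h1.mul_const (∑ i, k i * ∑ j, k j * RTE.pd j (RTE.pd i φ) x))
    refine this.congr_deriv ?_
    have h2 : ∀ i, ∑ j, (s • k) j * RTE.pd j (RTE.pd i φ) x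
        = s * ∑ j, k j * RTE.pd j (RTE.pd i φ) x := by
      intro i
      rw [Finset.mul_sum]
      exact Finset.sum_congr rfl fun j _ => by simp [mul_assoc]
    simp only [h2, mul_sub, Finset.sum_sub_distrib, one_mul]
    rw [Finset.mul_sum (f := fun i => k i * ∑ j, k j * RTE.pd j (RTE.pd i φ) x)]
    congr 1
    exact Finset.sum_congr rfl fun i _ => by ring
  have := abs_sub_le_of_hasDerivAt hG (B := (∑ i, B i) * (‖k‖ ^ 2 * ‖k‖)) fun s hs =>
    abs_sum_mul_le fun i => (hB i x (s • k)).trans (by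
      refine mul_le_mul_of_nonneg_left ?_ (hB0 i)
      rw [norm_smul, Real.norm_of_nonneg hs.1]
      exact pow_le_pow_left₀ (mul_nonneg hs.1 (norm_nonneg _))
        (mul_le_of_le_one_left (norm_nonneg _) hs.2.le) 2)
  have e : φ (x + k) - φ x - ∑ i, k i * RTE.pd i φ x
      - (1 / 2) * ∑ i, k i * ∑ j, k j * RTE.pd j (RTE.pd i φ) x
      = (φ (x + (1 : ℝ) • k) - 1 * ∑ i, k i * RTE.pd i φ x
        - ((1 : ℝ) ^ 2 / 2) * ∑ i, k i * ∑ j, k j * RTE.pd j (RTE.pd i φ) x)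
        - (φ (x + (0 : ℝ) • k) - 0 * ∑ i, k i * RTE.pd i φ x
        - ((0 : ℝ) ^ 2 / 2) * ∑ i, k i * ∑ j, k j * RTE.pd j (RTE.pd i φ) x) := by
    simp only [one_smul, zero_smul, add_zero]
    ring
  rw [e]
  refine this.trans (le_of_eq ?_)
  ring

/-- Symmetry of the Hessian makes the antisymmetric part of $\mathbb X$ invisible in the compensated
sums. -/
theorem IsTest.pd_comm (h : IsTest φ) (i j : Fin d) (x : E d) :
    RTE.pd i (RTE.pd j φ) x = RTE.pd j (RTE.pd i φ) x := by
  have hd : DifferentiableAt ℝ (fderiv ℝ φ) x :=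
    (h.1.fderiv_right (m := (⊤ : ℕ∞)) (by simp)).differentiable (by simp) x
  have key : ∀ i j : Fin d, RTE.pd i (RTE.pd j φ) x
      = fderiv ℝ (fderiv ℝ φ) x (EuclideanSpace.single i 1) (EuclideanSpace.single j 1) := by
    intro i j
    refine (pd_of_hasFDerivAt (f := RTE.pd j φ) (hd.hasFDerivAt.clm_apply
      (hasFDerivAt_const (EuclideanSpace.single j (1 : ℝ)) x)) i).trans ?_
    simp
  rw [key, key]
  have hs : IsSymmSndFDerivAt ℝ φ x :=
    (h.1.contDiffAt).isSymmSndFDerivAt (by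
      rw [minSmoothness_of_isRCLikeNormedField]
      exact WithTop.coe_le_coe.2 (le_top : (2 : ℕ∞) ≤ ⊤))
  exact hs _ _

theorem pd_eq_zero_of_norm_lt {R : ℝ} (h : ∀ x, R < ‖x‖ → φ x = 0) (i : Fin d) (x : E d)
    (hx : R < ‖x‖) : pd i φ x = 0 := by
  have h1 : φ =ᶠ[𝓝 x] fun _ => 0 := by
    filter_upwards [(isOpen_lt continuous_const continuous_norm).mem_nhds hx] with y hy using h y hy
  rw [pd, h1.fderiv_eq]
  simp

end Taylor

/-! ### Conversion between Hölder norms and pointwise bounds. -/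

section HolderNorms

variable {F : Type*} [NormedAddCommGroup F] {T α : ℝ}

theorem twoParamNorm_lt_top {g : ℝ → ℝ → F} {A : ℝ}
    (h : ∀ s ∈ Icc (0 : ℝ) T, ∀ t ∈ Icc (0 : ℝ) T, ‖g s t‖ ≤ A * |t - s| ^ α) :
    twoParamNorm T α g < ⊤ := by
  refine lt_of_le_of_lt (b := ENNReal.ofReal A) ?_ ENNReal.ofReal_lt_top
  unfold twoParamNorm
  refine iSup₂_le fun s hs => iSup₂_le fun t ht => iSup_le fun hst => ?_
  have h0 : 0 < |t - s| ^ α := Real.rpow_pos_of_pos (abs_pos.2 (sub_ne_zero.2 hst.symm)) _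
  refine ENNReal.div_le_of_le_mul ?_
  rw [← ENNReal.ofReal_mul' h0.le, ← ofReal_norm]
  exact ENNReal.ofReal_le_ofReal (h s hs t ht)

theorem enorm_le_twoParamNorm (g : ℝ → ℝ → F) {s t : ℝ} (hs : s ∈ Icc (0 : ℝ) T)
    (ht : t ∈ Icc (0 : ℝ) T) (hst : s ≠ t) :
    ‖g s t‖ₑ ≤ twoParamNorm T α g * ENNReal.ofReal (|t - s| ^ α) := by
  have h0 : 0 < |t - s| ^ α := Real.rpow_pos_of_pos (abs_pos.2 (sub_ne_zero.2 hst.symm)) _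
  have h1 : ‖g s t‖ₑ / ENNReal.ofReal (|t - s| ^ α) ≤ twoParamNorm T α g := by
    unfold twoParamNorm
    exact le_iSup₂_of_le s hs (le_iSup₂_of_le t ht (le_iSup_of_le hst le_rfl))
  rwa [ENNReal.div_le_iff (by simpa using h0) ENNReal.ofReal_ne_top] at h1

theorem exists_bound_of_holderSeminorm_lt_top {f : ℝ → F} (h : holderSeminorm T α f < ⊤) :
    ∃ A, 0 ≤ A ∧ ∀ s ∈ Icc (0 : ℝ) T, ∀ t ∈ Icc (0 : ℝ) T, ‖f t - f s‖ ≤ A * |t - s| ^ α := by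
  refine ⟨(holderSeminorm T α f).toReal, ENNReal.toReal_nonneg, fun s hs t ht => ?_⟩
  rcases eq_or_ne s t with rfl | hst
  · simp only [sub_self, norm_zero]
    positivity
  have h1 := enorm_le_twoParamNorm (α := α) (fun s t => f t - f s) hs ht hst
  have h0 : 0 ≤ |t - s| ^ α := by positivity
  have h2 := ENNReal.toReal_mono (ENNReal.mul_ne_top h.ne ENNReal.ofReal_ne_top) h1
  rw [ENNReal.toReal_mul, ENNReal.toReal_ofReal h0, toReal_enorm] at h2
  exact h2

theorem continuousOn_of_holder {f : ℝ → F} {A : ℝ} (hα : 0 < α)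
    (h : ∀ s ∈ Icc (0 : ℝ) T, ∀ t ∈ Icc (0 : ℝ) T, ‖f t - f s‖ ≤ A * |t - s| ^ α) :
    ContinuousOn f (Icc 0 T) := by
  intro s hs
  rw [ContinuousWithinAt, tendsto_iff_norm_sub_tendsto_zero]
  have h1 : Tendsto (fun t => A * |t - s| ^ α) (𝓝[Icc 0 T] s) (𝓝 0) := by
    have h2 : ContinuousAt (fun t => A * |t - s| ^ α) s :=
      ((continuous_abs.continuousAt.comp (by fun_prop : ContinuousAt (fun t => t - s) s)).rpow_const
        (Or.inr hα.le)).const_mul A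
    have h3 := h2.tendsto
    simp only [sub_self, abs_zero, Real.zero_rpow hα.ne', mul_zero] at h3
    exact h3.mono_left nhdsWithin_le_nhds
  refine squeeze_zero' (Eventually.of_forall fun _ => norm_nonneg _) ?_ h1
  filter_upwards [self_mem_nhdsWithin] with t ht using h s hs t ht

theorem memC1_of_holder {f : ℝ → F} {A : ℝ} (hα : 0 < α)
    (h : ∀ s ∈ Icc (0 : ℝ) T, ∀ t ∈ Icc (0 : ℝ) T, ‖f t - f s‖ ≤ A * |t - s| ^ α) :
    MemC1 T α f :=
  ⟨continuousOn_of_holder hα h, twoParamNorm_lt_top h⟩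

theorem rpow_le_mul_rpow {x p q : ℝ} (hx : 0 ≤ x) (hxT : x ≤ T) (hq : 0 < q) (hpq : p ≤ q) :
    x ^ q ≤ T ^ (q - p) * x ^ p := by
  have h1 : q - p + p ≠ 0 := by rw [sub_add_cancel]; exact hq.ne'
  have h2 := Real.rpow_add' hx h1
  rw [sub_add_cancel] at h2
  rw [h2]
  exact mul_le_mul_of_nonneg_right (Real.rpow_le_rpow hx hxT (by linarith))
    (Real.rpow_nonneg hx _)

end HolderNorms

/-! ### The symmetric part of a geometric rough path. -/

section Geometric

variable {d : ℕ} {T γ : ℝ}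

/-- The product rule for $(Y^i-Y^i_s)(Y^j-Y^j_s)$, which vanishes at $s$. -/
theorem naturalLift_add_swap {Y : ℝ → E d} (hY : ContDiffOn ℝ 1 Y (Icc 0 T)) {s t : ℝ}
    (hs : 0 ≤ s) (hst : s ≤ t) (ht : t ≤ T) (i j : Fin d) :
    naturalLift T Y s t i j + naturalLift T Y s t j i = (Y t i - Y s i) * (Y t j - Y s j) := by
  rcases hst.eq_or_lt with rfl | hlt
  · simp [naturalLift]
  have hT : (0 : ℝ) < T := lt_of_le_of_lt hs (hlt.trans_le ht)
  have hsub : uIcc s t ⊆ Icc 0 T := by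
    rw [uIcc_of_le hst]
    exact Icc_subset_Icc hs ht
  have hc : ∀ i, ContDiffOn ℝ 1 (fun q => Y q i) (Icc 0 T) := fun i =>
    contDiffOn_euclidean.1 hY i
  have hcont : ∀ i, ContinuousOn (fun q => Y q i - Y s i) (uIcc s t) := fun i =>
    ((hc i).continuousOn.mono hsub).sub continuousOn_const
  have hdc : ∀ i, ContinuousOn (derivWithin (fun q => Y q i) (Icc 0 T)) (uIcc s t) := fun i =>
    ((hc i).continuousOn_derivWithin (uniqueDiffOn_Icc hT) le_rfl).mono hsub
  have hder : ∀ i, ∀ x ∈ Ioo (min s t) (max s t), HasDerivWithinAt (fun q => Y q i - Y s i)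
      (derivWithin (fun q => Y q i) (Icc 0 T) x) (Ioi x) x := by
    intro i x hx
    rw [min_eq_left hst, max_eq_right hst] at hx
    have hx' : x ∈ Icc 0 T := ⟨hs.trans hx.1.le, hx.2.le.trans ht⟩
    have hn : Icc 0 T ∈ 𝓝 x := Icc_mem_nhds (lt_of_le_of_lt hs hx.1) (hx.2.trans_le ht)
    have h1 := (((hc i).differentiableOn one_ne_zero) x hx').hasDerivWithinAt
    exact ((h1.hasDerivAt hn).sub_const _).hasDerivWithinAt
  have h1 := intervalIntegral.integral_deriv_mul_eq_sub_of_hasDeriv_right (hcont i) (hcont j)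
    (hder i) (hder j) (hdc i).intervalIntegrable (hdc j).intervalIntegrable
  simp only [sub_self, mul_zero, sub_zero] at h1
  rw [← h1]
  unfold naturalLift
  rw [← intervalIntegral.integral_add]
  · refine intervalIntegral.integral_congr fun r _ => ?_
    simp only
    ring
  · exact ((hcont i).mul (hdc j)).intervalIntegrable
  · exact ((hcont j).mul (hdc i)).intervalIntegrable

/-- The symmetric part of a geometric rough path is determined by its first level. -/
theorem IsGeometricRoughPath.add_swap {X : ℝ → E d} {XX : ℝ → ℝ → Fin d → Fin d → ℝ}
    (h : IsGeometricRoughPath T γ X XX) {s t : ℝ} (hs : 0 ≤ s) (hst : s ≤ t) (ht : t ≤ T)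
    (i j : Fin d) : XX s t i j + XX s t j i = (X t i - X s i) * (X t j - X s j) := by
  have hs' : s ∈ Icc 0 T := ⟨hs, hst.trans ht⟩
  have ht' : t ∈ Icc 0 T := ⟨hs.trans hst, ht⟩
  rcases hst.eq_or_lt with rfl | hlt
  · rw [h.isRoughPath.area.diag s hs']
    simp
  obtain ⟨Y, hY, hlim⟩ := h.approx
  have hzero : ∀ c : ℝ≥0∞, c ≠ ⊤ →
      Tendsto (fun n => roughDist T γ X XX (Y n) (naturalLift T (Y n)) * c) atTop (𝓝 0) := by
    intro c hc
    simpa using ENNReal.Tendsto.mul_const hlim (Or.inr hc)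
  -- At a fixed pair of times the rough distance dominates the difference of increments at either
  -- level up to a finite factor, so the identity for natural lifts passes to the limit.
  have hconv : ∀ {F : Type} [NormedAddCommGroup F] (a : F) (c : ℕ → F) (p : ℝ),
      (∀ n, ‖a - c n‖ₑ ≤ roughDist T γ X XX (Y n) (naturalLift T (Y n)) *
        ENNReal.ofReal p) → Tendsto c atTop (𝓝 a) := by
    intro F _ a c p hle
    rw [tendsto_iff_edist_tendsto_0]
    refine tendsto_of_tendsto_of_tendsto_of_le_of_le tendsto_const_nhds
      (hzero (ENNReal.ofReal p) ENNReal.ofReal_ne_top) (fun _ => zero_le) fun n => ?_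
    rw [edist_comm, edist_eq_enorm_sub]
    exact hle n
  have hXX : Tendsto (fun n => naturalLift T (Y n) s t) atTop (𝓝 (XX s t)) := by
    refine hconv _ _ (|t - s| ^ (2 * γ)) fun n => ?_
    refine (enorm_le_twoParamNorm (α := 2 * γ)
      (fun s t => XX s t - naturalLift T (Y n) s t) hs' ht' hlt.ne).trans ?_
    exact mul_le_mul_left (le_add_self) _
  have hX : Tendsto (fun n => Y n t - Y n s) atTop (𝓝 (X t - X s)) := by
    refine hconv _ _ (|t - s| ^ γ) fun n => ?_
    have h1 := enorm_le_twoParamNorm (α := γ)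
      (fun s t => (X t - Y n t) - (X s - Y n s)) hs' ht' hlt.ne
    have h2 : X t - X s - (Y n t - Y n s) = X t - Y n t - (X s - Y n s) := by abel
    rw [h2]
    refine h1.trans (mul_le_mul_left ?_ _)
    exact le_add_self.trans le_self_add
  have hXXij : ∀ i j, Tendsto (fun n => naturalLift T (Y n) s t i j) atTop (𝓝 (XX s t i j)) :=
    fun i j => (tendsto_pi_nhds.1 ((tendsto_pi_nhds.1 hXX) i)) j
  have hXi : ∀ i, Tendsto (fun n => Y n t i - Y n s i) atTop (𝓝 (X t i - X s i)) := fun i =>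
    (((EuclideanSpace.proj i : E d →L[ℝ] ℝ).continuous.tendsto _).comp hX)
  refine tendsto_nhds_unique ((hXXij i j).add (hXXij j i)) ?_
  simp only [naturalLift_add_swap (hY _) hs hst ht]
  exact (hXi i).mul (hXi j)

end Geometric

/-! ### Translated test functions. -/

section Translation

variable {d : ℕ} {φ : E d → ℝ} {C : ℝ}

/-- The translate `x ↦ φ (x + a)`. -/
def translate (a : E d) (φ : E d → ℝ) : E d → ℝ := fun x => φ (x + a)

theorem IsTest.translate (h : IsTest φ) (a : E d) : IsTest (translate a φ) := h.comp_add a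

/-- A shift of size at most `A` changes the weight `1 + |x|` by a factor at most `1 + A`, which
makes the drift bounds uniform along a bounded path. -/
theorem testWeight_translate_le {a : E d} {A : ℝ} (ha : ‖a‖ ≤ A) (x : E d) :
    testWeight (translate a φ) x ≤ (1 + A) * testWeight φ (x + a) := by
  unfold testWeight
  have h1 : ∀ i, pd i (translate a φ) x = pd i φ (x + a) := fun i => pd_comp_add φ a i x
  simp only [h1, translate]
  rw [← mul_assoc]
  refine mul_le_mul_of_nonneg_right ?_ (by positivity)
  have h2 : ‖x‖ ≤ ‖x + a‖ + ‖a‖ := by simpa using norm_sub_le (x + a) a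
  have hA : 0 ≤ A := (norm_nonneg a).trans ha
  nlinarith [norm_nonneg (x + a)]

theorem IsTest.integral_testWeight_translate_le (h : IsTest φ) {a : E d} {A : ℝ} (ha : ‖a‖ ≤ A) :
    ∫ x, testWeight (RTE.translate a φ) x ≤ (1 + A) * ∫ x, testWeight φ x := by
  rw [← integral_add_right_eq_self (testWeight φ) a, ← integral_const_mul]
  exact integral_mono (h.translate a).integrable_testWeight
    ((h.integrable_testWeight.comp_add_right a).const_mul _) fun x => testWeight_translate_le ha x

theorem integral_le_of_bound_ball {e : E d → ℝ} {c R : ℝ} (he : Integrable e)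
    (hc : ∀ x, e x ≤ c) (hR : ∀ x, R < ‖x‖ → e x = 0) :
    ∫ x, e x ≤ c * volume.real (Metric.closedBall (0 : E d) R) := by
  have h1 : ∫ x in Metric.closedBall (0 : E d) R, e x = ∫ x, e x :=
    setIntegral_eq_integral_of_forall_compl_eq_zero fun x hx => hR x (by simpa using hx)
  rw [← h1]
  refine (setIntegral_mono he.integrableOn
    (integrableOn_const measure_closedBall_lt_top.ne) hc).trans (le_of_eq ?_)
  simp [mul_comm]

theorem abs_pairing_le_of_bound_ball {v e : E d → ℝ} {c R : ℝ} (hvC : ∀ x, |v x| ≤ C)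
    (he : Integrable e) (hc : ∀ x, |e x| ≤ c) (hR : ∀ x, R < ‖x‖ → e x = 0) :
    |pairing v e| ≤ C * (c * volume.real (Metric.closedBall (0 : E d) R)) := by
  have hC : 0 ≤ C := (abs_nonneg _).trans (hvC 0)
  exact (abs_pairing_le hvC he).trans (mul_le_mul_of_nonneg_left
    (integral_le_of_bound_ball he.abs hc fun x hx => by rw [hR x hx, abs_zero]) hC)

theorem abs_sub_le_of_mem_Icc {T s t : ℝ} (hs : s ∈ Icc 0 T) (ht : t ∈ Icc 0 T) : |t - s| ≤ T :=
  abs_le.2 ⟨by linarith [hs.2, ht.1], by linarith [hs.1, ht.2]⟩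

theorem translate_eq (X : ℝ → E d) (s t : ℝ) (x : E d) :
    translate (X t) φ x = φ (x + X s + (X t - X s)) := by
  unfold translate
  congr 1
  abel

theorem abs_le_rpow {T s t p : ℝ} (hs : s ∈ Icc 0 T) (ht : t ∈ Icc 0 T) (hp : p ≤ 1) :
    |t - s| ≤ T ^ (1 - p) * |t - s| ^ p := by
  simpa using rpow_le_mul_rpow (abs_nonneg (t - s)) (abs_sub_le_of_mem_Icc hs ht) one_pos hp

end Translation

/-! ### Increments of w_t(φ(· + X_t)) along a Hölder path X. -/

/-- `w` solves the transport equation along the fields `b`, `g`, and `X` is a Hölder path. -/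
structure IsShiftedSolution {d : ℕ} (T γ H A K M C : ℝ) (X : ℝ → E d) (b : ℝ → E d → E d)
    (g : ℝ → E d → ℝ) (u₀ : E d → ℝ) (w : ℝ → E d → ℝ) : Prop where
  toPath : IsTransportPath K M C b g u₀ w
  time_nonneg : 0 ≤ T
  exponent_pos : 0 < γ
  exponent_le : γ ≤ 1 / 2
  holder_nonneg : 0 ≤ H
  continuous : Continuous X
  holder : ∀ s ∈ Icc (0 : ℝ) T, ∀ t ∈ Icc (0 : ℝ) T, ‖X t - X s‖ ≤ H * |t - s| ^ γ
  bound : ∀ t ∈ Icc (0 : ℝ) T, ‖X t‖ ≤ A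
  equation : ∀ t ∈ Icc (0 : ℝ) T, ∀ φ : E d → ℝ, IsTest φ →
    pairing (w t) φ = weakRHS b g u₀ w φ t

namespace IsShiftedSolution

variable {d : ℕ} {T γ H A K M C : ℝ} {X : ℝ → E d} {b : ℝ → E d → E d}
    {g : ℝ → E d → ℝ} {u₀ : E d → ℝ} {w : ℝ → E d → ℝ} {φ : E d → ℝ}
    (h : IsShiftedSolution T γ H A K M C X b g u₀ w)
include h

theorem pairing_sub_eq (hφ : IsTest φ) {s t : ℝ} (hs : s ∈ Icc 0 T) (ht : t ∈ Icc 0 T) :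
    pairing (w t) φ - pairing (w s) φ
      = ∫ r in s..t, pairing (w r) (drift (b r) (g r) φ) := by
  rw [h.equation t ht φ hφ, h.equation s hs φ hφ]
  unfold weakRHS
  rw [add_sub_add_left_eq_sub]
  exact intervalIntegral.integral_interval_sub_left (h.toPath.intervalIntegrable hφ _ _)
    (h.toPath.intervalIntegrable hφ _ _)

/-- With the shift frozen only the drift acts, and the weak equation bounds its rate uniformly over
the frozen shifts. -/
theorem exists_time_bound (hφ : IsTest φ) : ∃ L, 0 ≤ L ∧ ∀ s ∈ Icc 0 T, ∀ t ∈ Icc 0 T,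
    |pairing (w t) (translate (X t) φ) - pairing (w s) (translate (X t) φ)| ≤ L * |t - s| := by
  have hK := h.toPath.growth_nonneg
  have hM := h.toPath.bound_nonneg
  have hC := h.toPath.nonneg
  have hW : 0 ≤ ∫ x, testWeight φ x := integral_nonneg fun x => testWeight_nonneg φ x
  have hA : 0 ≤ A := (norm_nonneg _).trans (h.bound 0 ⟨le_rfl, h.time_nonneg⟩)
  refine ⟨C * ((K + M) * ((1 + A) * ∫ x, testWeight φ x)), by positivity, fun s hs t ht => ?_⟩
  rw [h.pairing_sub_eq (hφ.translate _) hs ht]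
  refine intervalIntegral.norm_integral_le_of_norm_le_const
    (f := fun r => pairing (w r) (drift (b r) (g r) (translate (X t) φ))) fun r _ => ?_
  refine (h.toPath.abs_pairing_drift_le (hφ.translate _) r).trans ?_
  gcongr
  exact hφ.integral_testWeight_translate_le (h.bound t ht)

theorem translate_eq_zero {R : ℝ} (hR : ∀ x, R < ‖x‖ → φ x = 0) {t : ℝ} (ht : t ∈ Icc 0 T)
    (x : E d) (hx : R + A < ‖x‖) : translate (X t) φ x = 0 := by
  refine hR _ ?_
  have h1 := h.bound t ht
  have h2 : ‖x‖ ≤ ‖x + X t‖ + ‖X t‖ := by simpa using norm_sub_le (x + X t) (X t)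
  linarith

/-- The drift is linear in the test function, and the two translates differ by $O(|X_t-X_r|)$
together with their first derivatives. Both live in the ball of radius `R + A`, where the weight is
at most `1 + R + A`. -/
theorem exists_drift_bound (hφ : IsTest φ) : ∃ L, 0 ≤ L ∧ ∀ r ∈ Icc 0 T, ∀ t ∈ Icc 0 T,
    |pairing (w r) (drift (b r) (g r) (translate (X t) φ))
      - pairing (w r) (drift (b r) (g r) (translate (X r) φ))| ≤ L * |t - r| ^ γ := by
  have hK := h.toPath.growth_nonneg
  have hM := h.toPath.bound_nonneg
  have hC := h.toPath.nonneg
  have hH := h.holder_nonneg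
  have hA : 0 ≤ A := (norm_nonneg _).trans (h.bound 0 ⟨le_rfl, h.time_nonneg⟩)
  obtain ⟨R, hR0, hR⟩ := hφ.exists_radius
  obtain ⟨L, hL0, hL⟩ := hφ.exists_taylor_zero
  choose B hB0 hB using fun i => (hφ.pd i).exists_taylor_zero
  have hBs : 0 ≤ ∑ i, B i := Finset.sum_nonneg fun i _ => hB0 i
  set V := volume.real (Metric.closedBall (0 : E d) (R + A)) with hV
  refine ⟨C * ((K + M) * (((1 + (R + A)) * ((∑ i, B i + L) * H)) * V)), by positivity,
    fun r hr t ht => ?_⟩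
  have h1 := hφ.translate (X t)
  have h2 := hφ.translate (X r)
  rw [← pairing_sub (h.toPath.measurable_sol_slice r) (h.toPath.sol_le r)
    (h.toPath.integrable_drift h1 r) (h.toPath.integrable_drift h2 r)]
  have h3 : (fun x => drift (b r) (g r) (translate (X t) φ) x
      - drift (b r) (g r) (translate (X r) φ) x)
      = drift (b r) (g r) (fun x => translate (X t) φ x - translate (X r) φ x) := by
    funext x
    exact (drift_sub _ _ h1 h2 x).symm
  rw [h3]
  refine (h.toPath.abs_pairing_drift_le (h1.sub h2) r).trans ?_
  rw [mul_assoc C, mul_assoc (K + M)]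
  refine mul_le_mul_of_nonneg_left (mul_le_mul_of_nonneg_left ?_ (by positivity)) hC
  have hk := h.holder r hr t ht
  set k := X t - X r with hk_def
  have hpd : ∀ i x, pd i (fun x => translate (X t) φ x - translate (X r) φ x) x
      = translate (X t) (pd i φ) x - translate (X r) (pd i φ) x := by
    intro i x
    rw [pd_sub h1 h2]
    unfold translate
    rw [pd_comp_add, pd_comp_add]
  have hzero : ∀ x, R + A < ‖x‖ →
      testWeight (fun x => translate (X t) φ x - translate (X r) φ x) x = 0 := by
    intro x hx
    unfold testWeight
    simp only [hpd, h.translate_eq_zero hR ht x hx, h.translate_eq_zero hR hr x hx,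
      h.translate_eq_zero (pd_eq_zero_of_norm_lt hR _) ht x hx,
      h.translate_eq_zero (pd_eq_zero_of_norm_lt hR _) hr x hx]
    simp
  refine (integral_le_of_bound_ball (c := (1 + (R + A)) * ((∑ i, B i + L) * H) * |t - r| ^ γ)
    (h1.sub h2).integrable_testWeight ?_ hzero).trans (le_of_eq (by ring))
  intro x
  have hpos : 0 ≤ (1 + (R + A)) * ((∑ i, B i + L) * H) * |t - r| ^ γ := by positivity
  rcases lt_or_ge (R + A) ‖x‖ with hx | hx
  · rw [hzero x hx]; exact hpos
  unfold testWeight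
  simp only [hpd]
  rw [mul_assoc]
  refine mul_le_mul (by linarith) ?_ (by positivity) (by positivity)
  have e1 : ∑ i, |translate (X t) (pd i φ) x - translate (X r) (pd i φ) x|
      ≤ (∑ i, B i) * ‖k‖ := by
    rw [Finset.sum_mul]
    refine Finset.sum_le_sum fun i _ => ?_
    rw [translate_eq X r t]
    exact hB i _ _
  have e2 : |translate (X t) φ x - translate (X r) φ x| ≤ L * ‖k‖ := by
    rw [translate_eq X r t]
    exact hL _ _
  have e3 : (∑ i, B i + L) * ‖k‖ ≤ (∑ i, B i + L) * (H * |t - r| ^ γ) :=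
    mul_le_mul_of_nonneg_left hk (by positivity)
  nlinarith

theorem pow_norm_sub_le {s t : ℝ} (hs : s ∈ Icc 0 T) (ht : t ∈ Icc 0 T) (n : ℕ) :
    ‖X t - X s‖ ^ n ≤ H ^ n * |t - s| ^ (n * γ) := by
  refine (pow_le_pow_left₀ (norm_nonneg _) (h.holder s hs t ht) n).trans (le_of_eq ?_)
  rw [mul_pow, mul_comm (n : ℝ) γ, Real.rpow_mul_natCast (abs_nonneg _)]

/-- The path `t ↦ w_t(φ(· + X_t))` is Hölder continuous. -/
theorem exists_holder_bound (hφ : IsTest φ) : ∃ L, 0 ≤ L ∧ ∀ s ∈ Icc 0 T, ∀ t ∈ Icc 0 T,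
    |pairing (w t) (translate (X t) φ) - pairing (w s) (translate (X s) φ)|
      ≤ L * |t - s| ^ γ := by
  have hC := h.toPath.nonneg
  have hT := h.time_nonneg
  have hH := h.holder_nonneg
  obtain ⟨L₁, hL₁0, hL₁⟩ := h.exists_time_bound hφ
  obtain ⟨L, hL0, hL⟩ := hφ.exists_taylor_zero
  obtain ⟨R, hR0, hR⟩ := hφ.exists_radius
  set V := volume.real (Metric.closedBall (0 : E d) (R + A)) with hV
  refine ⟨L₁ * T ^ (1 - γ) + C * (L * H * V), by positivity, fun s hs t ht => ?_⟩
  have h1 := hφ.translate (X t)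
  have h2 := hφ.translate (X s)
  have e1 : |pairing (w s) (translate (X t) φ) - pairing (w s) (translate (X s) φ)|
      ≤ C * (L * (H * |t - s| ^ γ) * V) := by
    rw [← pairing_sub (h.toPath.measurable_sol_slice s) (h.toPath.sol_le s) h1.integrable
      h2.integrable]
    refine abs_pairing_le_of_bound_ball (h.toPath.sol_le s) (h1.sub h2).integrable (fun x => ?_)
      fun x hx => by
        rw [h.translate_eq_zero hR ht x hx, h.translate_eq_zero hR hs x hx, sub_zero]
    rw [translate_eq X s t]
    exact (hL _ _).trans (mul_le_mul_of_nonneg_left (h.holder s hs t ht) hL0)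
  have e2 := hL₁ s hs t ht
  have e3 := mul_le_mul_of_nonneg_left
    (abs_le_rpow hs ht (p := γ) (by linarith [h.exponent_le])) hL₁0
  refine (abs_sub_le _ (pairing (w s) (translate (X t) φ)) _).trans ?_
  nlinarith

theorem pairing_sum_translate (s : ℝ) {φ : Fin d → E d → ℝ} (hφ : ∀ i, IsTest (φ i))
    (c : Fin d → ℝ) :
    pairing (w s) (fun x => ∑ i, c i * translate (X s) (φ i) x)
      = ∑ i, c i * pairing (w s) (translate (X s) (φ i)) :=
  pairing_sum (h.toPath.measurable_sol_slice s) (h.toPath.sol_le s) _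
    (fun i => ((hφ i).translate _).integrable) c

/-- The path `t ↦ w_t(φ(· + X_t))` is controlled by `X`. -/
theorem exists_remainder_bound (hφ : IsTest φ) : ∃ L, 0 ≤ L ∧ ∀ s ∈ Icc 0 T, ∀ t ∈ Icc 0 T,
    |pairing (w t) (translate (X t) φ) - pairing (w s) (translate (X s) φ)
      - ∑ i, pairing (w s) (translate (X s) (pd i φ)) * (X t i - X s i)|
      ≤ L * |t - s| ^ (2 * γ) := by
  have hC := h.toPath.nonneg
  have hT := h.time_nonneg
  have hH := h.holder_nonneg
  obtain ⟨L₁, hL₁0, hL₁⟩ := h.exists_time_bound hφ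
  obtain ⟨L, hL0, hL⟩ := hφ.exists_taylor_one
  obtain ⟨R, hR0, hR⟩ := hφ.exists_radius
  set V := volume.real (Metric.closedBall (0 : E d) (R + A)) with hV
  refine ⟨L₁ * T ^ (1 - 2 * γ) + C * (L * H ^ 2 * V), by positivity, fun s hs t ht => ?_⟩
  have h1 := hφ.translate (X t)
  have h2 := hφ.translate (X s)
  have h3 : IsTest (fun x => ∑ i, (X t - X s) i * translate (X s) (pd i φ) x) :=
    IsTest.sum _ (fun i => (hφ.pd i).translate _) _
  have hm := h.toPath.measurable_sol_slice s
  have e1 : |pairing (w s) (translate (X t) φ) - pairing (w s) (translate (X s) φ)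
      - ∑ i, pairing (w s) (translate (X s) (pd i φ)) * (X t i - X s i)|
      ≤ C * (L * (H ^ 2 * |t - s| ^ (2 * γ)) * V) := by
    have e0 : ∑ i, pairing (w s) (translate (X s) (pd i φ)) * (X t i - X s i)
        = pairing (w s) (fun x => ∑ i, (X t - X s) i * translate (X s) (pd i φ) x) := by
      rw [h.pairing_sum_translate s fun i => hφ.pd i]
      exact Finset.sum_congr rfl fun i _ => mul_comm _ _
    rw [e0, ← pairing_sub hm (h.toPath.sol_le s) h1.integrable h2.integrable,
      ← pairing_sub hm (h.toPath.sol_le s) (h1.sub h2).integrable h3.integrable]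
    refine abs_pairing_le_of_bound_ball (h.toPath.sol_le s) ((h1.sub h2).sub h3).integrable
      (fun x => ?_) fun x hx => by
        simp only [h.translate_eq_zero hR ht x hx, h.translate_eq_zero hR hs x hx,
          h.translate_eq_zero (pd_eq_zero_of_norm_lt hR _) hs x hx]
        simp
    rw [translate_eq X s t]
    exact (hL _ _).trans (mul_le_mul_of_nonneg_left (by
      simpa using h.pow_norm_sub_le hs ht 2) hL0)
  have e2 := hL₁ s hs t ht
  have e3 := mul_le_mul_of_nonneg_left
    (abs_le_rpow hs ht (p := 2 * γ) (by linarith [h.exponent_le])) hL₁0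
  have e4 : pairing (w t) (translate (X t) φ) - pairing (w s) (translate (X s) φ)
      - ∑ i, pairing (w s) (translate (X s) (pd i φ)) * (X t i - X s i)
      = (pairing (w t) (translate (X t) φ) - pairing (w s) (translate (X t) φ))
        + (pairing (w s) (translate (X t) φ) - pairing (w s) (translate (X s) φ)
      - ∑ i, pairing (w s) (translate (X s) (pd i φ)) * (X t i - X s i)) := by ring
  rw [e4]
  refine (abs_add_le _ _).trans ?_
  nlinarith

theorem measurable_drift_along (hφ : IsTest φ) :
    Measurable fun r => pairing (w r) (drift (b r) (g r) (translate (X r) φ)) := by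
  have hX := h.continuous
  have h1 : ∀ i r x, pd i (translate (X r) φ) x = pd i φ (x + X r) := fun i r x =>
    pd_comp_add φ (X r) i x
  have h2 : Measurable fun z : ℝ × E d => z.2 + X z.1 :=
    (by fun_prop : Continuous fun z : ℝ × E d => z.2 + X z.1).measurable
  have h3 : Measurable fun z : ℝ × E d => translate (X z.1) φ z.2 :=
    hφ.continuous.measurable.comp h2
  have h4 : ∀ i, Measurable fun z : ℝ × E d => pd i (translate (X z.1) φ) z.2 := by
    intro i
    simp only [h1]
    exact (hφ.pd i).continuous.measurable.comp h2
  exact measurable_pairing (Y := ℝ) (v := w)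
    (φ := fun r => drift (b r) (g r) (translate (X r) φ)) h.toPath.measurable_sol
    (measurable_drift_param (Y := ℝ) (b := b) (g := g) (φ := fun r => translate (X r) φ)
      h.toPath.measurable_field h.toPath.measurable_div h3 h4)

theorem intervalIntegrable_drift_along (hφ : IsTest φ) {s t : ℝ} (hs : s ∈ Icc 0 T)
    (ht : t ∈ Icc 0 T) : IntervalIntegrable
      (fun r => pairing (w r) (drift (b r) (g r) (translate (X r) φ))) volume s t := by
  have hK := h.toPath.growth_nonneg
  have hM := h.toPath.bound_nonneg
  have hC := h.toPath.nonneg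
  refine (intervalIntegrable_const (c := C * ((K + M) * ((1 + A) * ∫ x, testWeight φ x)))).mono_fun'
    (h.measurable_drift_along hφ).aestronglyMeasurable ?_
  filter_upwards [ae_restrict_mem measurableSet_uIoc] with r hr
  have hr' : r ∈ Icc 0 T := uIcc_subset_Icc hs ht (uIoc_subset_uIcc hr)
  refine (h.toPath.abs_pairing_drift_le (hφ.translate _) r).trans ?_
  gcongr
  exact hφ.integral_testWeight_translate_le (h.bound r hr')

/-- Freezing the shift at the right endpoint costs $|t-s|^\gamma$ per unit of time, hence
$|t-s|^{1+\gamma}$ in total, and $1+\gamma\ge3\gamma$ because $\gamma\le1/2$. -/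
theorem exists_integral_bound (hφ : IsTest φ) : ∃ L, 0 ≤ L ∧ ∀ s ∈ Icc 0 T, ∀ t ∈ Icc 0 T, s ≤ t →
    |pairing (w t) (translate (X t) φ) - pairing (w s) (translate (X t) φ)
      - ∫ r in s..t, pairing (w r) (drift (b r) (g r) (translate (X r) φ))|
      ≤ L * |t - s| ^ (3 * γ) := by
  have hT := h.time_nonneg
  have hγ := h.exponent_pos
  obtain ⟨L, hL0, hL⟩ := h.exists_drift_bound hφ
  refine ⟨L * T ^ (1 + γ - 3 * γ), by positivity, fun s hs t ht hst => ?_⟩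
  rw [h.pairing_sub_eq (hφ.translate _) hs ht, ← intervalIntegral.integral_sub
    (h.toPath.intervalIntegrable (hφ.translate _) _ _) (h.intervalIntegrable_drift_along hφ hs ht)]
  have h1 : ∀ r ∈ uIoc s t, ‖pairing (w r) (drift (b r) (g r) (translate (X t) φ))
      - pairing (w r) (drift (b r) (g r) (translate (X r) φ))‖ ≤ L * |t - s| ^ γ := by
    intro r hr
    rw [uIoc_of_le hst] at hr
    refine (hL r ⟨hs.1.trans hr.1.le, hr.2.trans ht.2⟩ t ht).trans ?_
    refine mul_le_mul_of_nonneg_left (Real.rpow_le_rpow (abs_nonneg _) ?_ hγ.le) hL0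
    rw [abs_of_nonneg (by linarith [hr.2]), abs_of_nonneg (by linarith)]
    linarith [hr.1]
  refine (intervalIntegral.norm_integral_le_of_norm_le_const h1).trans ?_
  have h2 := rpow_le_mul_rpow (p := 3 * γ) (q := 1 + γ) (abs_nonneg (t - s))
    (abs_sub_le_of_mem_Icc hs ht) (by linarith) (by linarith [h.exponent_le])
  rw [Real.rpow_add' (abs_nonneg _) (by linarith), Real.rpow_one] at h2
  have h3 := mul_le_mul_of_nonneg_left h2 hL0
  linarith

theorem pairing_double_sum_translate (s : ℝ) {φ : Fin d → Fin d → E d → ℝ}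
    (hφ : ∀ i j, IsTest (φ i j)) (c : Fin d → ℝ) :
    pairing (w s) (fun x => (1 / 2) * ∑ i, c i * ∑ j, c j * translate (X s) (φ i j) x)
      = (1 / 2) * ∑ i, ∑ j, c i * c j * pairing (w s) (translate (X s) (φ i j)) := by
  have h1 := pairing_sum (h.toPath.measurable_sol_slice s) (h.toPath.sol_le s) Finset.univ
    (fun p : Fin d × Fin d => ((hφ p.1 p.2).translate (X s)).integrable)
    (fun p => (1 / 2) * (c p.1 * c p.2))
  simp only [Fintype.sum_prod_type] at h1
  have h2 : (fun x => (1 / 2) * ∑ i, c i * ∑ j, c j * translate (X s) (φ i j) x)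
      = fun x => ∑ i, ∑ j, (1 / 2) * (c i * c j) * translate (X s) (φ i j) x := by
    funext x
    simp only [Finset.mul_sum]
    exact Finset.sum_congr rfl fun i _ => Finset.sum_congr rfl fun j _ => by ring
  rw [h2, h1]
  simp only [Finset.mul_sum]
  exact Finset.sum_congr rfl fun i _ => Finset.sum_congr rfl fun j _ => by ring

/-- The increments of `t ↦ w_t(φ(· + X_t))` agree, up to an error of order `3γ`, with the drift
and the compensated Riemann sums. -/
theorem exists_rough_bound (hφ : IsTest φ) {XX : ℝ → ℝ → Fin d → Fin d → ℝ}
    (hXX : ∀ s t, 0 ≤ s → s ≤ t → t ≤ T → ∀ i j,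
      XX s t i j + XX s t j i = (X t i - X s i) * (X t j - X s j)) :
    ∃ L, 0 ≤ L ∧ ∀ s ∈ Icc 0 T, ∀ t ∈ Icc 0 T, s ≤ t →
    |pairing (w t) (translate (X t) φ) - pairing (w s) (translate (X s) φ)
      - (∫ r in s..t, pairing (w r) (drift (b r) (g r) (translate (X r) φ)))
      - ((∑ i, pairing (w s) (translate (X s) (pd i φ)) * (X t i - X s i))
        + ∑ i, ∑ j, pairing (w s) (translate (X s) (pd j (pd i φ))) * XX s t j i)|
      ≤ L * |t - s| ^ (3 * γ) := by
  have hC := h.toPath.nonneg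
  have hT := h.time_nonneg
  have hH := h.holder_nonneg
  obtain ⟨L₁, hL₁0, hL₁⟩ := h.exists_integral_bound hφ
  obtain ⟨L, hL0, hL⟩ := hφ.exists_taylor_two
  obtain ⟨R, hR0, hR⟩ := hφ.exists_radius
  set V := volume.real (Metric.closedBall (0 : E d) (R + A)) with hV
  refine ⟨L₁ + C * (L * H ^ 3 * V), by positivity, fun s hs t ht hst => ?_⟩
  set k : E d := X t - X s with hk
  have hki : ∀ i, X t i - X s i = k i := fun i => rfl
  have h1 := hφ.translate (X t)
  have h2 := hφ.translate (X s)
  have h3 : IsTest (fun x => ∑ i, k i * translate (X s) (pd i φ) x) :=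
    IsTest.sum _ (fun i => (hφ.pd i).translate _) _
  have h4 : IsTest (fun x => (1 / 2) * ∑ i, k i * ∑ j, k j * translate (X s) (pd j (pd i φ)) x) :=
    (IsTest.sum _ (fun i => IsTest.sum _ (fun j => ((hφ.pd i).pd j).translate _) _) _).const_mul _
  have hm := h.toPath.measurable_sol_slice s
  have hw := h.toPath.sol_le s
  have hsum1 : ∑ i, pairing (w s) (translate (X s) (pd i φ)) * k i
      = pairing (w s) (fun x => ∑ i, k i * translate (X s) (pd i φ) x) := by
    rw [h.pairing_sum_translate s fun i => hφ.pd i]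
    exact Finset.sum_congr rfl fun i _ => mul_comm _ _
  -- The coefficients are symmetric in `i`, `j`, so `XX` may be replaced by half of its sum with its
  -- transpose, that is by $\frac12k\otimes k$: the quadratic Taylor term appears.
  have hsum2 : ∑ i, ∑ j, pairing (w s) (translate (X s) (pd j (pd i φ))) * XX s t j i
      = pairing (w s) (fun x =>
        (1 / 2) * ∑ i, k i * ∑ j, k j * translate (X s) (pd j (pd i φ)) x) := by
    rw [h.pairing_double_sum_translate s (φ := fun i j => pd j (pd i φ))
      (fun i j => (hφ.pd i).pd j) k]
    set c : Fin d → Fin d → ℝ := fun i j => pairing (w s) (translate (X s) (pd j (pd i φ))) with hc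
    have hcs : ∀ i j, c i j = c j i := by
      intro i j
      simp only [hc]
      congr 1
      funext x
      exact hφ.pd_comm j i (x + X s)
    have e1 : ∑ i, ∑ j, c i j * XX s t j i = ∑ i, ∑ j, c i j * XX s t i j := by
      rw [Finset.sum_comm]
      exact Finset.sum_congr rfl fun i _ => Finset.sum_congr rfl fun j _ => by rw [hcs]
    have e2 : ∑ i, ∑ j, k i * k j * c i j
        = ∑ i, ∑ j, c i j * XX s t j i + ∑ i, ∑ j, c i j * XX s t i j := by
      rw [← Finset.sum_add_distrib]
      refine Finset.sum_congr rfl fun i _ => ?_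
      rw [← Finset.sum_add_distrib]
      refine Finset.sum_congr rfl fun j _ => ?_
      have := hXX s t hs.1 hst ht.2 j i
      rw [hki, hki] at this
      rw [← mul_add, this]
      ring
    change ∑ i, ∑ j, c i j * XX s t j i = (1 / 2) * ∑ i, ∑ j, k i * k j * c i j
    rw [e2, ← e1]
    ring
  have e1 : |pairing (w s) (translate (X t) φ) - pairing (w s) (translate (X s) φ)
      - ((∑ i, pairing (w s) (translate (X s) (pd i φ)) * (X t i - X s i))
        + ∑ i, ∑ j, pairing (w s) (translate (X s) (pd j (pd i φ))) * XX s t j i)|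
      ≤ C * (L * (H ^ 3 * |t - s| ^ (3 * γ)) * V) := by
    simp only [hki]
    rw [hsum1, hsum2, ← sub_sub, ← pairing_sub hm hw h1.integrable h2.integrable,
      ← pairing_sub hm hw (h1.sub h2).integrable h3.integrable,
      ← pairing_sub hm hw ((h1.sub h2).sub h3).integrable h4.integrable]
    refine abs_pairing_le_of_bound_ball hw (((h1.sub h2).sub h3).sub h4).integrable
      (fun x => ?_) fun x hx => by
        simp only [h.translate_eq_zero hR ht x hx, h.translate_eq_zero hR hs x hx,
          h.translate_eq_zero (pd_eq_zero_of_norm_lt hR _) hs x hx,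
          h.translate_eq_zero (pd_eq_zero_of_norm_lt (pd_eq_zero_of_norm_lt hR _) _) hs x hx]
        simp
    rw [translate_eq X s t]
    exact (hL _ _).trans (mul_le_mul_of_nonneg_left (by
      simpa using h.pow_norm_sub_le hs ht 3) hL0)
  have e2 := hL₁ s hs t ht hst
  have e4 : pairing (w t) (translate (X t) φ) - pairing (w s) (translate (X s) φ)
      - (∫ r in s..t, pairing (w r) (drift (b r) (g r) (translate (X r) φ)))
      - ((∑ i, pairing (w s) (translate (X s) (pd i φ)) * (X t i - X s i))
        + ∑ i, ∑ j, pairing (w s) (translate (X s) (pd j (pd i φ))) * XX s t j i)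
      = (pairing (w t) (translate (X t) φ) - pairing (w s) (translate (X t) φ)
        - ∫ r in s..t, pairing (w r) (drift (b r) (g r) (translate (X r) φ)))
        + (pairing (w s) (translate (X t) φ) - pairing (w s) (translate (X s) φ)
      - ((∑ i, pairing (w s) (translate (X s) (pd i φ)) * (X t i - X s i))
        + ∑ i, ∑ j, pairing (w s) (translate (X s) (pd j (pd i φ))) * XX s t j i)) := by ring
  rw [e4]
  refine (abs_add_le _ _).trans ?_
  nlinarith

end IsShiftedSolution

/-! ### Convergence of the compensated sums and the rough integral. -/

/-- Riemann sums whose local error is of an order larger than one converge. -/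
theorem exists_mesh_bound {T L p : ℝ} (hL : 0 ≤ L) (hp : 1 < p) {f : ℝ → ℝ → ℝ}
    {F : ℝ → ℝ} (hf : ∀ s ∈ Icc 0 T, ∀ t ∈ Icc 0 T, s ≤ t → |F t - F s - f s t| ≤ L * |t - s| ^ p)
    {ε : ℝ} (hε : 0 < ε) : ∃ δ > 0, ∀ t ∈ Icc 0 T, ∀ (n : ℕ) (τ : ℕ → ℝ), τ 0 = 0 → τ n = t →
      (∀ k < n, τ k ≤ τ (k + 1) ∧ τ (k + 1) - τ k < δ) →
      |(∑ k ∈ Finset.range n, f (τ k) (τ (k + 1))) - (F t - F 0)| < ε := by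
  have hp' : 0 < p - 1 := by linarith
  -- Against the telescoping sum of `F`, the local errors add up to at most
  -- $L\delta^{p-1}\sum_k(\tau_{k+1}-\tau_k)\le L\delta^{p-1}T$.
  have hlim : Tendsto (fun δ : ℝ => L * δ ^ (p - 1) * T) (𝓝[>] 0) (𝓝 0) := by
    have h1 : ContinuousAt (fun δ : ℝ => L * δ ^ (p - 1) * T) 0 :=
      ((Real.continuousAt_rpow_const 0 (p - 1) (Or.inr hp'.le)).const_mul L).mul_const T
    have h2 := h1.tendsto
    simp only [Real.zero_rpow hp'.ne', mul_zero, zero_mul] at h2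
    exact h2.mono_left nhdsWithin_le_nhds
  obtain ⟨δ, hδ, hδ0⟩ := ((hlim.eventually_lt_const hε).and self_mem_nhdsWithin).exists
  refine ⟨δ, hδ0, fun t ht n τ h0 hn hτ => ?_⟩
  have hmono : ∀ k ≤ n, ∀ l ≤ k, τ l ≤ τ k := by
    intro k
    induction k with
    | zero => intro _ l hl; rw [Nat.le_zero.1 hl]
    | succ k ih =>
      intro hk l hl
      rcases Nat.le_succ_iff.1 hl with h | h
      · exact (ih (by omega) l h).trans (hτ k (by omega)).1
      · rw [h]
  have hmem : ∀ k ≤ n, τ k ∈ Icc 0 T := fun k hk =>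
    ⟨h0 ▸ hmono k hk 0 (Nat.zero_le _), (hmono n le_rfl k hk).trans (hn ▸ ht.2)⟩
  have htel : F t - F 0 = ∑ k ∈ Finset.range n, (F (τ (k + 1)) - F (τ k)) := by
    rw [Finset.sum_range_sub (fun k => F (τ k)), hn, h0]
  have htel2 : ∑ k ∈ Finset.range n, (τ (k + 1) - τ k) = t := by
    rw [Finset.sum_range_sub, hn, h0, sub_zero]
  rw [htel, ← Finset.sum_sub_distrib]
  refine lt_of_le_of_lt (Finset.abs_sum_le_sum_abs _ _) ?_
  calc ∑ k ∈ Finset.range n, |f (τ k) (τ (k + 1)) - (F (τ (k + 1)) - F (τ k))|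
      ≤ ∑ k ∈ Finset.range n, L * δ ^ (p - 1) * (τ (k + 1) - τ k) := by
        refine Finset.sum_le_sum fun k hk => ?_
        have hk' := Finset.mem_range.1 hk
        rw [abs_sub_comm]
        refine (hf _ (hmem k hk'.le) _ (hmem (k + 1) hk') (hτ k hk').1).trans ?_
        have hΔ : 0 ≤ τ (k + 1) - τ k := sub_nonneg.2 (hτ k hk').1
        rw [abs_of_nonneg hΔ, mul_assoc]
        refine mul_le_mul_of_nonneg_left ?_ hL
        have h1 := Real.rpow_add' hΔ (y := p - 1) (z := 1) (by linarith)
        rw [sub_add_cancel, Real.rpow_one] at h1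
        rw [h1]
        exact mul_le_mul_of_nonneg_right (Real.rpow_le_rpow hΔ (hτ k hk').2.le hp'.le) hΔ
    _ = L * δ ^ (p - 1) * t := by rw [← Finset.mul_sum, htel2]
    _ ≤ L * δ ^ (p - 1) * T :=
        mul_le_mul_of_nonneg_left ht.2 (mul_nonneg hL (Real.rpow_nonneg (le_of_lt hδ0) _))
    _ < ε := hδ

namespace IsShiftedSolution

variable {d : ℕ} {T γ H A K M C : ℝ} {X Z : ℝ → E d} {b : ℝ → E d → E d}
    {g : ℝ → E d → ℝ} {u₀ : E d → ℝ} {w : ℝ → E d → ℝ} {φ : E d → ℝ}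
    (h : IsShiftedSolution T γ H A K M C Z b g u₀ w) (hXZ : ∀ t ∈ Icc 0 T, X t = Z t)
include h hXZ

theorem isControlled (hφ : IsTest φ) :
    IsControlled T γ X (fun t => pairing (w t) (translate (Z t) φ))
      (fun t i => pairing (w t) (translate (Z t) (pd i φ))) := by
  have hγ := h.exponent_pos
  obtain ⟨L, hL0, hL⟩ := h.exists_holder_bound hφ
  choose B hB0 hB using fun i => h.exists_holder_bound (hφ.pd i)
  obtain ⟨R, hR0, hR⟩ := h.exists_remainder_bound hφ
  have hy : MemC1 T γ (fun t => pairing (w t) (translate (Z t) φ)) := memC1_of_holder hγ hL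
  have hy' : MemC1 T γ (fun t i => pairing (w t) (translate (Z t) (pd i φ))) := by
    refine memC1_of_holder (A := ∑ i, B i) hγ fun s hs t ht => ?_
    have hp : 0 ≤ |t - s| ^ γ := by positivity
    refine (pi_norm_le_iff_of_nonneg
      (mul_nonneg (Finset.sum_nonneg fun i _ => hB0 i) hp)).2 fun i => ?_
    refine (hB i s hs t ht).trans (mul_le_mul_of_nonneg_right ?_ hp)
    exact Finset.single_le_sum (fun i _ => hB0 i) (Finset.mem_univ i)
  refine ⟨hy, hy', ?_, ?_, ?_⟩
  · have hX : ContinuousOn X (Icc 0 T) := h.continuous.continuousOn.congr hXZ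
    have hf : MapsTo Prod.fst (Icc (0 : ℝ) T ×ˢ Icc (0 : ℝ) T) (Icc 0 T) := fun q hq => hq.1
    have hs : MapsTo Prod.snd (Icc (0 : ℝ) T ×ˢ Icc (0 : ℝ) T) (Icc 0 T) := fun q hq => hq.2
    have hXi : ∀ i, ContinuousOn (fun t => X t i) (Icc 0 T) := fun i =>
      (EuclideanSpace.proj i : E d →L[ℝ] ℝ).continuous.comp_continuousOn hX
    have hyi : ∀ i, ContinuousOn (fun t => pairing (w t) (translate (Z t) (pd i φ))) (Icc 0 T) :=
      fun i => (continuous_apply i).comp_continuousOn hy'.continuousOn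
    refine ((hy.continuousOn.comp continuousOn_snd hs).sub
      (hy.continuousOn.comp continuousOn_fst hf)).sub (continuousOn_finsetSum _ fun i _ => ?_)
    exact ((hyi i).comp continuousOn_fst hf).mul
      (((hXi i).comp continuousOn_snd hs).sub ((hXi i).comp continuousOn_fst hf))
  · intro s _
    simp
  · refine twoParamNorm_lt_top (A := R) fun s hs t ht => ?_
    rw [hXZ s hs, hXZ t ht]
    exact hR s hs t ht

/-- The integral is identified by its local expansion: the increment of the path minus the drift
agrees with one compensated summand up to $|t-s|^{3\gamma}$, and $3\gamma>1$. -/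
theorem hasRoughIntegral (hγ : 1 / 3 < γ) (hφ : IsTest φ) {XX : ℝ → ℝ → Fin d → Fin d → ℝ}
    (hXX : ∀ s t, 0 ≤ s → s ≤ t → t ≤ T → ∀ i j,
      XX s t i j + XX s t j i = (X t i - X s i) * (X t j - X s j)) {t : ℝ} (ht : t ∈ Icc 0 T) :
    HasRoughIntegral X XX (fun r i => pairing (w r) (translate (Z r) (pd i φ)))
      (fun r i j => pairing (w r) (translate (Z r) (pd j (pd i φ)))) 0 t
      (pairing (w t) (translate (Z t) φ) - pairing (w 0) (translate (Z 0) φ)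
        - ∫ r in (0 : ℝ)..t, pairing (w r) (drift (b r) (g r) (translate (Z r) φ))) := by
  obtain ⟨L, hL0, hL⟩ := h.exists_rough_bound hφ (XX := XX) fun s t hs hst ht i j => by
    rw [← hXZ t ⟨hs.trans hst, ht⟩, ← hXZ s ⟨hs, hst.trans ht⟩]
    exact hXX s t hs hst ht i j
  intro ε hε
  have h0 : (0 : ℝ) ∈ Icc 0 T := ⟨le_rfl, h.time_nonneg⟩
  obtain ⟨δ, hδ0, hδ⟩ := exists_mesh_bound (T := T) (L := L) (p := 3 * γ) hL0 (by linarith)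
    (f := fun s t => (∑ i, pairing (w s) (translate (Z s) (pd i φ)) * (X t i - X s i))
        + ∑ i, ∑ j, pairing (w s) (translate (Z s) (pd j (pd i φ))) * XX s t j i)
    (F := fun t => pairing (w t) (translate (Z t) φ)
      - ∫ r in (0 : ℝ)..t, pairing (w r) (drift (b r) (g r) (translate (Z r) φ)))
    (fun s hs t ht hst => by
      have h1 := hL s hs t ht hst
      rw [← intervalIntegral.integral_interval_sub_left (h.intervalIntegrable_drift_along hφ h0 ht)
        (h.intervalIntegrable_drift_along hφ h0 hs)] at h1
      simp only [hXZ s hs, hXZ t ht]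
      refine le_trans (le_of_eq ?_) h1
      congr 1
      ring) hε
  refine ⟨δ, hδ0, fun n τ hτ0 hτn hτ => ?_⟩
  have h2 := hδ t ht n τ hτ0 hτn hτ
  simp only [intervalIntegral.integral_same, sub_zero] at h2
  rw [sub_right_comm]
  exact h2

end IsShiftedSolution

/-! ### Versions with everywhere bounds, continuous paths, and a change of measure. -/

section Versions

variable {d : ℕ}

theorem exists_bounded_version {α F : Type*} [MeasurableSpace α] {μ : Measure α}
    [NormedAddCommGroup F] [MeasurableSpace F] [BorelSpace F] {f : α → F} (hf : MemLp f ∞ μ) :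
    ∃ f' : α → F, Measurable f' ∧ (∃ C, 0 ≤ C ∧ ∀ x, ‖f' x‖ ≤ C) ∧ f =ᵐ[μ] f' := by
  obtain ⟨C, hC⟩ : ∃ C, ∀ᵐ x ∂μ, ‖f x‖ ≤ C := by
    refine ⟨(eLpNormEssSup f μ).toReal, ?_⟩
    have hlt : eLpNormEssSup f μ ≠ ⊤ := by
      rw [← eLpNorm_exponent_top]
      exact hf.2.ne
    filter_upwards [ae_le_eLpNormEssSup (f := f) (μ := μ)] with x hx
    rw [← toReal_enorm]
    exact ENNReal.toReal_mono hlt hx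
  set f₁ := hf.1.mk f
  have hm : Measurable f₁ := hf.1.stronglyMeasurable_mk.measurable
  have hS : MeasurableSet {x | ‖f₁ x‖ ≤ C} :=
    measurableSet_le hf.1.stronglyMeasurable_mk.norm.measurable measurable_const
  refine ⟨{x | ‖f₁ x‖ ≤ C}.indicator f₁, hm.indicator hS, ⟨max C 0, le_max_right _ _, fun x => ?_⟩, ?_⟩
  · by_cases hx : x ∈ {x | ‖f₁ x‖ ≤ C}
    · rw [indicator_of_mem hx]
      exact le_max_of_le_left hx
    · rw [indicator_of_notMem hx, norm_zero]
      exact le_max_right _ _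
  · filter_upwards [hf.1.ae_eq_mk, hC] with x h1 h2
    rw [h1] at h2
    rw [indicator_of_mem (by exact h2)]
    exact h1

theorem ae_slices {Ω : Type*} [MeasurableSpace Ω] {P : Measure Ω} [SFinite P] {T : ℝ}
    {p : Ω × ℝ × E d → Prop} (h : ∀ᵐ z ∂(spaceTime P T d), p z) :
    ∀ᵐ ω ∂P, ∀ᵐ t ∂(volume.restrict (Icc (0 : ℝ) T)), ∀ᵐ x, p (ω, t, x) := by
  filter_upwards [Measure.ae_ae_of_ae_prod h] with ω hω
  exact Measure.ae_ae_of_ae_prod hω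

theorem IsWeakDiv.congr {b b' : E d → E d} {g g' : E d → ℝ} (h : IsWeakDiv b g)
    (hb : b =ᵐ[volume] b') (hg : g =ᵐ[volume] g') : IsWeakDiv b' g' := by
  intro φ hφ
  have h1 : ∫ x, ∑ i, b' x i * pd i φ x = ∫ x, ∑ i, b x i * pd i φ x :=
    integral_congr_ae (by filter_upwards [hb] with x hx; rw [hx])
  have h2 : ∫ x, g' x * φ x = ∫ x, g x * φ x :=
    integral_congr_ae (by filter_upwards [hg] with x hx; rw [hx])
  rw [h1, h2, h φ hφ]

theorem IsWeakDiv.translate {b : E d → E d} {g : E d → ℝ} (h : IsWeakDiv b g) (a : E d) :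
    IsWeakDiv (fun x => b (x + a)) (fun x => g (x + a)) := by
  intro φ hφ
  have h1 := h _ (hφ.translate (-a))
  rw [← integral_add_right_eq_self _ a, ← integral_add_right_eq_self (fun x => g x * _) a] at h1
  have h2 : ∀ i x, pd i (RTE.translate (-a) φ) (x + a) = pd i φ x := by
    intro i x
    have := pd_comp_add φ (-a) i (x + a)
    rwa [add_neg_cancel_right] at this
  simpa [h2, RTE.translate] using h1

theorem pairing_translate (v φ : E d → ℝ) (a : E d) :
    pairing (fun x => v (x - a)) φ = pairing v (translate a φ) := by
  unfold pairing
  rw [← integral_add_right_eq_self _ a]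
  simp [translate]

theorem translate_drift (b : E d → E d) (g φ : E d → ℝ) (a : E d) :
    translate a (drift b g φ)
      = drift (fun x => b (x + a)) (fun x => g (x + a)) (translate a φ) := by
  funext x
  have h1 : ∀ i, pd i (translate a φ) x = pd i φ (x + a) := fun i => pd_comp_add φ a i x
  change drift b g φ (x + a) = _
  simp only [drift, h1]
  rfl

theorem drift_congr {b b' : E d → E d} {g g' : E d → ℝ} (φ : E d → ℝ) (hb : b =ᵐ[volume] b')
    (hg : g =ᵐ[volume] g') : drift b g φ =ᵐ[volume] drift b' g' φ := by
  filter_upwards [hb, hg] with x h1 h2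
  simp only [drift, h1, h2]

theorem pairing_congr {v v' φ φ' : E d → ℝ} (hv : v =ᵐ[volume] v') (hφ : φ =ᵐ[volume] φ') :
    pairing v φ = pairing v' φ' :=
  integral_congr_ae (by filter_upwards [hv, hφ] with x h1 h2; rw [h1, h2])

/-- A process with almost surely continuous paths on `[0,T]` has a jointly measurable version
with continuous, bounded paths. -/
theorem exists_continuous_version {Ω : Type*} [MeasurableSpace Ω] {P : Measure Ω} {T : ℝ}
    (hT : 0 ≤ T) {X : Ω → ℝ → E d} (hXm : ∀ t ∈ Icc (0 : ℝ) T, Measurable fun ω => X ω t)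
    (hX : ∀ᵐ ω ∂P, ContinuousOn (X ω) (Icc 0 T)) :
    ∃ (Z : Ω → ℝ → E d) (S : Ω → ℝ), (∀ ω, Continuous (Z ω)) ∧
      (Measurable fun z : Ω × ℝ => Z z.1 z.2) ∧ Measurable S ∧ (∀ ω t, ‖Z ω t‖ ≤ S ω) ∧
      ∀ᵐ ω ∂P, ∀ t ∈ Icc 0 T, X ω t = Z ω t := by
  classical
  obtain ⟨N, hNsub, hNm, hN0⟩ := exists_measurable_superset_of_null hX
  -- Off a measurable null set the path is extended by its endpoint values, on it the path is zero.
  -- Continuity in `t` and measurability in ω at each `t` then give joint measurability.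
  set Z : Ω → ℝ → E d := fun ω => if ω ∈ N then fun _ => 0 else fun t => X ω (projIcc 0 T hT t)
    with hZ
  have hZc : ∀ ω, Continuous (Z ω) := by
    intro ω
    by_cases hω : ω ∈ N
    · simp only [hZ, if_pos hω]
      exact continuous_const
    · simp only [hZ, if_neg hω]
      have h1 : ContinuousOn (X ω) (Icc 0 T) := by
        by_contra hc
        exact hω (hNsub hc)
      exact h1.comp_continuous (continuous_subtype_val.comp continuous_projIcc)
        fun t => (projIcc 0 T hT t).2
  have hZt : ∀ t, Measurable fun ω => Z ω t := by
    intro t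
    have h1 : (fun ω => Z ω t) = fun ω => if ω ∈ N then 0 else X ω (projIcc 0 T hT t) := by
      funext ω
      simp only [hZ]
      split_ifs <;> rfl
    rw [h1]
    exact Measurable.ite hNm measurable_const (hXm _ (projIcc 0 T hT t).2)
  have hZm : Measurable fun z : Ω × ℝ => Z z.1 z.2 :=
    (measurable_uncurry_of_continuous_of_measurable (u := fun t ω => Z ω t) hZc hZt).comp
      measurable_swap
  have hbdd : ∀ ω, BddAbove (range fun q : ℚ => ‖Z ω q‖) := by
    intro ω
    obtain ⟨B, hB⟩ := isCompact_Icc.exists_bound_of_continuousOn (hZc ω).continuousOn (s := Icc 0 T)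
    refine ⟨B, ?_⟩
    rintro _ ⟨q, rfl⟩
    have h1 : Z ω q = Z ω (projIcc 0 T hT q) := by
      simp only [hZ]
      split_ifs
      · rfl
      · simp only [projIcc_val]
    simp only
    rw [h1]
    exact hB _ (projIcc 0 T hT q).2
  -- A supremum over rational times is measurable and, by continuity, bounds the norm at all times.
  refine ⟨Z, fun ω => ⨆ q : ℚ, ‖Z ω q‖, hZc, hZm, ?_, ?_, ?_⟩
  · exact Measurable.iSup fun q => (hZt q).norm
  · intro ω t
    have hcl : IsClosed {t : ℝ | ‖Z ω t‖ ≤ ⨆ q : ℚ, ‖Z ω q‖} :=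
      isClosed_le (hZc ω).norm continuous_const
    exact Rat.denseRange_cast.induction_on (p := fun t : ℝ => ‖Z ω t‖ ≤ ⨆ q : ℚ, ‖Z ω q‖) t hcl
      fun q => le_ciSup (hbdd ω) q
  · have hN : ∀ᵐ ω ∂P, ω ∉ N := measure_eq_zero_iff_ae_notMem.1 hN0
    filter_upwards [hN] with ω hω t ht
    simp only [hZ, if_neg hω]
    rw [projIcc_of_mem hT ht]

/-- There is an equivalent finite measure for which a given random variable is integrable. -/
theorem exists_equiv_finite_measure {Ω : Type*} [MeasurableSpace Ω] (P : Measure Ω)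
    [IsFiniteMeasure P] {K : Ω → ℝ} (hKm : Measurable K) (hK : ∀ ω, 0 ≤ K ω) :
    ∃ Q : Measure Ω, IsFiniteMeasure Q ∧ Q ≪ P ∧ P ≪ Q ∧ Integrable K Q := by
  -- The density is at most 1 and `K` times it as well, and it is positive, so null sets do not
  -- change. Almost sure statements obtained under `Q` therefore hold under `P`.
  set ρ : Ω → ℝ≥0∞ := fun ω => ENNReal.ofReal (1 + K ω)⁻¹ with hρ
  have hρm : Measurable ρ := (hKm.const_add 1).inv.ennreal_ofReal
  have hle : ∀ ω, (1 + K ω)⁻¹ ≤ 1 := fun ω => inv_le_one_of_one_le₀ (by linarith [hK ω])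
  refine ⟨P.withDensity ρ, ?_, withDensity_absolutelyContinuous _ _,
    withDensity_absolutelyContinuous' hρm.aemeasurable (ae_of_all _ fun ω => ?_), ?_⟩
  · refine isFiniteMeasure_withDensity (ne_of_lt ?_)
    calc ∫⁻ ω, ρ ω ∂P ≤ ∫⁻ _, 1 ∂P := lintegral_mono fun ω => by
          simpa [hρ] using ENNReal.ofReal_le_ofReal (hle ω)
      _ < ⊤ := by simp
  · have : 0 < (1 + K ω)⁻¹ := by have := hK ω; positivity
    simpa [hρ] using this
  · refine ⟨hKm.aestronglyMeasurable, ?_⟩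
    rw [hasFiniteIntegral_iff_ofReal (ae_of_all _ hK),
      lintegral_withDensity_eq_lintegral_mul _ hρm hKm.ennreal_ofReal]
    calc ∫⁻ ω, (ρ * fun ω => ENNReal.ofReal (K ω)) ω ∂P ≤ ∫⁻ _, 1 ∂P := lintegral_mono fun ω => by
          have h1 : 0 ≤ (1 + K ω)⁻¹ := by have := hK ω; positivity
          simp only [hρ, Pi.mul_apply]
          rw [← ENNReal.ofReal_mul h1, ← ENNReal.ofReal_one]
          refine ENNReal.ofReal_le_ofReal ?_
          have : 0 < 1 + K ω := by linarith [hK ω]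
          rw [inv_mul_le_iff₀ this]
          linarith
      _ < ⊤ := by simp

end Versions

/-! ### Passage to the moving frame and back. -/

section Main

variable {Ω : Type*} [MeasurableSpace Ω] {d : ℕ} {P : Measure Ω} {T : ℝ}

/-- The transport field seen from a moving frame. -/
theorem isTransportField_shift {Q : Measure Ω} {b : Ω → ℝ → E d → E d} {g : Ω → ℝ → E d → ℝ}
    {B M : ℝ} {Z : Ω → ℝ → E d} {S : Ω → ℝ}
    (hbm : Measurable fun z : Ω × ℝ × E d => b z.1 z.2.1 z.2.2)
    (hgm : Measurable fun z : Ω × ℝ × E d => g z.1 z.2.1 z.2.2)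
    (hB : 0 ≤ B) (hM : 0 ≤ M) (hb : ∀ ω t x, ‖b ω t x‖ ≤ B * (1 + ‖x‖))
    (hg : ∀ ω t x, |g ω t x| ≤ M) (hZm : Measurable fun z : Ω × ℝ => Z z.1 z.2)
    (hZ : ∀ ω t, ‖Z ω t‖ ≤ S ω) (hS : Integrable (fun ω => B * (1 + S ω)) Q)
    (hdiv : ∀ᵐ ω ∂Q, ∀ᵐ t ∂(volume.restrict (Icc (0 : ℝ) T)), IsWeakDiv (b ω t) (g ω t)) :
    IsTransportField Q T (fun ω => B * (1 + S ω)) M (fun ω t x => b ω t (x + Z ω t))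
      (fun ω t x => g ω t (x + Z ω t)) := by
  have hS0 : ∀ ω, 0 ≤ S ω := fun ω => (norm_nonneg _).trans (hZ ω 0)
  have hsh : Measurable fun z : Ω × ℝ × E d => (z.1, z.2.1, z.2.2 + Z z.1 z.2.1) := by
    have h1 : Measurable fun z : Ω × ℝ × E d => Z z.1 z.2.1 :=
      hZm.comp (f := fun z : Ω × ℝ × E d => (z.1, z.2.1)) (by fun_prop)
    fun_prop
  refine ⟨hbm.comp hsh, hgm.comp hsh, hS, fun ω => mul_nonneg hB (by linarith [hS0 ω]), hM,
    fun ω t x => ?_, fun ω t x => hg _ _ _, ?_⟩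
  · refine (hb _ _ _).trans ?_
    rw [mul_assoc]
    -- The growth constant of the shifted field comes from $1+|x+Z|\le(1+S)(1+|x|)$.
    refine mul_le_mul_of_nonneg_left ?_ hB
    have h1 := norm_add_le x (Z ω t)
    have h2 := mul_nonneg (hS0 ω) (norm_nonneg x)
    linarith [hZ ω t]
  · filter_upwards [hdiv] with ω hω
    filter_upwards [hω] with t ht using ht.translate _

end Main

/-- Existence of stochastic weak controlled solutions, for any process whose paths have geometric
rough lifts: no integrability of the lift is needed. -/
theorem exists_isStochasticWCS {Ω : Type*} [MeasurableSpace Ω] (P : Measure Ω) [IsProbabilityMeasure P]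
    (d : ℕ) (T : ℝ) (hT : 0 < T) (γ : ℝ) (hγ : 1 / 3 < γ) (hγ' : γ ≤ 1 / 2)
    (X : Ω → ℝ → E d) (XX : Ω → ℝ → ℝ → Fin d → Fin d → ℝ)
    (hXm : ∀ t ∈ Icc (0 : ℝ) T, Measurable (fun ω => X ω t))
    (hX : ∀ᵐ ω ∂P, IsGeometricRoughPath T γ (X ω) (XX ω))
    (b : Ω → ℝ → E d → E d) (hb : MemLinftyLin P T b)
    (divb : Ω → ℝ → E d → ℝ) (hdivb : MemLinfty P T divb)
    (hdiv : ∀ᵐ z ∂(P.prod (volume.restrict (Icc (0 : ℝ) T))),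
      IsWeakDiv (b z.1 z.2) (divb z.1 z.2))
    (u₀ : Ω → E d → ℝ)
    (hu₀ : MemLp (fun z : Ω × E d => u₀ z.1 z.2) ∞ (P.prod volume)) :
    ∃ u : Ω → ℝ → E d → ℝ, IsStochasticWCS P T γ X XX b divb u₀ u := by
  obtain ⟨f, hfm, ⟨B, hB0, hfB⟩, hbf⟩ := exists_bounded_version hb
  obtain ⟨g', hgm', ⟨M, hM0, hgM'⟩, hdg⟩ := exists_bounded_version hdivb
  obtain ⟨v', hvm', ⟨C, hC0, hvC'⟩, huv⟩ := exists_bounded_version hu₀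
  obtain ⟨Z, S, hZc, hZm, hSm, hZS, hXZ⟩ := exists_continuous_version hT.le hXm
    (hX.mono fun ω hω => hω.isRoughPath.path.continuousOn)
  have hS0 : ∀ ω, 0 ≤ S ω := fun ω => (norm_nonneg _).trans (hZS ω 0)
  set β : Ω → ℝ → E d → E d := fun ω t x => (1 + ‖x‖) • f (ω, t, x) with hβ
  set g : Ω → ℝ → E d → ℝ := fun ω t x => g' (ω, t, x) with hg
  have hβm : Measurable fun z : Ω × ℝ × E d => β z.1 z.2.1 z.2.2 := by
    have h1 : Measurable fun z : Ω × ℝ × E d => f (z.1, z.2.1, z.2.2) := hfm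
    have h2 : Measurable fun z : Ω × ℝ × E d => 1 + ‖z.2.2‖ := by fun_prop
    exact h2.smul h1
  have hgm : Measurable fun z : Ω × ℝ × E d => g z.1 z.2.1 z.2.2 := hgm'
  have hβB : ∀ ω t x, ‖β ω t x‖ ≤ B * (1 + ‖x‖) := by
    intro ω t x
    have h1 : (0 : ℝ) ≤ 1 + ‖x‖ := by positivity
    rw [hβ, norm_smul, Real.norm_of_nonneg h1, mul_comm]
    exact mul_le_mul_of_nonneg_right (hfB _) h1
  -- versions agree on almost all slices
  have hbβ : ∀ᵐ ω ∂P, ∀ᵐ t ∂(volume.restrict (Icc (0 : ℝ) T)), b ω t =ᵐ[volume] β ω t := by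
    filter_upwards [ae_slices hbf] with ω hω
    filter_upwards [hω] with t ht
    filter_upwards [ht] with x hx
    have h1 : (1 + ‖x‖ : ℝ) ≠ 0 := by positivity
    simp only [hβ]
    rw [← hx, smul_smul, mul_inv_cancel₀ h1, one_smul]
  have hdvg : ∀ᵐ ω ∂P, ∀ᵐ t ∂(volume.restrict (Icc (0 : ℝ) T)), divb ω t =ᵐ[volume] g ω t := by
    filter_upwards [ae_slices hdg] with ω hω
    filter_upwards [hω] with t ht
    filter_upwards [ht] with x hx using hx
  have huv' : ∀ᵐ ω ∂P, u₀ ω =ᵐ[volume] fun x => v' (ω, x) := Measure.ae_ae_of_ae_prod huv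
  have hdivβ : ∀ᵐ ω ∂P, ∀ᵐ t ∂(volume.restrict (Icc (0 : ℝ) T)), IsWeakDiv (β ω t) (g ω t) := by
    filter_upwards [Measure.ae_ae_of_ae_prod hdiv, hbβ, hdvg] with ω h1 h2 h3
    filter_upwards [h1, h2, h3] with t h4 h5 h6 using h4.congr h5 h6
  -- the equation in the moving frame
  obtain ⟨Q, hQ, hQP, hPQ, hKi⟩ := exists_equiv_finite_measure P
    (K := fun ω => B * (1 + S ω)) ((hSm.const_add 1).const_mul B)
    fun ω => mul_nonneg hB0 (by linarith [hS0 ω])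
  have hfield := isTransportField_shift hβm hgm hB0 hM0 hβB (fun ω t x => hgM' _) hZm hZS hKi
    (hQP.ae_le hdivβ)
  have hZ0 : Measurable fun z : Ω × E d => (z.1, z.2 + Z z.1 0) := by
    have h1 : Measurable fun z : Ω × E d => Z z.1 0 :=
      hZm.comp (f := fun z : Ω × E d => (z.1, (0 : ℝ))) (by fun_prop)
    fun_prop
  obtain ⟨w, hwm, hwC, hw⟩ := hfield.exists_regular_solution hT
    (u₀ := fun ω x => v' (ω, x + Z ω 0)) (hvm'.comp hZ0) (fun ω x => hvC' _) hC0
  have hpath := hfield.isTransportPath (u₀ := fun ω x => v' (ω, x + Z ω 0)) (hvm'.comp hZ0)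
    (fun ω x => hvC' _) hwm hwC
  have hum : Measurable fun z : Ω × ℝ × E d => w z.1 z.2.1 (z.2.2 - Z z.1 z.2.1) := by
    have h1 : Measurable fun z : Ω × ℝ × E d => Z z.1 z.2.1 :=
      hZm.comp (f := fun z : Ω × ℝ × E d => (z.1, z.2.1)) (by fun_prop)
    exact hwm.comp (f := fun z : Ω × ℝ × E d => (z.1, z.2.1, z.2.2 - Z z.1 z.2.1)) (by fun_prop)
  have hgood : ∀ᵐ ω ∂P, (∀ t ∈ Icc 0 T, X ω t = Z ω t) ∧ ∃ H, IsShiftedSolution T γ H (S ω)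
      (B * (1 + S ω)) M C (Z ω) (fun t x => β ω t (x + Z ω t)) (fun t x => g ω t (x + Z ω t))
      (fun x => v' (ω, x + Z ω 0)) (w ω) := by
    filter_upwards [hX, hXZ, hPQ.ae_le hw] with ω h1 h2 h3
    obtain ⟨H, hH0, hH⟩ := exists_bound_of_holderSeminorm_lt_top h1.isRoughPath.path.seminorm_lt_top
    have hHZ : ∀ s ∈ Icc 0 T, ∀ t ∈ Icc 0 T, ‖Z ω t - Z ω s‖ ≤ H * |t - s| ^ γ := by
      intro s hs t ht
      rw [← h2 s hs, ← h2 t ht]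
      exact hH s hs t ht
    have hγ0 : 0 < γ := by linarith
    exact ⟨h2, H, hpath ω, hT.le, hγ0, hγ', hH0, hZc ω, hHZ, fun t _ => hZS ω t, h3⟩
  -- The change of frame is undone with the jointly measurable version `Z`, which almost surely
  -- equals `X` on $[0,T]$.
  refine ⟨fun ω t x => w ω t (x - Z ω t), ?_⟩
  constructor
  · exact hum
  · exact memLp_top_of_bound hum.aestronglyMeasurable C (ae_of_all _ fun z => hwC _ _ _)
  · refine ae_of_all _ fun ω t _ => ?_
    exact memLp_top_of_bound (hum.comp (measurable_const.prodMk
      (measurable_const.prodMk measurable_id))).aestronglyMeasurable C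
      (ae_of_all _ fun z => hwC _ _ _)
  · filter_upwards [hgood] with ω hω φ hφ
    obtain ⟨hXZω, H, hsol⟩ := hω
    simp only [pairing_translate]
    exact hsol.isControlled hXZω hφ
  · filter_upwards [hgood, hX, hbβ, hdvg, huv'] with ω hω hXω hbω hdω huω φ hφ t ht
    obtain ⟨hXZω, H, hsol⟩ := hω
    have hI := hsol.hasRoughIntegral hXZω hγ hφ (XX := XX ω)
      (fun s t hs hst ht i j => hXω.add_swap hs hst ht i j) ht
    simp only [← pairing_translate] at hI
    refine ⟨_, hI, ?_⟩
    -- The initial datum of `w` was shifted by `Z ω 0`, and the translated test function undoes this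
    -- shift.
    have h0 : pairing (w ω 0) (translate (Z ω 0) φ) = pairing (u₀ ω) φ := by
      rw [hsol.equation 0 ⟨le_rfl, hT.le⟩ _ (hφ.translate _), weakRHS,
        intervalIntegral.integral_same, add_zero,
        pairing_congr (v' := fun x => v' (ω, x)) huω (ae_eq_refl φ)]
      unfold pairing translate
      exact integral_add_right_eq_self (fun x => v' (ω, x) * φ x) (Z ω 0)
    have hdr : ∫ s in (0 : ℝ)..t, pairing (fun x => w ω s (x - Z ω s))
          (fun x => (∑ i, b ω s x i * pd i φ x) + divb ω s x * φ x)
        = ∫ r in (0 : ℝ)..t, pairing (w ω r) (drift (fun x => β ω r (x + Z ω r))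
          (fun x => g ω r (x + Z ω r)) (translate (Z ω r) φ)) := by
      rw [intervalIntegral.integral_of_le ht.1, intervalIntegral.integral_of_le ht.1]
      refine integral_congr_ae ?_
      have hsub : Ioc 0 t ⊆ Icc 0 T := fun s hs => ⟨hs.1.le, hs.2.trans ht.2⟩
      filter_upwards [ae_restrict_of_ae_restrict_of_subset hsub hbω,
        ae_restrict_of_ae_restrict_of_subset hsub hdω] with s h1 h2
      -- The drift of the shifted fields on the translated φ is the translate of the original drift,
      -- so the drift integrals agree in both frames.
      rw [← translate_drift, ← pairing_translate]
      exact pairing_congr (ae_eq_refl _) (drift_congr φ h1 h2)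
    rw [← pairing_translate] at h0
    rw [hdr, h0]
    ring

end RTE

end

theorem mainTheorem5 {Ω : Type*} [MeasurableSpace Ω] (P : Measure Ω) [IsProbabilityMeasure P]
    (d : ℕ) (T : ℝ) (hT : 0 < T) (γ : ℝ) (hγ : 1 / 3 < γ) (hγ' : γ ≤ 1 / 2)
    -- a process with a measurable geometric rough path lift
    (X : Ω → ℝ → RTE.E d) (XX : Ω → ℝ → ℝ → Fin d → Fin d → ℝ)
    (hXm : ∀ t ∈ Icc (0 : ℝ) T, Measurable (fun ω => X ω t))
    (hXXm : ∀ s ∈ Icc (0 : ℝ) T, ∀ t ∈ Icc (0 : ℝ) T, Measurable (fun ω => XX ω s t))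
    (hX : ∀ᵐ ω ∂P, RTE.IsGeometricRoughPath T γ (X ω) (XX ω))
    -- a measurable smooth approximation that converges in every `L^p`
    (Y : ℕ → Ω → ℝ → RTE.E d)
    (hYm : ∀ n, ∀ t ∈ Icc (0 : ℝ) T, Measurable (fun ω => Y n ω t))
    (hY : ∀ n, ∀ᵐ ω ∂P, ContDiffOn ℝ 1 (Y n ω) (Icc 0 T))
    (hconv : ∀ p : ℝ, 1 ≤ p → Tendsto
      (fun n => ∫⁻ ω, RTE.roughDist T γ (X ω) (XX ω) (Y n ω) (RTE.naturalLift T (Y n ω)) ^ p ∂P)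
      atTop (𝓝 0))
    -- the vector field, its divergence and the initial condition
    (b : Ω → ℝ → RTE.E d → RTE.E d) (hb : RTE.MemLinftyLin P T b)
    (divb : Ω → ℝ → RTE.E d → ℝ) (hdivb : RTE.MemLinfty P T divb)
    (hdiv : ∀ᵐ z ∂(P.prod (volume.restrict (Icc (0 : ℝ) T))),
      RTE.IsWeakDiv (b z.1 z.2) (divb z.1 z.2))
    (u₀ : Ω → RTE.E d → ℝ)
    (hu₀ : MemLp (fun z : Ω × RTE.E d => u₀ z.1 z.2) ∞ (P.prod volume)) :
    ∃ u : Ω → ℝ → RTE.E d → ℝ, RTE.IsStochasticWCS P T γ X XX b divb u₀ u := by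
  exact RTE.exists_isStochasticWCS P d T hT γ hγ hγ' X XX hXm hX b hb divb hdivb hdiv u₀ hu₀
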